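/- For a complex Lie algebra $L$ let $H^n(L)$ be the $n$-th Chevalley--Eilenberg cohomology of $L$ with coefficients in the adjoint module, i.e. the cohomology of the complex $L_n=\mathrm{Hom}(\bigwedge^nL,L)$, $n\ge 0$ (in the language of coderivations: $D(\varphi)=[d,\varphi]$, where $d$ is the quadratic codifferential given by the bracket). Consider the following Lie algebra structures on $\mathbb C^4$ with basis $e_1,\dots,e_4$ (brackets of basis vectors not listed are zero): - $d_3=\mathfrak{sl}_2(\mathbb C)\oplus\mathbb C$: $[e_1,e_2]=e_3$, $[e_1,e_3]=e_2$, $[e_2,e_3]=e_1$; - $d_2^\sharp=\mathfrak r_2(\mathbb C)\oplus\mathfrak r_2(\mathbb C)$: $[e_1,e_2]=e_1$, $[e_3,e_4]=e_3$; - $d_1(\lambda:\mu)$, $(\lambda,\mu)\neq 0$: $[e_2,e_3]=e_1$, $[e_1,e_4]=(\lambda+\mu)e_1$, $[e_2,e_4]=\lambda e_2$, $[e_3,e_4]=e_2+\mu e_3$; - $d_1^\sharp$: $[e_2,e_3]=e_1$, $[e_1,e_4]=2e_1$, $[e_2,e_4]=e_2$, $[e_3,e_4]=e_3$; - $d_3(\lambda:\mu:\nu)$,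 $(\lambda,\mu,\nu)\ne0$: $[e_1,e_4]=\lambda e_1$, $[e_2,e_4]=e_1+\mu e_2$, $[e_3,e_4]=e_2+\nu e_3$; - $d_3(\lambda:\mu)$, $(\lambda,\mu)\ne0$: $[e_1,e_4]=\lambda e_1$, $[e_2,e_4]=\lambda e_2$, $[e_3,e_4]=e_2+\mu e_3$; - $d_1$: $[e_2,e_4]=e_1$; - $d_2^*$: $[e_2,e_4]=e_1$, $[e_3,e_4]=e_2$; - $d_3^*$: $[e_1,e_4]=e_1$, $[e_2,e_4]=e_2$, $[e_3,e_4]=e_3$. Every non-abelian $4$-dimensional complex Lie algebra is isomorphic to one of these, and the dimensions $(h^1,h^2,h^3,h^4)$ of $H^1,H^2,H^3,H^4$ are as follows. 1. $d_3$: $(1,0,1,1)$; $\quad d_2^\sharp$: $(0,0,0,0)$. 2. $d_1(\lambda:\mu)$: $(2,2,2,1)$ if $\lambda+\mu=0$, i.e. for $d_1(1:-1)$; $(1,2,1,0)$ if $\lambda\mu=0$, i.e. for $d_1(1:0)$ and $d_1(0:1)$; $(1,1,0,0)$ otherwise. 3. $d_1^\sharp$: $(3,3,0,0)$. 4. $d_3(\lambda:\mu:\nu)$: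 - $(3,5,5,2)$ if $\lambda\mu\nu=0$ and $\lambda+\mu+\nu=0$, i.e. for $(1:-1:0)$ and its permutations; - $(2,3,1,0)$ if $\lambda\mu\nu\neq0$ and one of $\lambda,\mu,\nu$ is the sum of the other two; - $(3,3,1,0)$ if $\lambda\mu\nu=0$ and $\lambda+\mu+\nu\ne0$; - $(2,2,1,1)$ if $\lambda\mu\nu\ne0$ and $\lambda+\mu+\nu=0$; - $(2,2,0,0)$ otherwise. 5. $d_3(\lambda:\mu)$: $(5,7,3,0)$ for $(1:0)$; $(6,6,2,0)$ for $(0:1)$; $(4,5,1,0)$ for $(1:2)$; $(4,4,1,1)$ for $(1:-2)$; $(4,4,0,0)$ otherwise. 6. $d_1$: $(8,13,10,3)$; $\quad d_2^*$: $(4,6,5,2)$; $\quad d_3^*$: $(8,8,0,0)$. (For the abelian Lie algebra $\mathbb C^4$ the dimensions are $(16,24,16,4)$.) In particular $H^2(d_3)=0$, and $d_3=\mathfrak{sl}_2(\mathbb C)\oplus\mathbb C$ is rigid; moreover $H^n(d_2^\sharp)=0$ for all $n\ge0$, and $d_2^\sharp=\mathfrak r_2(\mathbb C)\oplus\mathfrak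 r_2(\mathbb C)$ is rigid. Here a Lie algebra structure $d$ on $\mathbb C^4$ is called rigid if for every complete local $\mathbb C$-algebra $A$ with maximal ideal $\mathfrak m$ and residue field $\mathbb C$ (for instance $A=\mathbb C[[t]]$), every $A$-Lie algebra structure on $A^4$ that reduces to $d$ modulo $\mathfrak m$ is carried to the constant structure $d\otimes A$ by an $A$-linear automorphism of $A^4$ that reduces to the identity modulo $\mathfrak m$. -/

import Mathlib

open Module

namespace FourDimLie

/-! ### Chevalley–Eilenberg cohomology with adjoint coefficients -/

/-- The value of the Chevalley–Eilenberg coboundary of an `n`-cochain `φ` on `x₀, …, xₙ`: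
`∑ᵢ (-1)ⁱ [xᵢ, φ(x₀,…,x̂ᵢ,…,xₙ)] - ∑_{i<j} (-1)ⁱ φ(x₀,…,x̂ᵢ,…,[xᵢ,xⱼ],…,xₙ)`,
the bracket `[xᵢ,xⱼ]` standing at the place of `xⱼ`. (Moving it to the front costs the sign
`(-1)^(j-1)`, so the second part is the familiar `∑_{i<j} (-1)^(i+j) φ([xᵢ,xⱼ],…,x̂ᵢ,…,x̂ⱼ,…)`.) -/
def coboundaryFun {L : Type*} [LieRing L] [LieAlgebra ℂ L] {n : ℕ} (φ : L [⋀^Fin n]→ₗ[ℂ] L)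
    (x : Fin (n + 1) → L) : L :=
  ∑ i : Fin (n + 1), (-1 : ℤ) ^ (i : ℕ) •
    (⁅x i, φ (i.removeNth x)⁆ -
      ∑ j ∈ Finset.Ioi i, φ (i.removeNth (Function.update x j ⁅x i, x j⁆)))

/-- The linear map `x ↦ [x, φ(·)]`; used only to see that the coboundary is alternating. -/
def adComp {L : Type*} [LieRing L] [LieAlgebra ℂ L] {n : ℕ} (φ : L [⋀^Fin n]→ₗ[ℂ] L) :
    L →ₗ[ℂ] L [⋀^Fin n]→ₗ[ℂ] L where
  toFun x := LinearMap.compAlternatingMap (LieAlgebra.ad ℂ L x) φ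
  map_add' x y := by ext v; simp
  map_smul' c x := by ext v; simp

/-- The linear map `x ↦ ((v₁,…,vₙ) ↦ ∑ₖ φ(v₁,…,[x,vₖ],…,vₙ))`; used only to see that the
coboundary is alternating. -/
def insertAd {L : Type*} [LieRing L] [LieAlgebra ℂ L] :
    {n : ℕ} → (L [⋀^Fin n]→ₗ[ℂ] L) → (L →ₗ[ℂ] L [⋀^Fin n]→ₗ[ℂ] L)
  | 0, _ => 0
  | _ + 1, φ =>
    { toFun := fun x =>
        AlternatingMap.alternatizeUncurryFin (φ.curryLeft ∘ₗ (LieAlgebra.ad ℂ L x : L →ₗ[ℂ] L))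
      map_add' := fun x y => by
        rw [← AlternatingMap.alternatizeUncurryFin_add]; congr 1; ext; simp
      map_smul' := fun c x => by
        rw [RingHom.id_apply, ← AlternatingMap.alternatizeUncurryFin_smul]; congr 1; ext; simp }

theorem insertAd_apply {L : Type*} [LieRing L] [LieAlgebra ℂ L] {n : ℕ}
    (φ : L [⋀^Fin n]→ₗ[ℂ] L) (x : L) (v : Fin n → L) :
    insertAd φ x v = ∑ k, φ (Function.update v k ⁅x, v k⁆) := by
  cases n with
  | zero => simp [insertAd]
  | succ n =>
    simp only [insertAd, LinearMap.coe_mk, AddHom.coe_mk,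
      AlternatingMap.alternatizeUncurryFin_apply]
    refine Finset.sum_congr rfl fun k _ => ?_
    rw [← Fin.insertNth_removeNth, AlternatingMap.map_insertNth]
    rfl

theorem insert_swap {L : Type*} [LieRing L] [LieAlgebra ℂ L] {n : ℕ}
    (φ : L [⋀^Fin n]→ₗ[ℂ] L) (x : Fin (n + 1) → L) {i j : Fin (n + 1)} (h : i ≠ j) :
    (-1 : ℤ) ^ (i : ℕ) • φ (i.removeNth (Function.update x j ⁅x i, x j⁆)) =
      (-1 : ℤ) ^ (j : ℕ) • φ (j.removeNth (Function.update x i ⁅x j, x i⁆)) := by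
  have key := AlternatingMap.neg_one_pow_smul_map_removeNth_add_eq_zero_of_eq φ
    (v := Function.update (Function.update x j ⁅x i, x j⁆) i ⁅x i, x j⁆) (i := i) (j := j)
    (by simp [Function.update_of_ne h.symm]) h
  rw [Fin.removeNth_update, Function.update_comm h.symm, Fin.removeNth_update] at key
  rw [eq_neg_of_add_eq_zero_left key, ← smul_neg]
  congr 1
  obtain ⟨k, rfl⟩ := Fin.exists_succAbove_eq h
  rw [Fin.removeNth_update_succAbove, Fin.removeNth_update_succAbove, ← lie_skew,
    AlternatingMap.map_update_neg, neg_neg]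

theorem coboundaryFun_eq {L : Type*} [LieRing L] [LieAlgebra ℂ L] {n : ℕ}
    (φ : L [⋀^Fin n]→ₗ[ℂ] L) :
    coboundaryFun φ = ⇑(AlternatingMap.alternatizeUncurryFin (adComp φ) -
      (2⁻¹ : ℂ) • AlternatingMap.alternatizeUncurryFin (insertAd φ)) := by
  funext x
  set T : Fin (n + 1) → Fin (n + 1) → L := fun i j =>
    (-1 : ℤ) ^ (i : ℕ) • φ (i.removeNth (Function.update x j ⁅x i, x j⁆)) with hT
  have h1 : AlternatingMap.alternatizeUncurryFin (insertAd φ) x =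
      ∑ i, ∑ j ∈ {i}ᶜ, T i j := by
    rw [AlternatingMap.alternatizeUncurryFin_apply]
    refine Finset.sum_congr rfl fun i _ => ?_
    rw [insertAd_apply, Finset.smul_sum]
    have : ({i}ᶜ : Finset (Fin (n + 1))) = Finset.univ.map (Fin.succAboveEmb i) := by
      ext j; simp [← Fin.exists_succAbove_eq_iff]
    rw [this, Finset.sum_map]
    refine Finset.sum_congr rfl fun k _ => ?_
    simp only [hT, Fin.coe_succAboveEmb, Fin.removeNth_update_succAbove]
    rfl
  have h2 : ∑ i, ∑ j ∈ {i}ᶜ, T i j = (2 : ℂ) • ∑ i, ∑ j ∈ Finset.Ioi i, T i j := by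
    have hs : ∀ i : Fin (n + 1), ∑ j ∈ {i}ᶜ, T i j =
        ∑ j ∈ Finset.Ioi i, T i j + ∑ j ∈ Finset.Iio i, T i j := by
      intro i
      rw [← Finset.sum_union (Finset.disjoint_left.2 fun j h h' =>
        lt_asymm (Finset.mem_Ioi.1 h) (Finset.mem_Iio.1 h'))]
      refine Finset.sum_congr ?_ fun _ _ => rfl
      ext j
      simp only [Finset.mem_compl, Finset.mem_singleton, Finset.mem_union, Finset.mem_Ioi,
        Finset.mem_Iio]
      exact ⟨fun h => (lt_or_gt_of_ne h).symm, fun h => h.elim ne_of_gt ne_of_lt⟩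
    have hc : ∑ i, ∑ j ∈ Finset.Iio i, T i j = ∑ i, ∑ j ∈ Finset.Ioi i, T i j := by
      rw [Finset.sum_comm' (t' := Finset.univ) (s' := fun j => Finset.Ioi j) (by simp)]
      refine Finset.sum_congr rfl fun i _ => Finset.sum_congr rfl fun j hj => ?_
      exact insert_swap φ x (Finset.mem_Ioi.1 hj).ne'
    simp only [hs, Finset.sum_add_distrib, hc, two_smul]
  rw [AlternatingMap.sub_apply, AlternatingMap.smul_apply, h1, h2, smul_smul,
    inv_mul_cancel₀ two_ne_zero, one_smul, AlternatingMap.alternatizeUncurryFin_apply,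
    ← Finset.sum_sub_distrib]
  refine Finset.sum_congr rfl fun i _ => ?_
  rw [smul_sub, Finset.smul_sum]
  rfl

/-- The Chevalley–Eilenberg coboundary `D : Lₙ → Lₙ₊₁` on the space `Lₙ = Hom(⋀ⁿ L, L)` of
alternating `n`-linear maps with values in the adjoint module. -/
def coboundary (L : Type*) [LieRing L] [LieAlgebra ℂ L] (n : ℕ) :
    (L [⋀^Fin n]→ₗ[ℂ] L) →ₗ[ℂ] (L [⋀^Fin (n + 1)]→ₗ[ℂ] L) where
  toFun φ :=
    { toFun := coboundaryFun φ
      map_update_add' := fun v i x y => by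
        rw [coboundaryFun_eq]; exact AlternatingMap.map_update_add _ v i x y
      map_update_smul' := fun v i c x => by
        rw [coboundaryFun_eq]; exact AlternatingMap.map_update_smul _ v i c x
      map_eq_zero_of_eq' := fun v i j h hij => by
        rw [coboundaryFun_eq]; exact AlternatingMap.map_eq_zero_of_eq _ v h hij }
  map_add' φ ψ := by
    ext x
    simp only [AlternatingMap.coe_mk, MultilinearMap.coe_mk, AlternatingMap.add_apply,
      coboundaryFun, lie_add, ← Finset.sum_add_distrib, ← smul_add]
    refine Finset.sum_congr rfl fun i _ => ?_
    rw [Finset.sum_add_distrib]; congr 1; abel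
  map_smul' c φ := by
    ext x
    simp only [AlternatingMap.coe_mk, MultilinearMap.coe_mk, AlternatingMap.smul_apply,
      coboundaryFun, lie_smul, RingHom.id_apply]
    rw [Finset.smul_sum]
    refine Finset.sum_congr rfl fun i _ => ?_
    rw [← Finset.smul_sum, ← smul_sub, smul_comm c]

/-- The `n`-cocycles. -/
def cocycles (L : Type*) [LieRing L] [LieAlgebra ℂ L] (n : ℕ) :
    Submodule ℂ (L [⋀^Fin n]→ₗ[ℂ] L) :=
  LinearMap.ker (coboundary L n)

/-- The `n`-coboundaries. -/
def coboundaries (L : Type*) [LieRing L] [LieAlgebra ℂ L] :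
    (n : ℕ) → Submodule ℂ (L [⋀^Fin n]→ₗ[ℂ] L)
  | 0 => ⊥
  | n + 1 => LinearMap.range (coboundary L n)

/-- The cohomology `Hⁿ(L) = Hⁿ(L, L)`: cocycles modulo coboundaries (every coboundary is a cocycle, so
`submoduleOf` only regards the coboundaries as a subspace of the cocycles). -/
abbrev Cohomology (L : Type*) [LieRing L] [LieAlgebra ℂ L] (n : ℕ) : Type _ :=
  cocycles L n ⧸ (coboundaries L n).submoduleOf (cocycles L n)

/-- `H¹, H², H³, H⁴` of `L` have dimensions `h₁, h₂, h₃, h₄`. -/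
def HasCohomologyDims (L : Type*) [LieRing L] [LieAlgebra ℂ L] (h₁ h₂ h₃ h₄ : ℕ) : Prop :=
  finrank ℂ (Cohomology L 1) = h₁ ∧ finrank ℂ (Cohomology L 2) = h₂ ∧
    finrank ℂ (Cohomology L 3) = h₃ ∧ finrank ℂ (Cohomology L 4) = h₄

/-! ### Lie algebra structures on `A⁴` -/

/-- A Lie algebra structure on the free module `A⁴` over a commutative ring `A`. -/
structure LieStructure (A : Type*) [CommRing A] where
  /-- The bracket. -/
  br : (Fin 4 → A) →ₗ[A] (Fin 4 → A) →ₗ[A] (Fin 4 → A)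
  self : ∀ x, br x x = 0
  jacobi : ∀ x y z, br x (br y z) = br (br x y) z + br y (br x z)

/-- The module `A⁴` with the bracket of `d`. -/
def LieStructure.Alg {A : Type*} [CommRing A] (_ : LieStructure A) : Type _ := Fin 4 → A

instance {A : Type*} [CommRing A] (d : LieStructure A) : AddCommGroup d.Alg :=
  inferInstanceAs (AddCommGroup (Fin 4 → A))

instance {A : Type*} [CommRing A] (d : LieStructure A) : Module A d.Alg :=
  inferInstanceAs (Module A (Fin 4 → A))

instance {A : Type*} [CommRing A] (d : LieStructure A) : LieRing d.Alg where
  bracket x y := d.br x y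
  add_lie x y z := (congrArg (fun f => f z) (d.br.map_add x y)).trans rfl
  lie_add x y z := (d.br x).map_add y z
  lie_self x := d.self x
  leibniz_lie x y z := d.jacobi x y z

instance {A : Type*} [CommRing A] (d : LieStructure A) : LieAlgebra A d.Alg where
  lie_smul c x y := (d.br x).map_smul c y

/-- `psi i j k` is the bracket `ψ^{ij}_k` on `ℂ⁴` with `[e_i, e_j] = e_k = -[e_j, e_i]`, all other
brackets of basis vectors being zero (for `i ≠ j`). The basis `e₁, e₂, e₃, e₄` is indexed by
`0, 1, 2, 3 : Fin 4`. -/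
def psi (i j k : Fin 4) : (Fin 4 → ℂ) →ₗ[ℂ] (Fin 4 → ℂ) →ₗ[ℂ] (Fin 4 → ℂ) :=
  LinearMap.mk₂ ℂ (fun x y => (x i * y j - x j * y i) • Pi.single k (1 : ℂ))
    (fun x x' y => by rw [← add_smul]; congr 1; simp only [Pi.add_apply]; ring)
    (fun c x y => by rw [smul_smul]; congr 1; simp only [Pi.smul_apply, smul_eq_mul]; ring)
    (fun x y y' => by rw [← add_smul]; congr 1; simp only [Pi.add_apply]; ring)
    (fun c x y => by rw [smul_smul]; congr 1; simp only [Pi.smul_apply, smul_eq_mul]; ring)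

theorem psi_apply (i j k : Fin 4) (x y : Fin 4 → ℂ) :
    psi i j k x y = (x i * y j - x j * y i) • Pi.single k (1 : ℂ) := rfl

/-- `d₃`: `[e₁,e₂] = e₃`, `[e₁,e₃] = e₂`, `[e₂,e₃] = e₁`; this is `sl₂(ℂ) ⊕ ℂ`. -/
def d3 : LieStructure ℂ where
  br := psi 0 1 2 + psi 0 2 1 + psi 1 2 0
  self x := by funext k; simp [psi_apply, mul_comm]
  jacobi x y z := by
    funext k; fin_cases k <;> simp [psi_apply] <;> ring

/-- `d₂♯`: `[e₁,e₂] = e₁`, `[e₃,e₄] = e₃`; this is `r₂(ℂ) ⊕ r₂(ℂ)`. -/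
def d2Sharp : LieStructure ℂ where
  br := psi 0 1 0 + psi 2 3 2
  self x := by funext k; simp [psi_apply, mul_comm]
  jacobi x y z := by
    funext k; fin_cases k <;> simp [psi_apply] <;> ring

/-- `d₁(l:m)`: `[e₂,e₃] = e₁`, `[e₁,e₄] = (l+m)e₁`, `[e₂,e₄] = l e₂`, `[e₃,e₄] = e₂ + m e₃`. -/
def d1Fam (l m : ℂ) : LieStructure ℂ where
  br := psi 1 2 0 + (l + m) • psi 0 3 0 + l • psi 1 3 1 + psi 2 3 1 + m • psi 2 3 2
  self x := by funext k; simp [psi_apply, mul_comm]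
  jacobi x y z := by
    funext k; fin_cases k <;> simp [psi_apply] <;> ring

/-- `d₁♯`: `[e₂,e₃] = e₁`, `[e₁,e₄] = 2e₁`, `[e₂,e₄] = e₂`, `[e₃,e₄] = e₃`. -/
def d1Sharp : LieStructure ℂ where
  br := psi 1 2 0 + (2 : ℂ) • psi 0 3 0 + psi 1 3 1 + psi 2 3 2
  self x := by funext k; simp [psi_apply, mul_comm]
  jacobi x y z := by
    funext k; fin_cases k <;> simp [psi_apply] <;> ring

/-- `d₃(l:m:n)`: `[e₁,e₄] = l e₁`, `[e₂,e₄] = e₁ + m e₂`, `[e₃,e₄] = e₂ + n e₃`. -/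
def d3Big (l m n : ℂ) : LieStructure ℂ where
  br := l • psi 0 3 0 + psi 1 3 0 + m • psi 1 3 1 + psi 2 3 1 + n • psi 2 3 2
  self x := by funext k; simp [psi_apply, mul_comm]
  jacobi x y z := by
    funext k; fin_cases k <;> simp [psi_apply] <;> ring

/-- `d₃(l:m)`: `[e₁,e₄] = l e₁`, `[e₂,e₄] = l e₂`, `[e₃,e₄] = e₂ + m e₃`. -/
def d3Small (l m : ℂ) : LieStructure ℂ where
  br := l • psi 0 3 0 + l • psi 1 3 1 + psi 2 3 1 + m • psi 2 3 2
  self x := by funext k; simp [psi_apply, mul_comm]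
  jacobi x y z := by
    funext k; fin_cases k <;> simp [psi_apply] <;> ring

/-- `d₁`: `[e₂,e₄] = e₁`. -/
def d1 : LieStructure ℂ where
  br := psi 1 3 0
  self x := by funext k; simp [psi_apply, mul_comm]
  jacobi x y z := by
    funext k; fin_cases k <;> simp [psi_apply]

/-- `d₂*`: `[e₂,e₄] = e₁`, `[e₃,e₄] = e₂`. -/
def d2Star : LieStructure ℂ where
  br := psi 1 3 0 + psi 2 3 1
  self x := by funext k; simp [psi_apply, mul_comm]
  jacobi x y z := by
    funext k; fin_cases k <;> simp [psi_apply] <;> ring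

/-- `d₃*`: `[e₁,e₄] = e₁`, `[e₂,e₄] = e₂`, `[e₃,e₄] = e₃`. -/
def d3Star : LieStructure ℂ where
  br := psi 0 3 0 + psi 1 3 1 + psi 2 3 2
  self x := by funext k; simp [psi_apply, mul_comm]
  jacobi x y z := by
    funext k; fin_cases k <;> simp [psi_apply] <;> ring

/-! ### Formal deformations and rigidity -/

/-- The bracket `[e_i, e_j]` of `d` read in `A⁴`, for a commutative `ℂ`-algebra `A`. -/
def LieStructure.bracketIn (d : LieStructure ℂ) (A : Type*) [CommRing A] [Algebra ℂ A]
    (i j : Fin 4) : Fin 4 → A :=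
  fun k => algebraMap ℂ A (d.br (Pi.single i 1) (Pi.single j 1) k)

/-- `D` is a deformation of `d` with base the local ring `A`: a Lie algebra structure on `A⁴` that
reduces to `d` modulo the maximal ideal. -/
def IsDeformation (d : LieStructure ℂ) {A : Type*} [CommRing A] [IsLocalRing A] [Algebra ℂ A]
    (D : LieStructure A) : Prop :=
  ∀ i j k, D.br (Pi.single i 1) (Pi.single j 1) k - d.bracketIn A i j k ∈
    IsLocalRing.maximalIdeal A

/-- `D` is equivalent to the trivial deformation of `d`: some automorphism `g` of `A⁴` that is the
identity modulo the maximal ideal carries the constant structure `d` to `D`. -/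
def IsTrivialDeformation (d : LieStructure ℂ) {A : Type*} [CommRing A] [IsLocalRing A]
    [Algebra ℂ A] (D : LieStructure A) : Prop :=
  ∃ g : (Fin 4 → A) ≃ₗ[A] (Fin 4 → A),
    (∀ i k, g (Pi.single i 1) k - (Pi.single i 1 : Fin 4 → A) k ∈ IsLocalRing.maximalIdeal A) ∧
    ∀ i j, g (d.bracketIn A i j) = D.br (g (Pi.single i 1)) (g (Pi.single j 1))

/-- `d` is (formally) rigid as a Lie algebra: every deformation of `d` with base a complete local
`ℂ`-algebra with residue field `ℂ`, such as `ℂ[[t]]`, is equivalent to the trivial one. -/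
def IsRigid (d : LieStructure ℂ) : Prop :=
  ∀ (A : Type) [CommRing A] [IsLocalRing A] [Algebra ℂ A]
    [IsAdicComplete (IsLocalRing.maximalIdeal A) A],
    Function.Bijective (algebraMap ℂ (IsLocalRing.ResidueField A)) →
      ∀ D : LieStructure A, IsDeformation d D → IsTrivialDeformation d D

end FourDimLie

namespace FourDimLie

/-! ### Cartan calculus on cochains and D² = 0. -/

section Cartan

variable {L : Type*} [LieRing L] [LieAlgebra ℂ L] {n : ℕ}

/-! Dimensions. Contraction and Lie derivative satisfy Cartan's formula ι_x D + D ι_x = L_x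
(`curryLeft_coboundary`), and induction on the degree gives D² = 0. By rank and nullity the numbers
zₙ = dim ker(D on Lₙ) then determine the table: hₙ = zₙ + zₙ₋₁ - dim Lₙ₋₁, with z₄ = 4. All algebras
of the table belong to one nine-parameter family of brackets (`HasBracket`), for which D is written
out once in coordinates. Each zₙ is certified from two sides: some cocycle equations that imply all
the others bound the rank, some coordinates that determine a cocycle bound the nullity, and the two
numbers add up to dim Lₙ (`finrank_cocycles_of_rows`). In several families explicit cocycles,
polynomial in the parameters, replace the list of equations (`finrank_cocycles_of_free`).
Isomorphisms that permute λ, μ, ν reduce the cases of d₃(λ:μ:ν).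

Classification. The argument runs over the dimension of the derived algebra L'. Dimension 4 is
impossible: a perfect algebra is unimodular, so its four structure 2-forms would be independent and
span a totally isotropic subspace of the six-dimensional Λ² with its wedge pairing
(`finrank_derived_ne_four`). If there is a nilpotent ideal of codimension one, it is abelian or
Heisenberg, and the normal form of a complementary element acting on it, or on its quotient by the
centre, gives all algebras except d₃ and d₂♯ (`classified_of_nilpotent`). Such an ideal exists when
dim L' = 1. When dim L' = 2, the algebra L' is abelian and a complement acts on it by commuting
triangular matrices; either a combination of them is nilpotent, which gives the ideal, or the
weights are independent and L is d₂♯. When dim L' = 3, either L' is nilpotent by Engel's theorem, or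
a nonzero eigenvalue together with vanishing traces produces sl₂ and L is d₃.

Rigidity. If H² = 0, a deformation is trivialised order by order. The failure of the current frame
to carry the constant structure to the deformed one is, to leading order, a 2-cocycle; a primitive
of it corrects the frame by one order, and completeness provides the limit (`exists_correction`,
`exists_defect_eq_zero`). The primitive is given by a fixed ℂ-linear formula, which can be applied
to cocycles with values in any quotient of the base ring. -/

theorem coboundary_apply (φ : L [⋀^Fin n]→ₗ[ℂ] L) (x : Fin (n + 1) → L) :
    coboundary L n φ x = coboundaryFun φ x := rfl

/-- The Lie derivative of a cochain along `x`. -/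
def lieDeriv (x : L) : (L [⋀^Fin n]→ₗ[ℂ] L) →ₗ[ℂ] (L [⋀^Fin n]→ₗ[ℂ] L) where
  toFun φ := adComp φ x - insertAd φ x
  map_add' φ ψ := by
    ext v
    simp only [AlternatingMap.sub_apply, AlternatingMap.add_apply, insertAd_apply, adComp,
      LinearMap.coe_mk, AddHom.coe_mk, LinearMap.compAlternatingMap_apply, LieAlgebra.ad_apply,
      lie_add, Finset.sum_add_distrib]
    abel
  map_smul' c φ := by
    ext v
    simp only [AlternatingMap.sub_apply, AlternatingMap.smul_apply, insertAd_apply, adComp,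
      LinearMap.coe_mk, AddHom.coe_mk, LinearMap.compAlternatingMap_apply, LieAlgebra.ad_apply,
      lie_smul, RingHom.id_apply, ← Finset.smul_sum, smul_sub]

theorem lieDeriv_apply (x : L) (φ : L [⋀^Fin n]→ₗ[ℂ] L) (v : Fin n → L) :
    lieDeriv x φ v = ⁅x, φ v⁆ - ∑ k, φ (Function.update v k ⁅x, v k⁆) := by
  rw [← insertAd_apply]; rfl

/-- Reduces an identity of cochains to one in lower degree; all identities of the calculus are
proved by induction this way. -/
theorem ext_curryLeft {φ ψ : L [⋀^Fin (n + 1)]→ₗ[ℂ] L}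
    (h : ∀ x, φ.curryLeft x = ψ.curryLeft x) : φ = ψ := by
  ext v
  have := DFunLike.congr_fun (h (v 0)) (Fin.tail v)
  rw [AlternatingMap.curryLeft_apply_apply, AlternatingMap.curryLeft_apply_apply] at this
  rwa [Matrix.vecCons, Fin.cons_self_tail] at this

/-- The commutation rule ι_y L_x = L_x ι_y - ι_[x,y]: the first argument contributes the extra term
of the sum. -/
theorem curryLeft_lieDeriv (x y : L) (φ : L [⋀^Fin (n + 1)]→ₗ[ℂ] L) :
    (lieDeriv x φ).curryLeft y = lieDeriv x (φ.curryLeft y) - φ.curryLeft ⁅x, y⁆ := by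
  ext v
  simp only [AlternatingMap.curryLeft_apply_apply, lieDeriv_apply, AlternatingMap.sub_apply,
    Fin.sum_univ_succ, Matrix.vecCons, Fin.cons_zero, Fin.cons_succ, Fin.update_cons_zero,
    ← Fin.cons_update]
  abel

theorem curryLeft_coboundary_zero (x : L) (φ : L [⋀^Fin 0]→ₗ[ℂ] L) :
    (coboundary L 0 φ).curryLeft x = lieDeriv x φ := by
  ext v
  rw [AlternatingMap.curryLeft_apply_apply, coboundary_apply, coboundaryFun, lieDeriv_apply,
    Fin.sum_univ_one, Subsingleton.elim (Fin.removeNth (0 : Fin 1) (Matrix.vecCons x v)) v]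
  simp

/-- Cartan's formula. The summand i = 0 of D, with x in front, is exactly L_x φ; the summands i + 1
carry one more sign and form -D(ι_x φ). -/
theorem curryLeft_coboundary (x : L) (φ : L [⋀^Fin (n + 1)]→ₗ[ℂ] L) :
    (coboundary L (n + 1) φ).curryLeft x = lieDeriv x φ - coboundary L n (φ.curryLeft x) := by
  ext v
  have hI : (Finset.Ioi (0 : Fin (n + 1 + 1))) = Finset.univ.map (Fin.succEmb _) := by
    ext j; refine Fin.cases ?_ (fun j => ?_) j <;> simp
  simp only [AlternatingMap.curryLeft_apply_apply, AlternatingMap.sub_apply, coboundary_apply,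
    lieDeriv_apply, coboundaryFun]
  rw [Fin.sum_univ_succ, sub_eq_add_neg _ (∑ i, _), ← Finset.sum_neg_distrib]
  congr 1
  · rw [hI, Finset.sum_map]
    simp [Matrix.vecCons, Fin.removeNth_zero, ← Fin.cons_update, sub_eq_add_neg]
  · refine Finset.sum_congr rfl fun i _ => ?_
    have hs : Finset.Ioi i.succ = (Finset.Ioi i).map (Fin.succEmb _) := by
      ext j; refine Fin.cases ?_ (fun j => ?_) j <;> simp
    have hr : ∀ w : Fin (n + 1) → L, Fin.removeNth i.succ (Fin.cons x w : Fin (n + 1 + 1) → L) =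
        Fin.cons x (i.removeNth w) := by
      intro w
      ext j; refine Fin.cases ?_ (fun j => ?_) j <;> simp [Fin.removeNth]
    rw [hs, Finset.sum_map]
    simp only [Matrix.vecCons, Fin.coe_succEmb, Fin.cons_succ, ← Fin.cons_update, hr,
      Fin.val_succ, pow_succ]
    simp

theorem lieDeriv_lie (x y : L) (φ : L [⋀^Fin n]→ₗ[ℂ] L) :
    lieDeriv x (lieDeriv y φ) - lieDeriv y (lieDeriv x φ) = lieDeriv ⁅x, y⁆ φ := by
  induction n with
  | zero => ext v; simp [lieDeriv_apply]
  | succ n ih =>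
    refine ext_curryLeft fun z => ?_
    have hsub : ∀ a b : L [⋀^Fin (n + 1)]→ₗ[ℂ] L,
      (a - b).curryLeft z = a.curryLeft z - b.curryLeft z := fun _ _ => rfl
    simp only [hsub, curryLeft_lieDeriv, map_sub, ← ih, lie_lie]
    abel

/-- Contracting with y and inserting Cartan's formula reduces the claim to the preceding degree and
to L_[x,y] = [L_x, L_y]. -/
theorem lieDeriv_coboundary (x : L) (φ : L [⋀^Fin n]→ₗ[ℂ] L) :
    lieDeriv x (coboundary L n φ) = coboundary L n (lieDeriv x φ) := by
  induction n with
  | zero =>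
    refine ext_curryLeft fun y => ?_
    rw [curryLeft_lieDeriv, curryLeft_coboundary_zero, curryLeft_coboundary_zero,
      curryLeft_coboundary_zero, ← lieDeriv_lie]
    abel
  | succ n ih =>
    refine ext_curryLeft fun y => ?_
    rw [curryLeft_lieDeriv, curryLeft_coboundary, curryLeft_coboundary, curryLeft_coboundary,
      curryLeft_lieDeriv, map_sub, map_sub, ih, ← lieDeriv_lie]
    abel

/-- By Cartan's formula ι_y D² = L_y D - D ι_y D = L_y D - D L_y + D² ι_y; the first two terms
cancel and the last vanishes by induction. -/
theorem coboundary_coboundary (φ : L [⋀^Fin n]→ₗ[ℂ] L) :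
    coboundary L (n + 1) (coboundary L n φ) = 0 := by
  induction n with
  | zero =>
    refine ext_curryLeft fun y => ?_
    rw [curryLeft_coboundary, curryLeft_coboundary_zero, lieDeriv_coboundary, sub_self]
    rfl
  | succ n ih =>
    refine ext_curryLeft fun y => ?_
    rw [curryLeft_coboundary, curryLeft_coboundary, map_sub, ih, sub_zero, lieDeriv_coboundary,
      sub_self]
    rfl

end Cartan

/-! ### Dimension count for the complex. -/

section Dimensions

variable (L : Type*) [LieRing L] [LieAlgebra ℂ L]

theorem coboundaries_le_cocycles (n : ℕ) : coboundaries L n ≤ cocycles L n := by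
  cases n with
  | zero => exact bot_le
  | succ n =>
    rintro _ ⟨φ, rfl⟩
    exact coboundary_coboundary φ

variable [Module.Finite ℂ L]

instance (n : ℕ) : Module.Finite ℂ (L [⋀^Fin n]→ₗ[ℂ] L) :=
  Module.Finite.equiv (exteriorPower.alternatingMapLinearEquiv (R := ℂ) (M := L) (N := L)
    (n := n)).symm

theorem finrank_cochains (n : ℕ) :
    finrank ℂ (L [⋀^Fin n]→ₗ[ℂ] L) = (finrank ℂ L).choose n * finrank ℂ L := by
  rw [(exteriorPower.alternatingMapLinearEquiv (R := ℂ) (M := L) (N := L)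
    (n := n)).finrank_eq, finrank_linearMap, exteriorPower.finrank_eq]

theorem finrank_cohomology_add (n : ℕ) :
    finrank ℂ (Cohomology L n) + finrank ℂ (coboundaries L n) = finrank ℂ (cocycles L n) := by
  rw [← (Submodule.submoduleOfEquivOfLe (coboundaries_le_cocycles L n)).finrank_eq]
  exact Submodule.finrank_quotient_add_finrank _

theorem finrank_coboundaries_add (n : ℕ) :
    finrank ℂ (coboundaries L (n + 1)) + finrank ℂ (cocycles L n) =
      (finrank ℂ L).choose n * finrank ℂ L := by
  rw [← finrank_cochains]
  exact LinearMap.finrank_range_add_finrank_ker (coboundary L n)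

theorem subsingleton_cochains {n : ℕ} (h : finrank ℂ L < n) :
    Subsingleton (L [⋀^Fin n]→ₗ[ℂ] L) := by
  rw [← finrank_zero_iff (R := ℂ), finrank_cochains, Nat.choose_eq_zero_of_lt h, zero_mul]

theorem finrank_cocycles_top {n : ℕ} (h : finrank ℂ L = n) : finrank ℂ (cocycles L n) = n := by
  have := subsingleton_cochains L (n := n + 1) (by omega)
  have hk : cocycles L n = ⊤ := by
    rw [cocycles, LinearMap.ker_eq_top]
    exact Subsingleton.elim _ _
  rw [hk, finrank_top, finrank_cochains, h, Nat.choose_self, one_mul]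

/-- The dimensions of the cocycle spaces determine those of the cohomology. -/
theorem hasCohomologyDims_of_cocycles (hL : finrank ℂ L = 4) {z₀ z₁ z₂ z₃ h₁ h₂ h₃ h₄ : ℕ}
    (c₀ : finrank ℂ (cocycles L 0) = z₀) (c₁ : finrank ℂ (cocycles L 1) = z₁)
    (c₂ : finrank ℂ (cocycles L 2) = z₂) (c₃ : finrank ℂ (cocycles L 3) = z₃)
    (e₁ : h₁ + 4 = z₁ + z₀) (e₂ : h₂ + 16 = z₂ + z₁) (e₃ : h₃ + 24 = z₃ + z₂)
    (e₄ : h₄ + 12 = z₃) : HasCohomologyDims L h₁ h₂ h₃ h₄ := by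
  have a := finrank_cohomology_add L
  have b := finrank_coboundaries_add L
  have c₄ := finrank_cocycles_top L hL
  have a1 := a 1; have a2 := a 2; have a3 := a 3; have a4 := a 4
  -- The ascriptions write the degree `0 + 1` as a numeral, so that `omega` meets the same quantity
  -- here and in `a1`, …, `a4`.
  have b0 : finrank ℂ (coboundaries L 1) + _ = _ := b 0
  have b1 : finrank ℂ (coboundaries L 2) + _ = _ := b 1
  have b2 : finrank ℂ (coboundaries L 3) + _ = _ := b 2
  have b3 : finrank ℂ (coboundaries L 4) + _ = _ := b 3
  simp only [hL, Nat.choose] at b0 b1 b2 b3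
  -- The spaces L₀, …, L₃ have dimensions 4, 16, 24, 16, and L₄ consists of 4 dimensions of
  -- cocycles; this explains 4, 16, 24 and 12 = 16 - 4 in the hypotheses.
  refine ⟨?_, ?_, ?_, ?_⟩ <;> omega

end Dimensions

/-! ### The coboundary in degrees 0 to 3. -/

section Curry

variable {L : Type*} [LieRing L] [LieAlgebra ℂ L]

/-- A `1`-cochain as a linear map. -/
def cur1 (φ : L [⋀^Fin 1]→ₗ[ℂ] L) : L →ₗ[ℂ] L where
  toFun x := φ ![x]
  map_add' x y := DFunLike.congr_fun (φ.curryLeft.map_add x y) ![]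
  map_smul' c x := DFunLike.congr_fun (φ.curryLeft.map_smul c x) ![]

/-- A `2`-cochain as a bilinear map. -/
def cur2 (φ : L [⋀^Fin 2]→ₗ[ℂ] L) : L →ₗ[ℂ] L →ₗ[ℂ] L where
  toFun x := cur1 (φ.curryLeft x)
  map_add' x y := by ext z; exact DFunLike.congr_fun (φ.curryLeft.map_add x y) ![z]
  map_smul' c x := by ext z; exact DFunLike.congr_fun (φ.curryLeft.map_smul c x) ![z]

/-- A `3`-cochain as a trilinear map. -/
def cur3 (φ : L [⋀^Fin 3]→ₗ[ℂ] L) : L →ₗ[ℂ] L →ₗ[ℂ] L →ₗ[ℂ] L where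
  toFun x := cur2 (φ.curryLeft x)
  map_add' x y := by ext z w; exact DFunLike.congr_fun (φ.curryLeft.map_add x y) ![z, w]
  map_smul' c x := by ext z w; exact DFunLike.congr_fun (φ.curryLeft.map_smul c x) ![z, w]

theorem cur1_apply (φ : L [⋀^Fin 1]→ₗ[ℂ] L) (x : L) : cur1 φ x = φ ![x] := rfl

theorem cur2_apply (φ : L [⋀^Fin 2]→ₗ[ℂ] L) (x y : L) : cur2 φ x y = φ ![x, y] := rfl

theorem cur3_apply (φ : L [⋀^Fin 3]→ₗ[ℂ] L) (x y z : L) : cur3 φ x y z = φ ![x, y, z] := rfl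

theorem cur2_self (φ : L [⋀^Fin 2]→ₗ[ℂ] L) (x : L) : cur2 φ x x = 0 :=
  φ.map_eq_zero_of_eq ![x, x] (i := 0) (j := 1) rfl (by decide)

theorem cur2_swap (φ : L [⋀^Fin 2]→ₗ[ℂ] L) (x y : L) : cur2 φ y x = -cur2 φ x y := by
  have := cur2_self φ (x + y)
  simp only [map_add, LinearMap.add_apply, cur2_self, zero_add, add_zero] at this
  exact eq_neg_of_add_eq_zero_left this

theorem cur3_self_right (φ : L [⋀^Fin 3]→ₗ[ℂ] L) (x y : L) : cur3 φ x y y = 0 :=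
  cur2_self (φ.curryLeft x) y

theorem cur3_self_left (φ : L [⋀^Fin 3]→ₗ[ℂ] L) (x y : L) : cur3 φ x x y = 0 :=
  φ.map_eq_zero_of_eq ![x, x, y] (i := 0) (j := 1) rfl (by decide)

theorem cur3_swap_right (φ : L [⋀^Fin 3]→ₗ[ℂ] L) (x y z : L) :
    cur3 φ x z y = -cur3 φ x y z :=
  cur2_swap (φ.curryLeft x) y z

theorem cur3_swap_left (φ : L [⋀^Fin 3]→ₗ[ℂ] L) (x y z : L) :
    cur3 φ y x z = -cur3 φ x y z := by
  have := cur3_self_left φ (x + y) z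
  simp only [map_add, LinearMap.add_apply, cur3_self_left, zero_add, add_zero] at this
  exact eq_neg_of_add_eq_zero_left this

theorem update_vec_one {α : Type*} (x a : α) : Function.update ![x] 0 a = ![a] := by
  ext i; fin_cases i; rfl

theorem update_vec_two {α : Type*} (x y a : α) :
    Function.update ![x, y] 0 a = ![a, y] ∧ Function.update ![x, y] 1 a = ![x, a] := by
  constructor <;> ext i <;> fin_cases i <;> rfl

theorem update_vec_three {α : Type*} (x y z a : α) :
    Function.update ![x, y, z] 0 a = ![a, y, z] ∧ Function.update ![x, y, z] 1 a = ![x, a, z] ∧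
      Function.update ![x, y, z] 2 a = ![x, y, a] := by
  refine ⟨?_, ?_, ?_⟩ <;> ext i <;> fin_cases i <;> rfl

/-- This and the next three formulas are obtained one from another by Cartan's formula, which avoids
expanding the general double sum. -/
theorem coboundary_zero_apply (φ : L [⋀^Fin 0]→ₗ[ℂ] L) (x : L) :
    coboundary L 0 φ ![x] = ⁅x, φ ![]⁆ := by
  have := DFunLike.congr_fun (curryLeft_coboundary_zero x φ) ![]
  simpa [lieDeriv_apply] using this

theorem coboundary_one_apply (φ : L [⋀^Fin 1]→ₗ[ℂ] L) (x y : L) :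
    coboundary L 1 φ ![x, y] = ⁅x, cur1 φ y⁆ - cur1 φ ⁅x, y⁆ - ⁅y, cur1 φ x⁆ := by
  have := DFunLike.congr_fun (curryLeft_coboundary x φ) ![y]
  rw [AlternatingMap.sub_apply, coboundary_zero_apply] at this
  simpa [lieDeriv_apply, cur1_apply, update_vec_one] using this

theorem coboundary_two_apply (φ : L [⋀^Fin 2]→ₗ[ℂ] L) (x y z : L) :
    coboundary L 2 φ ![x, y, z] = ⁅x, cur2 φ y z⁆ - (cur2 φ ⁅x, y⁆ z + cur2 φ y ⁅x, z⁆) -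
      (⁅y, cur2 φ x z⁆ - cur2 φ x ⁅y, z⁆ - ⁅z, cur2 φ x y⁆) := by
  have := DFunLike.congr_fun (curryLeft_coboundary x φ) ![y, z]
  rw [AlternatingMap.sub_apply, coboundary_one_apply] at this
  simpa [lieDeriv_apply, cur2_apply, cur1_apply, Fin.sum_univ_succ, update_vec_two] using this

theorem coboundary_three_apply (φ : L [⋀^Fin 3]→ₗ[ℂ] L) (x y z w : L) :
    coboundary L 3 φ ![x, y, z, w] = ⁅x, cur3 φ y z w⁆ -
        (cur3 φ ⁅x, y⁆ z w + cur3 φ y ⁅x, z⁆ w + cur3 φ y z ⁅x, w⁆) -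
      (⁅y, cur3 φ x z w⁆ - (cur3 φ x ⁅y, z⁆ w + cur3 φ x z ⁅y, w⁆) -
      (⁅z, cur3 φ x y w⁆ - cur3 φ x y ⁅z, w⁆ - ⁅w, cur3 φ x y z⁆)) := by
  have := DFunLike.congr_fun (curryLeft_coboundary x φ) ![y, z, w]
  rw [AlternatingMap.sub_apply, coboundary_two_apply] at this
  simpa [lieDeriv_apply, cur3_apply, cur2_apply, Fin.sum_univ_succ, add_assoc,
    update_vec_three] using this

end Curry

/-! ### Coordinates on cochains and a rank-nullity criterion. -/

section Coordinates

/-- The standard basis of `ℂ⁴`, as a basis of the Lie algebra of `d`. -/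
noncomputable def LieStructure.basis (d : LieStructure ℂ) : Basis (Fin 4) ℂ d.Alg :=
  Pi.basisFun ℂ (Fin 4)

instance (d : LieStructure ℂ) : Module.Finite ℂ d.Alg := Module.Finite.of_basis d.basis

theorem LieStructure.finrank_alg (d : LieStructure ℂ) : finrank ℂ d.Alg = 4 := by
  simp [finrank_eq_card_basis d.basis]

/-- An injective tuple of indices becomes strictly increasing after sorting, and sorting changes the
value only by a sign. -/
theorem alternating_eq_zero {M N : Type*} [AddCommGroup M] [Module ℂ M] [AddCommGroup N]
    [Module ℂ N] {m n : ℕ} (b : Basis (Fin m) ℂ M) (φ : M [⋀^Fin n]→ₗ[ℂ] N)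
    (h : ∀ s : Fin n → Fin m, StrictMono s → φ (fun a => b (s a)) = 0) : φ = 0 := by
  refine Basis.ext_alternating b fun v hv => ?_
  have hm : StrictMono (v ∘ Tuple.sort v) :=
    (Tuple.monotone_sort v).strictMono_of_injective (hv.comp (Equiv.injective _))
  have := φ.map_perm (fun a => b (v a)) (Tuple.sort v)
  rw [show (fun a => b (v a)) ∘ (Tuple.sort v) = fun a => b ((v ∘ Tuple.sort v) a) from rfl,
    h _ hm] at this
  have h2 := congrArg (fun y => Equiv.Perm.sign (Tuple.sort v) • y) this
  simpa [smul_smul] using h2.symm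

/-- The `k`-th coordinate of the value of a cochain on basis vectors. -/
noncomputable def LieStructure.coord (d : LieStructure ℂ) {n : ℕ} (s : Fin n → Fin 4) (k : Fin 4) :
    (d.Alg [⋀^Fin n]→ₗ[ℂ] d.Alg) →ₗ[ℂ] ℂ where
  toFun φ := d.basis.repr (φ fun a => d.basis (s a)) k
  map_add' φ ψ := by simp
  map_smul' c φ := by simp

/-- A linear map has nullity `k` if `dim E - k` of the functionals that cut out its kernel
suffice for that, and `k` functionals separate the points of the kernel. -/
theorem finrank_ker_eq_length {E F : Type*} [AddCommGroup E] [Module ℂ E] [Module.Finite ℂ E]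
    [AddCommGroup F] [Module ℂ F] (T : E →ₗ[ℂ] F) (R : List (F →ₗ[ℂ] ℂ)) (G : List (E →ₗ[ℂ] ℂ))
    (h : R.length + G.length = finrank ℂ E) (hR : ∀ x, (∀ r ∈ R, r (T x) = 0) → T x = 0)
    (hG : ∀ x, T x = 0 → (∀ g ∈ G, g x = 0) → x = 0) :
    finrank ℂ (LinearMap.ker T) = G.length := by
  have hr : finrank ℂ (LinearMap.range T) ≤ R.length := by
    let f : LinearMap.range T →ₗ[ℂ] (Fin R.length → ℂ) :=
      LinearMap.pi fun a => R.get a ∘ₗ (LinearMap.range T).subtype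
    have hf : Function.Injective f := by
      rw [← LinearMap.ker_eq_bot, LinearMap.ker_eq_bot']
      rintro ⟨_, x, rfl⟩ hx
      ext
      refine hR x fun r hr => ?_
      obtain ⟨a, rfl⟩ := List.get_of_mem hr
      exact congrFun hx a
    simpa using LinearMap.finrank_le_finrank_of_injective hf
  have hg : finrank ℂ (LinearMap.ker T) ≤ G.length := by
    let f : LinearMap.ker T →ₗ[ℂ] (Fin G.length → ℂ) :=
      LinearMap.pi fun a => G.get a ∘ₗ (LinearMap.ker T).subtype
    have hf : Function.Injective f := by
      rw [← LinearMap.ker_eq_bot, LinearMap.ker_eq_bot']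
      rintro ⟨x, hT⟩ hx
      ext1
      refine hG x hT fun g hg => ?_
      obtain ⟨a, rfl⟩ := List.get_of_mem hg
      exact congrFun hx a
    simpa using LinearMap.finrank_le_finrank_of_injective hf
  -- The two upper bounds add up to the dimension, so both are equalities.
  have := LinearMap.finrank_range_add_finrank_ker T
  omega

end Coordinates

/-! ### The coboundary of the nine-parameter family in coordinates. -/

section Rows

/-- The coboundary of a `0`-cochain in coordinates. -/
def row0 (a b c ε l m n p q : ℂ) (x : Fin 1 → Fin 4 → ℂ) : Fin 4 → Fin 4 → ℂ
  | 0, 0 => c * x 0 1 + l * x 0 3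
  | 0, 1 => b * x 0 2
  | 0, 2 => a * x 0 1
  | 0, 3 => 0
  | 1, 0 => -c * x 0 0 + ε * x 0 2 + p * x 0 3
  | 1, 1 => m * x 0 3
  | 1, 2 => -a * x 0 0
  | 1, 3 => 0
  | 2, 0 => -ε * x 0 1
  | 2, 1 => -b * x 0 0 + q * x 0 3
  | 2, 2 => n * x 0 3
  | 2, 3 => 0
  | 3, 0 => -l * x 0 0 - p * x 0 1
  | 3, 1 => -m * x 0 1 - q * x 0 2
  | 3, 2 => -n * x 0 2
  | 3, 3 => 0

/-- The coboundary of a `1`-cochain in coordinates. -/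
def row1 (a b c ε l m n p q : ℂ) (x : Fin 4 → Fin 4 → ℂ) : Fin 6 → Fin 4 → ℂ
  | 0, 0 => c * x 1 1 + l * x 1 3 - a * x 2 0 - ε * x 0 2 - p * x 0 3
  | 0, 1 => b * x 1 2 - c * x 0 1 - a * x 2 1 - m * x 0 3
  | 0, 2 => a * x 1 1 - c * x 0 2 - a * x 2 2 + a * x 0 0
  | 0, 3 => -c * x 0 3 - a * x 2 3
  | 1, 0 => c * x 2 1 + l * x 2 3 - b * x 1 0 + ε * x 0 1
  | 1, 1 => b * x 2 2 - b * x 1 1 + b * x 0 0 - q * x 0 3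
  | 1, 2 => a * x 2 1 - b * x 1 2 - n * x 0 3
  | 1, 3 => -b * x 1 3
  | 2, 0 => c * x 3 1 + l * x 3 3 + p * x 0 1
  | 2, 1 => b * x 3 2 - l * x 0 1 + m * x 0 1 + q * x 0 2
  | 2, 2 => a * x 3 1 - l * x 0 2 + n * x 0 2
  | 2, 3 => -l * x 0 3
  | 3, 0 => -c * x 2 0 + ε * x 2 2 + p * x 2 3 - ε * x 0 0 + ε * x 1 1
  | 3, 1 => m * x 2 3 - ε * x 0 1 + b * x 1 0 - q * x 1 3
  | 3, 2 => -a * x 2 0 - ε * x 0 2 - n * x 1 3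
  | 3, 3 => -ε * x 0 3
  | 4, 0 => -c * x 3 0 + ε * x 3 2 + p * x 3 3 - p * x 0 0 - m * x 1 0 + l * x 1 0 + p * x 1 1
  | 4, 1 => m * x 3 3 - p * x 0 1 + q * x 1 2
  | 4, 2 => -a * x 3 0 - p * x 0 2 - m * x 1 2 + n * x 1 2
  | 4, 3 => -p * x 0 3 - m * x 1 3
  | 5, 0 => -ε * x 3 1 - q * x 1 0 - n * x 2 0 + l * x 2 0 + p * x 2 1
  | 5, 1 => -b * x 3 0 + q * x 3 3 - q * x 1 1 - n * x 2 1 + m * x 2 1 + q * x 2 2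
  | 5, 2 => n * x 3 3 - q * x 1 2
  | 5, 3 => -q * x 1 3 - n * x 2 3

/-- The coboundary of a `2`-cochain in coordinates. -/
def row2 (a b c ε l m n p q : ℂ) (x : Fin 6 → Fin 4 → ℂ) : Fin 4 → Fin 4 → ℂ
  | 0, 0 => c * x 3 1 + l * x 3 3 - ε * x 1 2 - p * x 1 3 - ε * x 0 1
  | 0, 1 => b * x 3 2 - c * x 1 1 - m * x 1 3 - b * x 0 0 + q * x 0 3
  | 0, 2 => a * x 3 1 - c * x 1 2 + a * x 1 0 + n * x 0 3
  | 0, 3 => -c * x 1 3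
  | 1, 0 => c * x 4 1 + l * x 4 3 - a * x 5 0 - ε * x 2 2 - p * x 2 3 + m * x 0 0 - p * x 0 1
  | 1, 1 => b * x 4 2 - c * x 2 1 - a * x 5 1 + l * x 0 1 - m * x 2 3 - q * x 0 2
  | 1, 2 => a * x 4 1 - c * x 2 2 - a * x 5 2 + l * x 0 2 + a * x 2 0 + m * x 0 2 - n * x 0 2
  | 1, 3 => -c * x 2 3 - a * x 5 3 + l * x 0 3 + m * x 0 3
  | 2, 0 => c * x 5 1 + l * x 5 3 - b * x 4 0 + ε * x 2 1 + q * x 0 0 + n * x 1 0 - p * x 1 1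
  | 2, 1 => b * x 5 2 - b * x 4 1 + l * x 1 1 + b * x 2 0 - q * x 2 3 + q * x 0 1 +
      n * x 1 1 - m * x 1 1 - q * x 1 2
  | 2, 2 => a * x 5 1 - b * x 4 2 + l * x 1 2 - n * x 2 3 + q * x 0 2
  | 2, 3 => -b * x 4 3 + l * x 1 3 + q * x 0 3 + n * x 1 3
  | 3, 0 => -c * x 5 0 + ε * x 5 2 + p * x 5 3 - ε * x 2 0 + p * x 1 0 + m * x 3 0 +
      ε * x 4 1 + n * x 3 0 - l * x 3 0 - p * x 3 1
  | 3, 1 => m * x 5 3 - ε * x 2 1 + p * x 1 1 + b * x 4 0 - q * x 4 3 + n * x 3 1 - q * x 3 2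
  | 3, 2 => -a * x 5 0 - ε * x 2 2 + p * x 1 2 + m * x 3 2 - n * x 4 3
  | 3, 3 => -ε * x 2 3 + p * x 1 3 + m * x 3 3 + n * x 3 3

/-- The coboundary of a `3`-cochain in coordinates. -/
def row3 (a b c ε l m n p q : ℂ) (x : Fin 4 → Fin 4 → ℂ) : Fin 1 → Fin 4 → ℂ
  | 0, 0 => c * x 3 1 + l * x 3 3 - ε * x 2 2 - p * x 2 3 - m * x 0 0 - ε * x 1 1 -
      n * x 0 0 + p * x 0 1
  | 0, 1 => b * x 3 2 - c * x 2 1 - l * x 0 1 - m * x 2 3 - b * x 1 0 + q * x 1 3 -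
      n * x 0 1 + q * x 0 2
  | 0, 2 => a * x 3 1 - c * x 2 2 - l * x 0 2 + a * x 2 0 - m * x 0 2 + n * x 1 3
  | 0, 3 => -c * x 2 3 - l * x 0 3 - m * x 0 3 - n * x 0 3

/-- The increasing tuples of basis indices. -/
def tup0 : Fin 1 → Fin 0 → Fin 4 := ![![]]

/-- The increasing tuples of basis indices. -/
def tup1 : Fin 4 → Fin 1 → Fin 4 := ![![0], ![1], ![2], ![3]]

/-- The increasing tuples of basis indices. -/
def tup2 : Fin 6 → Fin 2 → Fin 4 := ![![0, 1], ![0, 2], ![0, 3], ![1, 2], ![1, 3], ![2, 3]]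

/-- The increasing tuples of basis indices. -/
def tup3 : Fin 4 → Fin 3 → Fin 4 := ![![0, 1, 2], ![0, 1, 3], ![0, 2, 3], ![1, 2, 3]]

/-- The increasing tuples of basis indices. -/
def tup4 : Fin 1 → Fin 4 → Fin 4 := ![![0, 1, 2, 3]]

theorem exists_tup0 (s : Fin 0 → Fin 4) (_ : StrictMono s) : ∃ a, tup0 a = s :=
  ⟨0, Subsingleton.elim _ _⟩

theorem exists_tup1 (s : Fin 1 → Fin 4) (_ : StrictMono s) : ∃ a, tup1 a = s := by
  revert s; decide

theorem exists_tup2 (s : Fin 2 → Fin 4) (h : StrictMono s) : ∃ a, tup2 a = s := by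
  have h01 : s 0 < s 1 := h (by decide)
  revert s; decide

theorem exists_tup3 (s : Fin 3 → Fin 4) (h : StrictMono s) : ∃ a, tup3 a = s := by
  have h01 : s 0 < s 1 := h (by decide)
  have h12 : s 1 < s 2 := h (by decide)
  clear h
  revert s; decide

theorem exists_tup4 (s : Fin 4 → Fin 4) (h : StrictMono s) : ∃ a, tup4 a = s := by
  have h01 : s 0 < s 1 := h (by decide)
  have h12 : s 1 < s 2 := h (by decide)
  have h23 : s 2 < s 3 := h (by decide)
  refine ⟨0, funext fun i => ?_⟩
  fin_cases i <;> simp [tup4] <;> omega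

theorem LieStructure.eq_zero_of_coord (d : LieStructure ℂ) {n N : ℕ} {t : Fin N → Fin n → Fin 4}
    (ht : ∀ s, StrictMono s → ∃ a, t a = s) (φ : d.Alg [⋀^Fin n]→ₗ[ℂ] d.Alg)
    (h : ∀ a j, d.coord (t a) j φ = 0) : φ = 0 := by
  refine alternating_eq_zero d.basis φ fun s hs => ?_
  obtain ⟨a, rfl⟩ := ht s hs
  exact d.basis.repr.map_eq_zero_iff.1 (Finsupp.ext fun j => h a j)

/-- The cocycle space has dimension `k` if `dim Lₙ - k` of the cocycle equations, those in `R`,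
imply all others, and `k` coordinates, those in `G`, determine a cocycle. The equations outside `R`
are either trivial or listed in `C`, together with some equations that imply them. -/
theorem finrank_cocycles_of_rows (d : LieStructure ℂ) {n N N' : ℕ} {t : Fin N → Fin n → Fin 4}
    {t' : Fin N' → Fin (n + 1) → Fin 4} (ht : ∀ s, StrictMono s → ∃ a, t a = s)
    (ht' : ∀ s, StrictMono s → ∃ a, t' a = s)
    {row : (Fin N → Fin 4 → ℂ) → Fin N' → Fin 4 → ℂ}
    (hrow : ∀ φ a k, d.coord (t' a) k (coboundary d.Alg n φ) =
      row (fun b j => d.coord (t b) j φ) a k)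
    (R : List (Fin N' × Fin 4)) (C : List ((Fin N' × Fin 4) × List (Fin N' × Fin 4)))
    (G : List (Fin N × Fin 4)) (hlen : R.length + G.length = Nat.choose 4 n * 4)
    (hT : ∀ x a k, (a, k) ∉ R → (∀ c ∈ C, c.1 ≠ (a, k)) → row x a k = 0)
    (hC : ∀ c ∈ C, c.2 ⊆ R ∧ ∀ x, (∀ r ∈ c.2, row x r.1 r.2 = 0) → row x c.1.1 c.1.2 = 0)
    (hG : ∀ x, (∀ a k, row x a k = 0) → (∀ g ∈ G, x g.1 g.2 = 0) → ∀ b j, x b j = 0) :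
    finrank ℂ (cocycles d.Alg n) = G.length := by
  have hR : ∀ x, (∀ r ∈ R, row x r.1 r.2 = 0) → ∀ a k, row x a k = 0 := by
    intro x hx a k
    by_cases h1 : (a, k) ∈ R
    · exact hx _ h1
    by_cases h2 : ∀ c ∈ C, c.1 ≠ (a, k)
    · exact hT x a k h1 h2
    push Not at h2
    obtain ⟨c, hc, hca⟩ := h2
    simpa [hca] using (hC c hc).2 x fun r hr => hx r ((hC c hc).1 hr)
  have key := finrank_ker_eq_length (coboundary d.Alg n) (R.map fun r => d.coord (t' r.1) r.2)
    (G.map fun g => d.coord (t g.1) g.2)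
    (by rw [List.length_map, List.length_map, hlen, finrank_cochains, d.finrank_alg])
    (fun φ h => d.eq_zero_of_coord ht' _ fun a k => by
      rw [hrow]
      refine hR _ (fun r hr => ?_) a k
      rw [← hrow]
      exact h _ (List.mem_map_of_mem hr))
    (fun φ h hg => d.eq_zero_of_coord ht _ fun b j => hG _ (fun a k => by rw [← hrow, h, map_zero])
      (fun g hgm => hg _ (List.mem_map_of_mem hgm)) b j)
  rwa [List.length_map] at key

/-- The cocycle space has dimension `k` if a cocycle is determined by `k` of its coordinates, and
these can be prescribed. -/
theorem finrank_cocycles_of_free (d : LieStructure ℂ) {n N N' z : ℕ} {t : Fin N → Fin n → Fin 4}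
    {t' : Fin N' → Fin (n + 1) → Fin 4} (ht : ∀ s, StrictMono s → ∃ a, t a = s)
    (ht' : ∀ s, StrictMono s → ∃ a, t' a = s)
    {row : (Fin N → Fin 4 → ℂ) → Fin N' → Fin 4 → ℂ}
    (hrow : ∀ φ a k, d.coord (t' a) k (coboundary d.Alg n φ) =
      row (fun b j => d.coord (t b) j φ) a k) (hN : Nat.choose 4 n = N)
    (G : Fin z → Fin N × Fin 4)
    (hK : ∀ u : Fin z → ℂ, ∃ x, (∀ a k, row x a k = 0) ∧ ∀ i, x (G i).1 (G i).2 = u i)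
    (hG : ∀ x, (∀ a k, row x a k = 0) → (∀ i, x (G i).1 (G i).2 = 0) → ∀ b j, x b j = 0) :
    finrank ℂ (cocycles d.Alg n) = z := by
  let e : (d.Alg [⋀^Fin n]→ₗ[ℂ] d.Alg) →ₗ[ℂ] (Fin N → Fin 4 → ℂ) :=
    LinearMap.pi fun b => LinearMap.pi fun j => d.coord (t b) j
  have he : Function.Injective e := by
    rw [← LinearMap.ker_eq_bot, LinearMap.ker_eq_bot']
    exact fun φ h => d.eq_zero_of_coord ht φ fun b j => congrFun (congrFun h b) j
  have hs : Function.Surjective e := by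
    refine (LinearMap.injective_iff_surjective_of_finrank_eq_finrank ?_).1 he
    rw [finrank_cochains, d.finrank_alg, hN]
    simp [Module.finrank_pi_fintype]
  let f : cocycles d.Alg n →ₗ[ℂ] (Fin z → ℂ) :=
    LinearMap.pi fun i => d.coord (t (G i).1) (G i).2 ∘ₗ (cocycles d.Alg n).subtype
  have hf : Function.Bijective f := by
    constructor
    · rw [← LinearMap.ker_eq_bot, LinearMap.ker_eq_bot']
      rintro ⟨φ, hφ⟩ h
      ext1
      refine d.eq_zero_of_coord ht φ (hG _ (fun a k => ?_) fun i => congrFun h i)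
      rw [← hrow, LinearMap.mem_ker.1 hφ, map_zero]
    · intro u
      obtain ⟨x, hx, hu⟩ := hK u
      obtain ⟨φ, rfl⟩ := hs x
      refine ⟨⟨φ, LinearMap.mem_ker.2 (d.eq_zero_of_coord ht' _ fun a k => ?_)⟩, funext hu⟩
      rw [hrow]
      exact hx a k
  simpa using (LinearEquiv.ofBijective f hf).finrank_eq

/-- The brackets `[e₁,e₂] = c e₁ + a e₃`, `[e₁,e₃] = b e₂`, `[e₂,e₃] = ε e₁`, `[e₁,e₄] = l e₁`,
`[e₂,e₄] = p e₁ + m e₂`, `[e₃,e₄] = q e₂ + n e₃`, which cover all algebras of the table. -/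
def HasBracket (d : LieStructure ℂ) (a b c ε l m n p q : ℂ) : Prop :=
  ∀ x y : Fin 4 → ℂ, d.br x y =
    ![c * (x 0 * y 1 - x 1 * y 0) + ε * (x 1 * y 2 - x 2 * y 1) + l * (x 0 * y 3 - x 3 * y 0) +
        p * (x 1 * y 3 - x 3 * y 1),
      b * (x 0 * y 2 - x 2 * y 0) + m * (x 1 * y 3 - x 3 * y 1) + q * (x 2 * y 3 - x 3 * y 2),
      a * (x 0 * y 1 - x 1 * y 0) + n * (x 2 * y 3 - x 3 * y 2), 0]

theorem LieStructure.lie_repr {d : LieStructure ℂ} {a b c ε l m n p q : ℂ}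
    (h : HasBracket d a b c ε l m n p q) (x y : d.Alg) (k : Fin 4) :
    d.basis.repr ⁅x, y⁆ k =
    ![c * (d.basis.repr x 0 * d.basis.repr y 1 - d.basis.repr x 1 * d.basis.repr y 0) +
        ε * (d.basis.repr x 1 * d.basis.repr y 2 - d.basis.repr x 2 * d.basis.repr y 1) +
        l * (d.basis.repr x 0 * d.basis.repr y 3 - d.basis.repr x 3 * d.basis.repr y 0) +
        p * (d.basis.repr x 1 * d.basis.repr y 3 - d.basis.repr x 3 * d.basis.repr y 1),
      b * (d.basis.repr x 0 * d.basis.repr y 2 - d.basis.repr x 2 * d.basis.repr y 0) +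
        m * (d.basis.repr x 1 * d.basis.repr y 3 - d.basis.repr x 3 * d.basis.repr y 1) +
        q * (d.basis.repr x 2 * d.basis.repr y 3 - d.basis.repr x 3 * d.basis.repr y 2),
      a * (d.basis.repr x 0 * d.basis.repr y 1 - d.basis.repr x 1 * d.basis.repr y 0) +
        n * (d.basis.repr x 2 * d.basis.repr y 3 - d.basis.repr x 3 * d.basis.repr y 2), 0] k :=
  congrFun (h x y) k

theorem LieStructure.lie_basis {d : LieStructure ℂ} {a b c ε l m n p q : ℂ}
    (h : HasBracket d a b c ε l m n p q) :
    ⁅d.basis 0, d.basis 1⁆ = c • d.basis 0 + a • d.basis 2 ∧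
    ⁅d.basis 0, d.basis 2⁆ = b • d.basis 1 ∧ ⁅d.basis 1, d.basis 2⁆ = ε • d.basis 0 ∧
    ⁅d.basis 0, d.basis 3⁆ = l • d.basis 0 ∧
    ⁅d.basis 1, d.basis 3⁆ = p • d.basis 0 + m • d.basis 1 ∧
    ⁅d.basis 2, d.basis 3⁆ = q • d.basis 1 + n • d.basis 2 := by
  refine ⟨?_, ?_, ?_, ?_, ?_, ?_⟩ <;>
  · refine d.basis.ext_elem fun k => ?_
    rw [lie_repr h]
    fin_cases k <;> simp

variable {d : LieStructure ℂ} {a b c ε l m n p q : ℂ}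

/-- The evaluation is done once per degree with symbolic structure constants. Afterwards the cocycle
spaces of the table are kernels of explicit matrices. -/
theorem coord_coboundary_zero (h : HasBracket d a b c ε l m n p q)
    (φ : d.Alg [⋀^Fin 0]→ₗ[ℂ] d.Alg) (i k : Fin 4) :
    d.coord (tup1 i) k (coboundary d.Alg 0 φ) =
      row0 a b c ε l m n p q (fun b j => d.coord (tup0 b) j φ) i k := by
  have e : ∀ i, (fun j => d.basis (tup1 i j)) = ![d.basis i] := by
    intro i; funext j; fin_cases i <;> fin_cases j <;> rfl
  have e0 : (fun j => d.basis (tup0 0 j)) = ![] := Subsingleton.elim _ _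
  simp only [LieStructure.coord, LinearMap.coe_mk, AddHom.coe_mk, e, coboundary_zero_apply,
    LieStructure.lie_repr h]
  fin_cases i <;> fin_cases k <;>
    simp [row0, e0] <;> ring

theorem coord_coboundary_one (h : HasBracket d a b c ε l m n p q)
    (φ : d.Alg [⋀^Fin 1]→ₗ[ℂ] d.Alg) (i : Fin 6) (k : Fin 4) :
    d.coord (tup2 i) k (coboundary d.Alg 1 φ) =
      row1 a b c ε l m n p q (fun b j => d.coord (tup1 b) j φ) i k := by
  have e : ∀ i, (fun j => d.basis (tup2 i j)) = ![d.basis (tup2 i 0), d.basis (tup2 i 1)] := by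
    intro i; funext j; fin_cases j <;> rfl
  have e1 : ∀ i k, d.coord (tup1 i) k φ = d.basis.repr (cur1 φ (d.basis i)) k := by
    intro i k
    rw [cur1_apply]
    change d.basis.repr (φ _) k = _
    congr 3; funext j; fin_cases i <;> fin_cases j <;> rfl
  obtain ⟨h01, h02, h12, h03, h13, h23⟩ := LieStructure.lie_basis h
  simp only [e1]
  simp only [LieStructure.coord, LinearMap.coe_mk, AddHom.coe_mk, e, coboundary_one_apply]
  fin_cases i <;>
  · simp only [tup2, row1, Fin.zero_eta, Fin.mk_one, Fin.reduceFinMk, Matrix.cons_val,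
      h01, h02, h12, h03, h13, h23, map_add, map_sub, map_smul, Finsupp.coe_add, Finsupp.coe_sub, Finsupp.coe_smul, Pi.add_apply, Pi.sub_apply,
      Pi.smul_apply, LieStructure.lie_repr h, smul_eq_mul]
    fin_cases k <;> simp <;> ring

end Rows

section Rows

variable {d : LieStructure ℂ} {a b c ε l m n p q : ℂ}

set_option maxHeartbeats 1000000 in
theorem coord_coboundary_two (h : HasBracket d a b c ε l m n p q)
    (φ : d.Alg [⋀^Fin 2]→ₗ[ℂ] d.Alg) (i k : Fin 4) :
    d.coord (tup3 i) k (coboundary d.Alg 2 φ) =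
      row2 a b c ε l m n p q (fun b j => d.coord (tup2 b) j φ) i k := by
  have e : ∀ i, (fun j => d.basis (tup3 i j)) =
      ![d.basis (tup3 i 0), d.basis (tup3 i 1), d.basis (tup3 i 2)] := by
    intro i; funext j; fin_cases j <;> rfl
  have e1 : ∀ i k, d.coord (tup2 i) k φ =
      d.basis.repr (cur2 φ (d.basis (tup2 i 0)) (d.basis (tup2 i 1))) k := by
    intro i k
    rw [cur2_apply]
    change d.basis.repr (φ _) k = _
    congr 3; funext j; fin_cases j <;> rfl
  obtain ⟨h01, h02, h12, h03, h13, h23⟩ := LieStructure.lie_basis h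
  have s10 := cur2_swap φ (d.basis 0) (d.basis 1)
  have s20 := cur2_swap φ (d.basis 0) (d.basis 2)
  have s21 := cur2_swap φ (d.basis 1) (d.basis 2)
  simp only [e1]
  simp only [LieStructure.coord, LinearMap.coe_mk, AddHom.coe_mk, e, coboundary_two_apply]
  fin_cases i <;>
  · simp only [tup3, tup2, row2, Fin.zero_eta, Fin.mk_one, Fin.reduceFinMk, Matrix.cons_val,
      h01, h02, h12, h03, h13, h23, s10, s20, s21, cur2_self, map_add, map_sub, map_smul,
      LinearMap.add_apply, LinearMap.smul_apply, Finsupp.coe_add, Finsupp.coe_sub,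
      Finsupp.coe_smul, Pi.add_apply, Pi.sub_apply, Pi.smul_apply, LieStructure.lie_repr h,
      smul_eq_mul, Basis.repr_self]
    fin_cases k <;> simp <;> ring

set_option maxHeartbeats 1000000 in
theorem coord_coboundary_three (h : HasBracket d a b c ε l m n p q)
    (φ : d.Alg [⋀^Fin 3]→ₗ[ℂ] d.Alg) (i : Fin 1) (k : Fin 4) :
    d.coord (tup4 i) k (coboundary d.Alg 3 φ) =
      row3 a b c ε l m n p q (fun b j => d.coord (tup3 b) j φ) i k := by
  have e : (fun j => d.basis (tup4 i j)) =
      ![d.basis 0, d.basis 1, d.basis 2, d.basis 3] := by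
    funext j; fin_cases i; fin_cases j <;> rfl
  have e1 : ∀ i k, d.coord (tup3 i) k φ = d.basis.repr
      (cur3 φ (d.basis (tup3 i 0)) (d.basis (tup3 i 1)) (d.basis (tup3 i 2))) k := by
    intro i k
    rw [cur3_apply]
    change d.basis.repr (φ _) k = _
    congr 3; funext j; fin_cases j <;> rfl
  obtain ⟨h01, h02, h12, h03, h13, h23⟩ := LieStructure.lie_basis h
  have s0 := cur3_swap_left φ (d.basis 0) (d.basis 1)
  have s4 := fun x => cur3_swap_right φ x (d.basis 0) (d.basis 2)
  have s5 := fun x => cur3_swap_right φ x (d.basis 1) (d.basis 2)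
  simp only [e1]
  simp only [LieStructure.coord, LinearMap.coe_mk, AddHom.coe_mk, e, coboundary_three_apply]
  fin_cases i
  simp only [tup3, row3, Fin.zero_eta, Matrix.cons_val,
    h01, h02, h12, h03, h13, h23, s0, s4, s5, cur3_self_left, cur3_self_right,
    map_add, map_sub, map_smul, LinearMap.add_apply, LinearMap.smul_apply, Finsupp.coe_add, Finsupp.coe_sub, Finsupp.coe_smul, Pi.add_apply, Pi.sub_apply, Pi.smul_apply,
    LieStructure.lie_repr h, smul_eq_mul, Basis.repr_self]
  fin_cases k <;> simp <;> ring

end Rows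

/-! ### Dimensions of the cocycle spaces. -/

section Table

theorem hasBracket_d3 : HasBracket d3 1 1 0 1 0 0 0 0 0 := by
  intro x y; funext k; fin_cases k <;> simp [d3, psi_apply]

theorem hasBracket_d2Sharp : HasBracket d2Sharp 0 0 1 0 0 0 1 0 0 := by
  intro x y; funext k; fin_cases k <;> simp [d2Sharp, psi_apply]

theorem hasBracket_d1Fam (l m : ℂ) : HasBracket (d1Fam l m) 0 0 0 1 (l + m) l m 0 1 := by
  intro x y; funext k; fin_cases k <;> simp [d1Fam, psi_apply]

theorem hasBracket_d1Sharp : HasBracket d1Sharp 0 0 0 1 2 1 1 0 0 := by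
  intro x y; funext k; fin_cases k <;> simp [d1Sharp, psi_apply]

theorem hasBracket_d3Big (l m n : ℂ) : HasBracket (d3Big l m n) 0 0 0 0 l m n 1 1 := by
  intro x y; funext k; fin_cases k <;> simp [d3Big, psi_apply]

theorem hasBracket_d3Small (l m : ℂ) : HasBracket (d3Small l m) 0 0 0 0 l l m 0 1 := by
  intro x y; funext k; fin_cases k <;> simp [d3Small, psi_apply]

theorem hasBracket_d1 : HasBracket d1 0 0 0 0 0 0 0 1 0 := by
  intro x y; funext k; fin_cases k <;> simp [d1, psi_apply]

theorem hasBracket_d2Star : HasBracket d2Star 0 0 0 0 0 0 0 1 1 := by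
  intro x y; funext k; fin_cases k <;> simp [d2Star, psi_apply]

theorem hasBracket_d3Star : HasBracket d3Star 0 0 0 0 1 1 1 0 0 := by
  intro x y; funext k; fin_cases k <;> simp [d3Star, psi_apply]

/-- A derivation preserves V = ⟨e₁,e₂,e₃⟩ and commutes there with the bracket with e₄; that matrix
is cyclic, so its commutant has dimension 3. The image of e₄ is an arbitrary vector of V, which
gives 3 more parameters. No multiple of e₄ occurs in it because the matrix has the nonzero
eigenvalue l and is not nilpotent. -/
theorem finrank_cocycles_d3Big_one (l m n : ℂ) (hl : l ≠ 0) :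
    finrank ℂ (cocycles (d3Big l m n).Alg 1) = 6 := by
  refine finrank_cocycles_of_free _ exists_tup1 exists_tup2
    (coord_coboundary_one (hasBracket_d3Big _ _ _)) rfl
    ![(1, 0), (2, 0), (2, 2), (3, 0), (3, 1), (3, 2)] (fun u => ?_) (fun x hx hg => ?_)
  · refine ⟨![![u 2 + (m - n) * (u 0 - (l - n) * u 1) + (l - m) * u 0, 0, 0, 0],
      ![u 0, u 2 + (m - n) * (u 0 - (l - n) * u 1), 0, 0],
      ![u 1, u 0 - (l - n) * u 1, u 2, 0], ![u 3, u 4, u 5, 0]], fun a k => ?_, fun i => ?_⟩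
    · fin_cases a <;> fin_cases k <;> simp [row1] <;> ring
    · fin_cases i <;> rfl
  · simp [row1, Fin.forall_fin_succ] at hx hg ⊢ <;> grind

/-- The matrix of the bracket with e₄ on ⟨e₁,e₂,e₃⟩ has a minimal polynomial of degree 2, also for m
= l, so its commutant has dimension 5; the image of e₄ adds 3. -/
theorem finrank_cocycles_d3Small_one (l m : ℂ) (h : l ≠ 0 ∨ m ≠ 0) :
    finrank ℂ (cocycles (d3Small l m).Alg 1) = 8 := by
  refine finrank_cocycles_of_free _ exists_tup1 exists_tup2
    (coord_coboundary_one (hasBracket_d3Small _ _)) rfl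
    ![(0, 0), (0, 1), (2, 0), (2, 1), (2, 2), (3, 0), (3, 1), (3, 2)] (fun u => ?_)
    (fun x hx hg => ?_)
  · refine ⟨![![u 0, u 1, 0, 0], ![(l - m) * u 2, u 4 + (l - m) * u 3, 0, 0],
      ![u 2, u 3, u 4, 0], ![u 5, u 6, u 7, 0]], fun a k => ?_, fun i => ?_⟩
    · fin_cases a <;> fin_cases k <;> simp [row1] <;> ring
    · fin_cases i <;> rfl
  · simp [row1, Fin.forall_fin_succ] at hx hg ⊢ <;> grind

/-- On the quotient of the Heisenberg ideal by e₁ a derivation commutes with a cyclic 2 × 2 block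
(two parameters), and [e₂,e₃] = e₁ makes its eigenvalue on e₁ the trace. The other parameters are
the e₁-components of the images of e₂, e₃, e₄, and they determine the rest. -/
theorem finrank_cocycles_d1Fam_one (l m : ℂ) (h : l ≠ 0 ∨ m ≠ 0) :
    finrank ℂ (cocycles (d1Fam l m).Alg 1) = 5 := by
  refine finrank_cocycles_of_free _ exists_tup1 exists_tup2
    (coord_coboundary_one (hasBracket_d1Fam _ _)) rfl
    ![(1, 0), (2, 0), (2, 1), (2, 2), (3, 0)] (fun u => ?_) (fun x hx hg => ?_)
  · refine ⟨![![2 * u 3 + (l - m) * u 2, 0, 0, 0], ![u 0, u 3 + (l - m) * u 2, 0, 0],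
      ![u 1, u 2, u 3, 0], ![u 4, -u 0 + l * u 1, -m * u 0, 0]], fun a k => ?_, fun i => ?_⟩
    · fin_cases a <;> fin_cases k <;> simp [row1] <;> ring
    · fin_cases i <;> rfl
  · simp [row1, Fin.forall_fin_succ] at hx hg ⊢ <;> grind

/-- The parametrisation is polynomial in l and m, so the doubly degenerate case m = 0 is included.
-/
theorem finrank_cocycles_d3Big_two_zero (l m : ℂ) (hl : l ≠ 0) (h : l + m ≠ 0) :
    finrank ℂ (cocycles (d3Big l m 0).Alg 2) = 13 := by
  refine finrank_cocycles_of_free _ exists_tup2 exists_tup3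
    (coord_coboundary_two (hasBracket_d3Big _ _ _)) rfl
    ![(0, 0), (5, 3), (1, 0), (3, 0), (2, 0), (2, 1), (2, 2), (4, 0), (4, 1), (4, 2), (5, 0),
      (5, 1), (5, 2)] (fun u => ?_) (fun x hx hg => ?_)
  · refine ⟨![![u 0, m * (u 0 + l * u 1), 0, 0], ![u 2, u 0 + l * u 1, 0, 0],
      ![u 4, u 5, u 6, l * (u 0 + l * u 1)], ![u 3, u 1 + u 2 + (m - l) * u 3, 0, 0],
      ![u 7, u 8, u 9, u 0 + (l + m) * u 1], ![u 10, u 11, u 12, u 1]], fun a k => ?_, fun i => ?_⟩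
    · fin_cases a <;> fin_cases k <;> simp [row2] <;> ring
    · fin_cases i <;> rfl
  · simp [row2, Fin.forall_fin_succ] at hx hg ⊢ <;> grind

/-- The centre is the kernel of a cyclic singular matrix, hence a line. The remaining coordinates
follow from that of e₂ because l ≠ 0. -/
theorem finrank_cocycles_d3Big_zero_zero (l m : ℂ) (hl : l ≠ 0) :
    finrank ℂ (cocycles (d3Big l m 0).Alg 0) = 1 := by
  refine finrank_cocycles_of_rows _ exists_tup0 exists_tup1
    (coord_coboundary_zero (hasBracket_d3Big _ _ _))
    [(0, 0), (3, 0), (3, 1)]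
    [((1, 0), [(0, 0)]), ((1, 1), [(0, 0)]), ((2, 1), [(0, 0)])]
    [(0, 1)]
    rfl ?_ ?_ ?_
  · intro x a k
    fin_cases a <;> fin_cases k <;> simp [row0]
  · simp only [List.forall_mem_cons, List.not_mem_nil, false_imp_iff, implies_true, and_true]
    refine ⟨?_, ?_, ?_⟩ <;>
    · refine ⟨by decide, fun x hx => ?_⟩
      simp [row0] at hx ⊢ <;> grind
  · intro x hx hg
    simp [row0, Fin.forall_fin_succ] at hx hg ⊢ <;> grind

theorem finrank_cocycles_d3Big_two_antisymm (l : ℂ) (hl : l ≠ 0) :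
    finrank ℂ (cocycles (d3Big l (-l) 0).Alg 2) = 15 := by
  refine finrank_cocycles_of_rows _ exists_tup2 exists_tup3
    (coord_coboundary_two (hasBracket_d3Big _ _ _))
    [(0, 0), (0, 1), (1, 0), (1, 1), (2, 0), (2, 1), (2, 2), (3, 0), (3, 2)]
    [((2, 3), [(0, 1)]), ((3, 1), [(1, 0), (1, 1), (2, 0), (2, 2), (3, 2)]), ((3, 3), [(0, 0)])]
    [(1, 2), (1, 3), (2, 0), (2, 1), (2, 2), (2, 3), (3, 0), (3, 1), (4, 0), (4, 1), (4, 2),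
     (5, 0), (5, 1), (5, 2), (5, 3)]
    rfl ?_ ?_ ?_
  · intro x a k
    fin_cases a <;> fin_cases k <;> simp [row2]
  · simp only [List.forall_mem_cons, List.not_mem_nil, false_imp_iff, implies_true, and_true]
    refine ⟨?_, ?_, ?_⟩ <;>
    · refine ⟨by decide, fun x hx => ?_⟩
      simp [row2] at hx ⊢ <;> grind
  · intro x hx hg
    simp [row2, Fin.forall_fin_succ] at hx hg ⊢ <;> grind

theorem finrank_cocycles_d3Big_three_antisymm (l : ℂ) (hl : l ≠ 0) :
    finrank ℂ (cocycles (d3Big l (-l) 0).Alg 3) = 14 := by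
  refine finrank_cocycles_of_rows _ exists_tup3 exists_tup4
    (coord_coboundary_three (hasBracket_d3Big _ _ _))
    [(0, 0), (0, 1)]
    []
    [(0, 1), (0, 3), (1, 0), (1, 1), (1, 2), (1, 3), (2, 0), (2, 1), (2, 2), (2, 3), (3, 0),
     (3, 1), (3, 2), (3, 3)]
    rfl ?_ ?_ ?_
  · intro x a k
    fin_cases a <;> fin_cases k <;> simp [row3]
  · simp
  · intro x hx hg
    simp [row3, Fin.forall_fin_succ] at hx hg ⊢ <;> grind

theorem finrank_cocycles_d3Big_zero_ne (l m n : ℂ) (hl : l ≠ 0) (hm : m ≠ 0) (hn : n ≠ 0) :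
    finrank ℂ (cocycles (d3Big l m n).Alg 0) = 0 := by
  refine finrank_cocycles_of_rows _ exists_tup0 exists_tup1
    (coord_coboundary_zero (hasBracket_d3Big _ _ _))
    [(0, 0), (3, 0), (3, 1), (3, 2)]
    [((1, 0), [(0, 0)]), ((1, 1), [(0, 0)]), ((2, 1), [(0, 0)]), ((2, 2), [(0, 0)])]
    []
    rfl ?_ ?_ ?_
  · intro x a k
    fin_cases a <;> fin_cases k <;> simp [row0]
  · simp only [List.forall_mem_cons, List.not_mem_nil, false_imp_iff, implies_true, and_true]
    refine ⟨?_, ?_, ?_, ?_⟩ <;>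
    · refine ⟨by decide, fun x hx => ?_⟩
      simp [row0] at hx ⊢ <;> grind
  · intro x hx hg
    simp [row0, Fin.forall_fin_succ] at hx hg ⊢ <;> grind

/-- With V = ⟨e₁,e₂,e₃⟩, the bracket with e₄ acts on Hom(Λ²V, V) with eigenvalues λᵢ + λⱼ - λₖ. If
λ₁, λ₂, λ₃ are nonzero and none is the sum of the other two, this action is invertible and a cocycle
is determined by its values φ(·, e₄), which gives 12. The resonance l = m + n frees one more
coordinate, the e₁-component of φ(e₂,e₃). -/
theorem finrank_cocycles_d3Big_two_sum (m n : ℂ) (hm : m ≠ 0) (hn : n ≠ 0) (h : m + n ≠ 0) :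
    finrank ℂ (cocycles (d3Big (m + n) m n).Alg 2) = 13 := by
  refine finrank_cocycles_of_rows _ exists_tup2 exists_tup3
    (coord_coboundary_two (hasBracket_d3Big _ _ _))
    [(0, 0), (0, 1), (0, 2), (1, 0), (1, 1), (1, 2), (2, 0), (2, 1), (2, 2), (3, 0), (3, 2)]
    [((1, 3), [(0, 2)]), ((2, 3), [(0, 1), (0, 2)]), ((3, 1), [(1, 0), (1, 1), (1, 2), (2, 0),
     (2, 1), (2, 2), (3, 0), (3, 2)]), ((3, 3), [(0, 0), (0, 1), (0, 2)])]
    [(2, 0), (2, 1), (2, 2), (2, 3), (3, 0), (4, 0), (4, 1), (4, 2), (4, 3), (5, 0), (5, 1),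
     (5, 2), (5, 3)]
    rfl ?_ ?_ ?_
  · intro x a k
    fin_cases a <;> fin_cases k <;> simp [row2]
  · simp only [List.forall_mem_cons, List.not_mem_nil, false_imp_iff, implies_true, and_true]
    refine ⟨?_, ?_, ?_, ?_⟩ <;>
    · refine ⟨by decide, fun x hx => ?_⟩
      simp [row2] at hx ⊢ <;> grind
  · intro x hx hg
    simp [row2, Fin.forall_fin_succ] at hx hg ⊢ <;> grind

theorem finrank_cocycles_d3Big_two_generic (l m n : ℂ) (hl : l ≠ 0) (hm : m ≠ 0) (hn : n ≠ 0)
    (h1 : l ≠ m + n) (h2 : m ≠ l + n) (h3 : n ≠ l + m) :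
    finrank ℂ (cocycles (d3Big l m n).Alg 2) = 12 := by
  refine finrank_cocycles_of_rows _ exists_tup2 exists_tup3
    (coord_coboundary_two (hasBracket_d3Big _ _ _))
    [(0, 0), (0, 1), (0, 2), (1, 0), (1, 1), (1, 2), (2, 0), (2, 1), (2, 2), (3, 0), (3, 1),
     (3, 2)]
    [((1, 3), [(0, 2)]), ((2, 3), [(0, 1), (0, 2)]), ((3, 3), [(0, 0), (0, 1), (0, 2)])]
    [(2, 0), (2, 1), (2, 2), (2, 3), (4, 0), (4, 1), (4, 2), (4, 3), (5, 0), (5, 1), (5, 2),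
     (5, 3)]
    rfl ?_ ?_ ?_
  · intro x a k
    fin_cases a <;> fin_cases k <;> simp [row2]
  · simp only [List.forall_mem_cons, List.not_mem_nil, false_imp_iff, implies_true, and_true]
    refine ⟨?_, ?_, ?_⟩ <;>
    · refine ⟨by decide, fun x hx => ?_⟩
      simp [row2] at hx ⊢ <;> grind
  · intro x hx hg
    simp [row2, Fin.forall_fin_succ] at hx hg ⊢ <;> grind

/-- The last cocycle equation says that l + m + n, the trace of the bracket with e₄, annihilates the
e₄-component of φ(e₁,e₂,e₃). It is an independent condition exactly when the trace is nonzero. -/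
theorem finrank_cocycles_d3Big_three_trace_ne (l m n : ℂ) (h : l + m + n ≠ 0) :
    finrank ℂ (cocycles (d3Big l m n).Alg 3) = 12 := by
  refine finrank_cocycles_of_rows _ exists_tup3 exists_tup4
    (coord_coboundary_three (hasBracket_d3Big _ _ _))
    [(0, 0), (0, 1), (0, 2), (0, 3)]
    []
    [(0, 0), (1, 0), (1, 1), (1, 2), (2, 0), (2, 1), (2, 2), (2, 3), (3, 0), (3, 1), (3, 2),
     (3, 3)]
    rfl ?_ ?_ ?_
  · intro x a k
    fin_cases a <;> fin_cases k <;> simp [row3]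
  · simp
  · intro x hx hg
    simp [row3, Fin.forall_fin_succ] at hx hg ⊢ <;> grind

theorem finrank_cocycles_d3Big_three_trace_zero (m n : ℂ) (hm : m ≠ 0) (hn : n ≠ 0)
    (h : m + n ≠ 0) :
    finrank ℂ (cocycles (d3Big (-(m + n)) m n).Alg 3) = 13 := by
  refine finrank_cocycles_of_rows _ exists_tup3 exists_tup4
    (coord_coboundary_three (hasBracket_d3Big _ _ _))
    [(0, 0), (0, 1), (0, 2)]
    []
    [(0, 3), (1, 0), (1, 1), (1, 2), (1, 3), (2, 0), (2, 1), (2, 2), (2, 3), (3, 0), (3, 1),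
     (3, 2), (3, 3)]
    rfl ?_ ?_ ?_
  · intro x a k
    fin_cases a <;> fin_cases k <;> simp [row3] <;> ring
  · simp
  · intro x hx hg
    simp [row3, Fin.forall_fin_succ] at hx hg ⊢ <;> grind

theorem finrank_cocycles_d3Small_zero_right (l : ℂ) (hl : l ≠ 0) :
    finrank ℂ (cocycles (d3Small l 0).Alg 0) = 1 := by
  refine finrank_cocycles_of_rows _ exists_tup0 exists_tup1
    (coord_coboundary_zero (hasBracket_d3Small _ _))
    [(0, 0), (3, 0), (3, 1)]
    [((1, 1), [(0, 0)]), ((2, 1), [(0, 0)])]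
    [(0, 2)]
    rfl ?_ ?_ ?_
  · intro x a k
    fin_cases a <;> fin_cases k <;> simp [row0]
  · simp only [List.forall_mem_cons, List.not_mem_nil, false_imp_iff, implies_true, and_true]
    refine ⟨?_, ?_⟩ <;>
    · refine ⟨by decide, fun x hx => ?_⟩
      simp [row0] at hx ⊢ <;> grind
  · intro x hx hg
    simp [row0, Fin.forall_fin_succ] at hx hg ⊢ <;> grind

theorem finrank_cocycles_d3Small_zero_left (m : ℂ) (hm : m ≠ 0) :
    finrank ℂ (cocycles (d3Small 0 m).Alg 0) = 2 := by
  refine finrank_cocycles_of_rows _ exists_tup0 exists_tup1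
    (coord_coboundary_zero (hasBracket_d3Small _ _))
    [(2, 1), (3, 1)]
    [((2, 2), [(2, 1)]), ((3, 2), [(3, 1)])]
    [(0, 0), (0, 1)]
    rfl ?_ ?_ ?_
  · intro x a k
    fin_cases a <;> fin_cases k <;> simp [row0]
  · simp only [List.forall_mem_cons, List.not_mem_nil, false_imp_iff, implies_true, and_true]
    refine ⟨?_, ?_⟩ <;>
    · refine ⟨by decide, fun x hx => ?_⟩
      simp [row0] at hx ⊢ <;> grind
  · intro x hx hg
    simp [row0, Fin.forall_fin_succ] at hx hg ⊢ <;> grind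

theorem finrank_cocycles_d3Small_zero_ne (l m : ℂ) (hl : l ≠ 0) (hm : m ≠ 0) :
    finrank ℂ (cocycles (d3Small l m).Alg 0) = 0 := by
  refine finrank_cocycles_of_rows _ exists_tup0 exists_tup1
    (coord_coboundary_zero (hasBracket_d3Small _ _))
    [(0, 0), (3, 0), (3, 1), (3, 2)]
    [((1, 1), [(0, 0)]), ((2, 1), [(0, 0)]), ((2, 2), [(0, 0)])]
    []
    rfl ?_ ?_ ?_
  · intro x a k
    fin_cases a <;> fin_cases k <;> simp [row0]
  · simp only [List.forall_mem_cons, List.not_mem_nil, false_imp_iff, implies_true, and_true]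
    refine ⟨?_, ?_, ?_⟩ <;>
    · refine ⟨by decide, fun x hx => ?_⟩
      simp [row0] at hx ⊢ <;> grind
  · intro x hx hg
    simp [row0, Fin.forall_fin_succ] at hx hg ⊢ <;> grind

theorem finrank_cocycles_d3Small_two_right (l : ℂ) (hl : l ≠ 0) :
    finrank ℂ (cocycles (d3Small l 0).Alg 2) = 15 := by
  refine finrank_cocycles_of_rows _ exists_tup2 exists_tup3
    (coord_coboundary_two (hasBracket_d3Small _ _))
    [(0, 0), (0, 1), (1, 0), (1, 1), (1, 2), (1, 3), (2, 0), (2, 2), (3, 2)]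
    [((2, 1), [(1, 1), (1, 2), (2, 2)]), ((2, 3), [(0, 1), (1, 3)]), ((3, 1), [(1, 0), (2, 0),
     (3, 2)]), ((3, 3), [(0, 0)])]
    [(1, 0), (1, 1), (2, 0), (2, 1), (2, 2), (2, 3), (3, 0), (3, 1), (4, 0), (4, 1), (4, 2),
     (5, 0), (5, 1), (5, 2), (5, 3)]
    rfl ?_ ?_ ?_
  · intro x a k
    fin_cases a <;> fin_cases k <;> simp [row2]
  · simp only [List.forall_mem_cons, List.not_mem_nil, false_imp_iff, implies_true, and_true]
    refine ⟨?_, ?_, ?_, ?_⟩ <;>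
    · refine ⟨by decide, fun x hx => ?_⟩
      simp [row2] at hx ⊢ <;> grind
  · intro x hx hg
    simp [row2, Fin.forall_fin_succ] at hx hg ⊢ <;> grind

theorem finrank_cocycles_d3Small_two_left (m : ℂ) (hm : m ≠ 0) :
    finrank ℂ (cocycles (d3Small 0 m).Alg 2) = 14 := by
  refine finrank_cocycles_of_rows _ exists_tup2 exists_tup3
    (coord_coboundary_two (hasBracket_d3Small _ _))
    [(0, 1), (1, 1), (2, 0), (2, 1), (2, 2), (2, 3), (3, 0), (3, 1), (3, 2), (3, 3)]
    [((0, 2), [(0, 1)]), ((1, 2), [(1, 1)])]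
    [(1, 0), (1, 1), (1, 2), (2, 0), (2, 1), (2, 2), (3, 2), (4, 0), (4, 1), (4, 2), (5, 0),
     (5, 1), (5, 2), (5, 3)]
    rfl ?_ ?_ ?_
  · intro x a k
    fin_cases a <;> fin_cases k <;> simp [row2]
  · simp only [List.forall_mem_cons, List.not_mem_nil, false_imp_iff, implies_true, and_true]
    refine ⟨?_, ?_⟩ <;>
    · refine ⟨by decide, fun x hx => ?_⟩
      simp [row2] at hx ⊢ <;> grind
  · intro x hx hg
    simp [row2, Fin.forall_fin_succ] at hx hg ⊢ <;> grind

/-- The resonance m = l + l concerns the e₃-component of φ(e₁,e₂). Since the action of e₄ is not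
diagonal in this basis, that component is expressed through the free coordinates (1,2) and (2,3). -/
theorem finrank_cocycles_d3Small_two_double (l : ℂ) (hl : l ≠ 0) :
    finrank ℂ (cocycles (d3Small l (2 * l)).Alg 2) = 13 := by
  refine finrank_cocycles_of_rows _ exists_tup2 exists_tup3
    (coord_coboundary_two (hasBracket_d3Small _ _))
    [(0, 0), (0, 1), (0, 2), (1, 0), (1, 1), (2, 0), (2, 1), (2, 2), (3, 0), (3, 1), (3, 2)]
    [((1, 3), [(0, 2)]), ((2, 3), [(0, 1), (0, 2)]), ((3, 3), [(0, 0)])]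
    [(1, 2), (2, 0), (2, 1), (2, 2), (2, 3), (4, 0), (4, 1), (4, 2), (4, 3), (5, 0), (5, 1),
     (5, 2), (5, 3)]
    rfl ?_ ?_ ?_
  · intro x a k
    fin_cases a <;> fin_cases k <;> simp [row2] <;> ring
  · simp only [List.forall_mem_cons, List.not_mem_nil, false_imp_iff, implies_true, and_true]
    refine ⟨?_, ?_, ?_⟩ <;>
    · refine ⟨by decide, fun x hx => ?_⟩
      simp [row2] at hx ⊢ <;> grind
  · intro x hx hg
    simp [row2, Fin.forall_fin_succ] at hx hg ⊢ <;> grind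

theorem finrank_cocycles_d3Small_two_generic (l m : ℂ) (hl : l ≠ 0) (hm : m ≠ 0)
    (h : m ≠ 2 * l) :
    finrank ℂ (cocycles (d3Small l m).Alg 2) = 12 := by
  refine finrank_cocycles_of_rows _ exists_tup2 exists_tup3
    (coord_coboundary_two (hasBracket_d3Small _ _))
    [(0, 0), (0, 1), (0, 2), (1, 0), (1, 1), (1, 2), (2, 0), (2, 1), (2, 2), (3, 0), (3, 1),
     (3, 2)]
    [((1, 3), [(0, 2)]), ((2, 3), [(0, 1), (0, 2)]), ((3, 3), [(0, 0)])]
    [(2, 0), (2, 1), (2, 2), (2, 3), (4, 0), (4, 1), (4, 2), (4, 3), (5, 0), (5, 1), (5, 2),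
     (5, 3)]
    rfl ?_ ?_ ?_
  · intro x a k
    fin_cases a <;> fin_cases k <;> simp [row2]
  · simp only [List.forall_mem_cons, List.not_mem_nil, false_imp_iff, implies_true, and_true]
    refine ⟨?_, ?_, ?_⟩ <;>
    · refine ⟨by decide, fun x hx => ?_⟩
      simp [row2] at hx ⊢ <;> grind
  · intro x hx hg
    simp [row2, Fin.forall_fin_succ] at hx hg ⊢ <;> grind

theorem finrank_cocycles_d3Small_three_left (m : ℂ) (hm : m ≠ 0) :
    finrank ℂ (cocycles (d3Small 0 m).Alg 3) = 12 := by
  refine finrank_cocycles_of_rows _ exists_tup3 exists_tup4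
    (coord_coboundary_three (hasBracket_d3Small _ _))
    [(0, 0), (0, 1), (0, 2), (0, 3)]
    []
    [(0, 2), (1, 0), (1, 1), (1, 2), (2, 0), (2, 1), (2, 2), (2, 3), (3, 0), (3, 1), (3, 2),
     (3, 3)]
    rfl ?_ ?_ ?_
  · intro x a k
    fin_cases a <;> fin_cases k <;> simp [row3]
  · simp
  · intro x hx hg
    simp [row3, Fin.forall_fin_succ] at hx hg ⊢ <;> grind

theorem finrank_cocycles_d3Small_three_trace_ne (l m : ℂ) (hl : l ≠ 0) (h : m ≠ -2 * l) :
    finrank ℂ (cocycles (d3Small l m).Alg 3) = 12 := by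
  refine finrank_cocycles_of_rows _ exists_tup3 exists_tup4
    (coord_coboundary_three (hasBracket_d3Small _ _))
    [(0, 0), (0, 1), (0, 2), (0, 3)]
    []
    [(0, 0), (0, 1), (1, 0), (1, 1), (1, 2), (2, 0), (2, 1), (2, 2), (2, 3), (3, 0), (3, 1),
     (3, 2)]
    rfl ?_ ?_ ?_
  · intro x a k
    fin_cases a <;> fin_cases k <;> simp [row3]
  · simp
  · intro x hx hg
    simp [row3, Fin.forall_fin_succ] at hx hg ⊢ <;> grind

theorem finrank_cocycles_d3Small_three_trace_zero (l : ℂ) (hl : l ≠ 0) :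
    finrank ℂ (cocycles (d3Small l (-2 * l)).Alg 3) = 13 := by
  refine finrank_cocycles_of_rows _ exists_tup3 exists_tup4
    (coord_coboundary_three (hasBracket_d3Small _ _))
    [(0, 0), (0, 1), (0, 2)]
    []
    [(0, 3), (1, 0), (1, 1), (1, 2), (1, 3), (2, 0), (2, 1), (2, 2), (2, 3), (3, 0), (3, 1),
     (3, 2), (3, 3)]
    rfl ?_ ?_ ?_
  · intro x a k
    fin_cases a <;> fin_cases k <;> simp [row3] <;> ring
  · simp
  · intro x hx hg
    simp [row3, Fin.forall_fin_succ] at hx hg ⊢ <;> grind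

theorem finrank_cocycles_d1Fam_zero_neg (l : ℂ) (hl : l ≠ 0) :
    finrank ℂ (cocycles (d1Fam l (-l)).Alg 0) = 1 := by
  refine finrank_cocycles_of_rows _ exists_tup0 exists_tup1
    (coord_coboundary_zero (hasBracket_d1Fam _ _))
    [(1, 0), (1, 1), (2, 0)]
    [((2, 1), [(1, 1)]), ((2, 2), [(1, 1)]), ((3, 1), [(1, 0), (2, 0)]), ((3, 2), [(1, 0)])]
    [(0, 0)]
    rfl ?_ ?_ ?_
  · intro x a k
    fin_cases a <;> fin_cases k <;> simp [row0]
  · simp only [List.forall_mem_cons, List.not_mem_nil, false_imp_iff, implies_true, and_true]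
    refine ⟨?_, ?_, ?_, ?_⟩ <;>
    · refine ⟨by decide, fun x hx => ?_⟩
      simp [row0] at hx ⊢ <;> grind
  · intro x hx hg
    simp [row0, Fin.forall_fin_succ] at hx hg ⊢ <;> grind

theorem finrank_cocycles_d1Fam_zero_ne (l m : ℂ) (h : l + m ≠ 0) :
    finrank ℂ (cocycles (d1Fam l m).Alg 0) = 0 := by
  refine finrank_cocycles_of_rows _ exists_tup0 exists_tup1
    (coord_coboundary_zero (hasBracket_d1Fam _ _))
    [(0, 0), (1, 0), (2, 0), (3, 0)]
    [((1, 1), [(0, 0)]), ((2, 1), [(0, 0)]), ((2, 2), [(0, 0)]), ((3, 1), [(1, 0), (2, 0)]),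
     ((3, 2), [(1, 0)])]
    []
    rfl ?_ ?_ ?_
  · intro x a k
    fin_cases a <;> fin_cases k <;> simp [row0]
  · simp only [List.forall_mem_cons, List.not_mem_nil, false_imp_iff, implies_true, and_true]
    refine ⟨?_, ?_, ?_, ?_, ?_⟩ <;>
    · refine ⟨by decide, fun x hx => ?_⟩
      simp [row0] at hx ⊢ <;> grind
  · intro x hx hg
    simp [row0, Fin.forall_fin_succ] at hx hg ⊢ <;> grind

theorem finrank_cocycles_d1Fam_two_neg (l : ℂ) (hl : l ≠ 0) :
    finrank ℂ (cocycles (d1Fam l (-l)).Alg 2) = 13 := by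
  refine finrank_cocycles_of_rows _ exists_tup2 exists_tup3
    (coord_coboundary_two (hasBracket_d1Fam _ _))
    [(0, 0), (0, 1), (0, 2), (1, 0), (1, 2), (2, 0), (2, 1), (3, 0), (3, 1), (3, 2), (3, 3)]
    [((1, 1), [(1, 2), (3, 3)]), ((1, 3), [(0, 2)]), ((2, 2), [(1, 2), (3, 3)]), ((2, 3),
     [(0, 1)])]
    [(1, 2), (2, 1), (3, 0), (3, 2), (3, 3), (4, 0), (4, 1), (4, 2), (4, 3), (5, 0), (5, 1),
     (5, 2), (5, 3)]
    rfl ?_ ?_ ?_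
  · intro x a k
    fin_cases a <;> fin_cases k <;> simp [row2]
  · simp only [List.forall_mem_cons, List.not_mem_nil, false_imp_iff, implies_true, and_true]
    refine ⟨?_, ?_, ?_, ?_⟩ <;>
    · refine ⟨by decide, fun x hx => ?_⟩
      simp [row2] at hx ⊢ <;> grind
  · intro x hx hg
    simp [row2, Fin.forall_fin_succ] at hx hg ⊢ <;> grind

theorem finrank_cocycles_d1Fam_two_left (m : ℂ) (hm : m ≠ 0) :
    finrank ℂ (cocycles (d1Fam 0 m).Alg 2) = 13 := by
  refine finrank_cocycles_of_rows _ exists_tup2 exists_tup3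
    (coord_coboundary_two (hasBracket_d1Fam _ _))
    [(0, 0), (0, 1), (1, 0), (1, 1), (2, 0), (2, 1), (2, 3), (3, 0), (3, 1), (3, 2), (3, 3)]
    [((0, 2), [(0, 1)]), ((1, 3), [(0, 1)]), ((2, 2), [(0, 0), (1, 1), (3, 3)])]
    [(1, 0), (1, 2), (2, 1), (2, 3), (3, 0), (3, 2), (4, 0), (4, 1), (4, 2), (5, 0), (5, 1),
     (5, 2), (5, 3)]
    rfl ?_ ?_ ?_
  · intro x a k
    fin_cases a <;> fin_cases k <;> simp [row2]
  · simp only [List.forall_mem_cons, List.not_mem_nil, false_imp_iff, implies_true, and_true]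
    refine ⟨?_, ?_, ?_⟩ <;>
    · refine ⟨by decide, fun x hx => ?_⟩
      simp [row2] at hx ⊢ <;> grind
  · intro x hx hg
    simp [row2, Fin.forall_fin_succ] at hx hg ⊢ <;> grind

theorem finrank_cocycles_d1Fam_two_right (l : ℂ) (hl : l ≠ 0) :
    finrank ℂ (cocycles (d1Fam l 0).Alg 2) = 13 := by
  refine finrank_cocycles_of_rows _ exists_tup2 exists_tup3
    (coord_coboundary_two (hasBracket_d1Fam _ _))
    [(1, 0), (1, 1), (1, 2), (1, 3), (2, 0), (2, 2), (2, 3), (3, 0), (3, 1), (3, 2), (3, 3)]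
    [((0, 0), [(1, 1), (2, 2), (3, 3)]), ((0, 1), [(1, 3), (2, 3)]), ((2, 1), [(1, 1), (1, 2),
     (2, 2)])]
    [(1, 0), (1, 1), (2, 3), (3, 0), (3, 1), (3, 2), (4, 0), (4, 1), (4, 2), (5, 0), (5, 1),
     (5, 2), (5, 3)]
    rfl ?_ ?_ ?_
  · intro x a k
    fin_cases a <;> fin_cases k <;> simp [row2]
  · simp only [List.forall_mem_cons, List.not_mem_nil, false_imp_iff, implies_true, and_true]
    refine ⟨?_, ?_, ?_⟩ <;>
    · refine ⟨by decide, fun x hx => ?_⟩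
      simp [row2] at hx ⊢ <;> grind
  · intro x hx hg
    simp [row2, Fin.forall_fin_succ] at hx hg ⊢ <;> grind

theorem finrank_cocycles_d1Fam_two_generic (l m : ℂ) (hl : l ≠ 0) (hm : m ≠ 0)
    (h : l + m ≠ 0) :
    finrank ℂ (cocycles (d1Fam l m).Alg 2) = 12 := by
  refine finrank_cocycles_of_rows _ exists_tup2 exists_tup3
    (coord_coboundary_two (hasBracket_d1Fam _ _))
    [(0, 0), (0, 1), (0, 2), (1, 0), (1, 1), (1, 2), (2, 0), (2, 1), (3, 0), (3, 1), (3, 2),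
     (3, 3)]
    [((1, 3), [(0, 2)]), ((2, 2), [(0, 0), (1, 1), (3, 3)]), ((2, 3), [(0, 1), (0, 2)])]
    [(2, 1), (2, 3), (3, 0), (3, 2), (4, 0), (4, 1), (4, 2), (4, 3), (5, 0), (5, 1), (5, 2),
     (5, 3)]
    rfl ?_ ?_ ?_
  · intro x a k
    fin_cases a <;> fin_cases k <;> simp [row2]
  · simp only [List.forall_mem_cons, List.not_mem_nil, false_imp_iff, implies_true, and_true]
    refine ⟨?_, ?_, ?_⟩ <;>
    · refine ⟨by decide, fun x hx => ?_⟩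
      simp [row2] at hx ⊢ <;> grind
  · intro x hx hg
    simp [row2, Fin.forall_fin_succ] at hx hg ⊢ <;> grind

theorem finrank_cocycles_d1Fam_three_neg (l : ℂ) (hl : l ≠ 0) :
    finrank ℂ (cocycles (d1Fam l (-l)).Alg 3) = 13 := by
  refine finrank_cocycles_of_rows _ exists_tup3 exists_tup4
    (coord_coboundary_three (hasBracket_d1Fam _ _))
    [(0, 0), (0, 1), (0, 2)]
    []
    [(0, 0), (0, 3), (1, 0), (1, 2), (1, 3), (2, 0), (2, 1), (2, 2), (2, 3), (3, 0), (3, 1),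
     (3, 2), (3, 3)]
    rfl ?_ ?_ ?_
  · intro x a k
    fin_cases a <;> fin_cases k <;> simp [row3]
  · simp
  · intro x hx hg
    simp [row3, Fin.forall_fin_succ] at hx hg ⊢ <;> grind

theorem finrank_cocycles_d1Fam_three_ne (l m : ℂ) (h : l + m ≠ 0) :
    finrank ℂ (cocycles (d1Fam l m).Alg 3) = 12 := by
  refine finrank_cocycles_of_rows _ exists_tup3 exists_tup4
    (coord_coboundary_three (hasBracket_d1Fam _ _))
    [(0, 0), (0, 1), (0, 2), (0, 3)]
    []
    [(0, 1), (1, 0), (1, 1), (1, 2), (2, 0), (2, 1), (2, 2), (2, 3), (3, 0), (3, 1), (3, 2),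
     (3, 3)]
    rfl ?_ ?_ ?_
  · intro x a k
    fin_cases a <;> fin_cases k <;> simp [row3]
  · simp
  · intro x hx hg
    simp [row3, Fin.forall_fin_succ] at hx hg ⊢ <;> grind

theorem finrank_cocycles_d1Sharp_zero : finrank ℂ (cocycles d1Sharp.Alg 0) = 0 := by
  refine finrank_cocycles_of_rows _ exists_tup0 exists_tup1
    (coord_coboundary_zero hasBracket_d1Sharp)
    [(0, 0), (1, 0), (2, 0), (3, 0)]
    [((1, 1), [(0, 0)]), ((2, 2), [(0, 0)]), ((3, 1), [(2, 0)]), ((3, 2), [(1, 0)])]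
    []
    rfl ?_ ?_ ?_
  · intro x a k
    fin_cases a <;> fin_cases k <;> simp [row0]
  · simp only [List.forall_mem_cons, List.not_mem_nil, false_imp_iff, implies_true, and_true]
    refine ⟨?_, ?_, ?_, ?_⟩ <;>
    · refine ⟨by decide, fun x hx => ?_⟩
      simp [row0] at hx ⊢ <;> grind
  · intro x hx hg
    simp [row0, Fin.forall_fin_succ] at hx hg ⊢ <;> grind

/-- Here e₄ acts on ⟨e₂,e₃⟩ by a scalar, so every 2 × 2 block is allowed there; the image of e₄ in
⟨e₁,e₂,e₃⟩ gives 3 further parameters and fixes the e₁-components of the images of e₂ and e₃. -/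
theorem finrank_cocycles_d1Sharp_one : finrank ℂ (cocycles d1Sharp.Alg 1) = 7 := by
  refine finrank_cocycles_of_rows _ exists_tup1 exists_tup2
    (coord_coboundary_one hasBracket_d1Sharp)
    [(0, 1), (2, 0), (2, 1), (2, 2), (3, 0), (4, 0), (4, 3), (5, 0), (5, 3)]
    [((0, 0), [(2, 2), (4, 3)]), ((1, 0), [(2, 1), (5, 3)]), ((1, 2), [(0, 1)]), ((2, 3),
     [(0, 1)]), ((3, 1), [(2, 1), (5, 3)]), ((3, 2), [(2, 2), (4, 3)]), ((3, 3), [(0, 1)]), ((4, 1),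
     [(2, 0)]), ((5, 2), [(2, 0)])]
    [(1, 1), (1, 2), (2, 1), (2, 2), (3, 0), (3, 1), (3, 2)]
    rfl ?_ ?_ ?_
  · intro x a k
    fin_cases a <;> fin_cases k <;> simp [row1]
  · simp only [List.forall_mem_cons, List.not_mem_nil, false_imp_iff, implies_true, and_true]
    refine ⟨?_, ?_, ?_, ?_, ?_, ?_, ?_, ?_, ?_⟩ <;>
    · refine ⟨by decide, fun x hx => ?_⟩
      simp [row1] at hx ⊢ <;> grind
  · intro x hx hg
    simp [row1, Fin.forall_fin_succ] at hx hg ⊢ <;> grind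

theorem finrank_cocycles_d1Sharp_two : finrank ℂ (cocycles d1Sharp.Alg 2) = 12 := by
  refine finrank_cocycles_of_rows _ exists_tup2 exists_tup3
    (coord_coboundary_two hasBracket_d1Sharp)
    [(0, 1), (0, 2), (1, 0), (1, 1), (1, 2), (2, 0), (2, 1), (2, 2), (3, 0), (3, 1), (3, 2),
     (3, 3)]
    [((0, 0), [(1, 1), (2, 2), (3, 3)]), ((1, 3), [(0, 2)]), ((2, 3), [(0, 1)])]
    [(2, 1), (2, 2), (2, 3), (3, 0), (4, 0), (4, 1), (4, 2), (4, 3), (5, 0), (5, 1), (5, 2),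
     (5, 3)]
    rfl ?_ ?_ ?_
  · intro x a k
    fin_cases a <;> fin_cases k <;> simp [row2]
  · simp only [List.forall_mem_cons, List.not_mem_nil, false_imp_iff, implies_true, and_true]
    refine ⟨?_, ?_, ?_⟩ <;>
    · refine ⟨by decide, fun x hx => ?_⟩
      simp [row2] at hx ⊢ <;> grind
  · intro x hx hg
    simp [row2, Fin.forall_fin_succ] at hx hg ⊢ <;> grind

theorem finrank_cocycles_d1Sharp_three : finrank ℂ (cocycles d1Sharp.Alg 3) = 12 := by
  refine finrank_cocycles_of_rows _ exists_tup3 exists_tup4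
    (coord_coboundary_three hasBracket_d1Sharp)
    [(0, 0), (0, 1), (0, 2), (0, 3)]
    []
    [(1, 0), (1, 1), (1, 2), (1, 3), (2, 0), (2, 1), (2, 2), (2, 3), (3, 0), (3, 1), (3, 2),
     (3, 3)]
    rfl ?_ ?_ ?_
  · intro x a k
    fin_cases a <;> fin_cases k <;> simp [row3]
  · simp
  · intro x hx hg
    simp [row3, Fin.forall_fin_succ] at hx hg ⊢ <;> grind

theorem finrank_cocycles_d1_zero : finrank ℂ (cocycles d1.Alg 0) = 2 := by
  refine finrank_cocycles_of_rows _ exists_tup0 exists_tup1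
    (coord_coboundary_zero hasBracket_d1)
    [(1, 0), (3, 0)]
    []
    [(0, 0), (0, 2)]
    rfl ?_ ?_ ?_
  · intro x a k
    fin_cases a <;> fin_cases k <;> simp [row0]
  · simp
  · intro x hx hg
    simp [row0, Fin.forall_fin_succ] at hx hg ⊢ <;> grind

theorem finrank_cocycles_d1_one : finrank ℂ (cocycles d1.Alg 1) = 10 := by
  refine finrank_cocycles_of_rows _ exists_tup1 exists_tup2
    (coord_coboundary_one hasBracket_d1)
    [(0, 0), (2, 0), (3, 0), (4, 0), (4, 2), (5, 0)]
    [((4, 1), [(2, 0)]), ((4, 3), [(0, 0)])]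
    [(1, 0), (1, 1), (1, 2), (1, 3), (2, 0), (2, 2), (3, 0), (3, 1), (3, 2), (3, 3)]
    rfl ?_ ?_ ?_
  · intro x a k
    fin_cases a <;> fin_cases k <;> simp [row1]
  · simp only [List.forall_mem_cons, List.not_mem_nil, false_imp_iff, implies_true, and_true]
    refine ⟨?_, ?_⟩ <;>
    · refine ⟨by decide, fun x hx => ?_⟩
      simp [row1] at hx ⊢ <;> grind
  · intro x hx hg
    simp [row1, Fin.forall_fin_succ] at hx hg ⊢ <;> grind

theorem finrank_cocycles_d1_two : finrank ℂ (cocycles d1.Alg 2) = 19 := by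
  refine finrank_cocycles_of_rows _ exists_tup2 exists_tup3
    (coord_coboundary_two hasBracket_d1)
    [(0, 0), (1, 0), (2, 0), (3, 0), (3, 2)]
    [((3, 1), [(2, 0)]), ((3, 3), [(0, 0)])]
    [(0, 0), (0, 2), (0, 3), (2, 0), (2, 1), (2, 2), (2, 3), (3, 0), (3, 1), (3, 2), (3, 3),
     (4, 0), (4, 1), (4, 2), (4, 3), (5, 0), (5, 1), (5, 2), (5, 3)]
    rfl ?_ ?_ ?_
  · intro x a k
    fin_cases a <;> fin_cases k <;> simp [row2]
  · simp only [List.forall_mem_cons, List.not_mem_nil, false_imp_iff, implies_true, and_true]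
    refine ⟨?_, ?_⟩ <;>
    · refine ⟨by decide, fun x hx => ?_⟩
      simp [row2] at hx ⊢ <;> grind
  · intro x hx hg
    simp [row2, Fin.forall_fin_succ] at hx hg ⊢ <;> grind

theorem finrank_cocycles_d1_three : finrank ℂ (cocycles d1.Alg 3) = 15 := by
  refine finrank_cocycles_of_rows _ exists_tup3 exists_tup4
    (coord_coboundary_three hasBracket_d1)
    [(0, 0)]
    []
    [(0, 0), (0, 2), (0, 3), (1, 0), (1, 1), (1, 2), (1, 3), (2, 0), (2, 1), (2, 2), (2, 3),
     (3, 0), (3, 1), (3, 2), (3, 3)]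
    rfl ?_ ?_ ?_
  · intro x a k
    fin_cases a <;> fin_cases k <;> simp [row3]
  · simp
  · intro x hx hg
    simp [row3, Fin.forall_fin_succ] at hx hg ⊢ <;> grind

theorem finrank_cocycles_d2Star_zero : finrank ℂ (cocycles d2Star.Alg 0) = 1 := by
  refine finrank_cocycles_of_rows _ exists_tup0 exists_tup1
    (coord_coboundary_zero hasBracket_d2Star)
    [(1, 0), (3, 0), (3, 1)]
    [((2, 1), [(1, 0)])]
    [(0, 0)]
    rfl ?_ ?_ ?_
  · intro x a k
    fin_cases a <;> fin_cases k <;> simp [row0]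
  · simp only [List.forall_mem_cons, List.not_mem_nil, false_imp_iff, implies_true, and_true]
    refine ⟨by decide, fun x hx => ?_⟩
    simp [row0] at hx ⊢ <;> grind
  · intro x hx hg
    simp [row0, Fin.forall_fin_succ] at hx hg ⊢ <;> grind

theorem finrank_cocycles_d2Star_one : finrank ℂ (cocycles d2Star.Alg 1) = 7 := by
  refine finrank_cocycles_of_rows _ exists_tup1 exists_tup2
    (coord_coboundary_one hasBracket_d2Star)
    [(0, 0), (2, 0), (2, 1), (3, 0), (3, 1), (4, 0), (5, 0), (5, 1), (5, 2)]
    [((1, 1), [(0, 0)]), ((4, 1), [(2, 0), (5, 2)]), ((4, 2), [(2, 1)]), ((4, 3), [(0, 0)]),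
     ((5, 3), [(3, 1)])]
    [(1, 1), (2, 0), (2, 1), (3, 0), (3, 1), (3, 2), (3, 3)]
    rfl ?_ ?_ ?_
  · intro x a k
    fin_cases a <;> fin_cases k <;> simp [row1]
  · simp only [List.forall_mem_cons, List.not_mem_nil, false_imp_iff, implies_true, and_true]
    refine ⟨?_, ?_, ?_, ?_, ?_⟩ <;>
    · refine ⟨by decide, fun x hx => ?_⟩
      simp [row1] at hx ⊢ <;> grind
  · intro x hx hg
    simp [row1, Fin.forall_fin_succ] at hx hg ⊢ <;> grind

theorem finrank_cocycles_d2Star_two : finrank ℂ (cocycles d2Star.Alg 2) = 15 := by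
  refine finrank_cocycles_of_rows _ exists_tup2 exists_tup3
    (coord_coboundary_two hasBracket_d2Star)
    [(0, 0), (0, 1), (1, 0), (1, 1), (2, 0), (2, 1), (3, 0), (3, 1), (3, 2)]
    [((2, 2), [(1, 1)]), ((2, 3), [(0, 1)]), ((3, 3), [(0, 0)])]
    [(1, 1), (2, 0), (2, 1), (2, 2), (3, 0), (3, 1), (3, 3), (4, 0), (4, 1), (4, 2), (4, 3),
     (5, 0), (5, 1), (5, 2), (5, 3)]
    rfl ?_ ?_ ?_
  · intro x a k
    fin_cases a <;> fin_cases k <;> simp [row2]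
  · simp only [List.forall_mem_cons, List.not_mem_nil, false_imp_iff, implies_true, and_true]
    refine ⟨?_, ?_, ?_⟩ <;>
    · refine ⟨by decide, fun x hx => ?_⟩
      simp [row2] at hx ⊢ <;> grind
  · intro x hx hg
    simp [row2, Fin.forall_fin_succ] at hx hg ⊢ <;> grind

theorem finrank_cocycles_d2Star_three : finrank ℂ (cocycles d2Star.Alg 3) = 14 := by
  refine finrank_cocycles_of_rows _ exists_tup3 exists_tup4
    (coord_coboundary_three hasBracket_d2Star)
    [(0, 0), (0, 1)]
    []
    [(0, 0), (0, 3), (1, 0), (1, 1), (1, 2), (1, 3), (2, 0), (2, 1), (2, 2), (2, 3), (3, 0),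
     (3, 1), (3, 2), (3, 3)]
    rfl ?_ ?_ ?_
  · intro x a k
    fin_cases a <;> fin_cases k <;> simp [row3]
  · simp
  · intro x hx hg
    simp [row3, Fin.forall_fin_succ] at hx hg ⊢ <;> grind

theorem finrank_cocycles_d3Star_zero : finrank ℂ (cocycles d3Star.Alg 0) = 0 := by
  refine finrank_cocycles_of_rows _ exists_tup0 exists_tup1
    (coord_coboundary_zero hasBracket_d3Star)
    [(0, 0), (3, 0), (3, 1), (3, 2)]
    [((1, 1), [(0, 0)]), ((2, 2), [(0, 0)])]
    []
    rfl ?_ ?_ ?_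
  · intro x a k
    fin_cases a <;> fin_cases k <;> simp [row0]
  · simp only [List.forall_mem_cons, List.not_mem_nil, false_imp_iff, implies_true, and_true]
    refine ⟨?_, ?_⟩ <;>
    · refine ⟨by decide, fun x hx => ?_⟩
      simp [row0] at hx ⊢ <;> grind
  · intro x hx hg
    simp [row0, Fin.forall_fin_succ] at hx hg ⊢ <;> grind

/-- As e₄ acts by a scalar on ⟨e₁,e₂,e₃⟩, a derivation is an arbitrary 3 × 3 block together with an
arbitrary image of e₄ in this space. -/
theorem finrank_cocycles_d3Star_one : finrank ℂ (cocycles d3Star.Alg 1) = 12 := by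
  refine finrank_cocycles_of_rows _ exists_tup1 exists_tup2
    (coord_coboundary_one hasBracket_d3Star)
    [(0, 0), (0, 1), (1, 0), (2, 0)]
    [((1, 2), [(0, 1)]), ((2, 3), [(0, 1)]), ((3, 1), [(1, 0)]), ((3, 2), [(0, 0)]), ((4, 1),
     [(2, 0)]), ((4, 3), [(0, 0)]), ((5, 2), [(2, 0)]), ((5, 3), [(1, 0)])]
    [(0, 0), (0, 1), (0, 2), (1, 0), (1, 1), (1, 2), (2, 0), (2, 1), (2, 2), (3, 0), (3, 1),
     (3, 2)]
    rfl ?_ ?_ ?_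
  · intro x a k
    fin_cases a <;> fin_cases k <;> simp [row1]
  · simp only [List.forall_mem_cons, List.not_mem_nil, false_imp_iff, implies_true, and_true]
    refine ⟨?_, ?_, ?_, ?_, ?_, ?_, ?_, ?_⟩ <;>
    · refine ⟨by decide, fun x hx => ?_⟩
      simp [row1] at hx ⊢ <;> grind
  · intro x hx hg
    simp [row1, Fin.forall_fin_succ] at hx hg ⊢ <;> grind

theorem finrank_cocycles_d3Star_two : finrank ℂ (cocycles d3Star.Alg 2) = 12 := by
  refine finrank_cocycles_of_rows _ exists_tup2 exists_tup3
    (coord_coboundary_two hasBracket_d3Star)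
    [(0, 0), (0, 1), (0, 2), (1, 0), (1, 1), (1, 2), (2, 0), (2, 1), (2, 2), (3, 0), (3, 1),
     (3, 2)]
    [((1, 3), [(0, 2)]), ((2, 3), [(0, 1)]), ((3, 3), [(0, 0)])]
    [(2, 0), (2, 1), (2, 2), (2, 3), (4, 0), (4, 1), (4, 2), (4, 3), (5, 0), (5, 1), (5, 2),
     (5, 3)]
    rfl ?_ ?_ ?_
  · intro x a k
    fin_cases a <;> fin_cases k <;> simp [row2]
  · simp only [List.forall_mem_cons, List.not_mem_nil, false_imp_iff, implies_true, and_true]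
    refine ⟨?_, ?_, ?_⟩ <;>
    · refine ⟨by decide, fun x hx => ?_⟩
      simp [row2] at hx ⊢ <;> grind
  · intro x hx hg
    simp [row2, Fin.forall_fin_succ] at hx hg ⊢ <;> grind

theorem finrank_cocycles_d3Star_three : finrank ℂ (cocycles d3Star.Alg 3) = 12 := by
  refine finrank_cocycles_of_rows _ exists_tup3 exists_tup4
    (coord_coboundary_three hasBracket_d3Star)
    [(0, 0), (0, 1), (0, 2), (0, 3)]
    []
    [(1, 0), (1, 1), (1, 2), (1, 3), (2, 0), (2, 1), (2, 2), (2, 3), (3, 0), (3, 1), (3, 2),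
     (3, 3)]
    rfl ?_ ?_ ?_
  · intro x a k
    fin_cases a <;> fin_cases k <;> simp [row3]
  · simp
  · intro x hx hg
    simp [row3, Fin.forall_fin_succ] at hx hg ⊢ <;> grind

theorem finrank_cocycles_d3_zero : finrank ℂ (cocycles d3.Alg 0) = 1 := by
  refine finrank_cocycles_of_rows _ exists_tup0 exists_tup1
    (coord_coboundary_zero hasBracket_d3)
    [(0, 1), (0, 2), (1, 2)]
    [((1, 0), [(0, 1)]), ((2, 0), [(0, 2)]), ((2, 1), [(1, 2)])]
    [(0, 3)]
    rfl ?_ ?_ ?_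
  · intro x a k
    fin_cases a <;> fin_cases k <;> simp [row0]
  · simp only [List.forall_mem_cons, List.not_mem_nil, false_imp_iff, implies_true, and_true]
    refine ⟨?_, ?_, ?_⟩ <;>
    · refine ⟨by decide, fun x hx => ?_⟩
      simp [row0] at hx ⊢ <;> grind
  · intro x hx hg
    simp [row0, Fin.forall_fin_succ] at hx hg ⊢ <;> grind

/-- Three inner derivations from sl₂ and the scaling of the centre. -/
theorem finrank_cocycles_d3_one : finrank ℂ (cocycles d3.Alg 1) = 4 := by
  refine finrank_cocycles_of_rows _ exists_tup1 exists_tup2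
    (coord_coboundary_one hasBracket_d3)
    [(0, 0), (0, 1), (0, 2), (0, 3), (1, 0), (1, 1), (1, 3), (2, 1), (2, 2), (3, 0), (3, 3),
     (4, 2)]
    [((1, 2), [(0, 1)]), ((3, 1), [(1, 0)]), ((3, 2), [(0, 0)]), ((4, 0), [(2, 1)]), ((5, 0),
     [(2, 2)]), ((5, 1), [(4, 2)])]
    [(1, 0), (2, 0), (2, 1), (3, 3)]
    rfl ?_ ?_ ?_
  · intro x a k
    fin_cases a <;> fin_cases k <;> simp [row1]
  · simp only [List.forall_mem_cons, List.not_mem_nil, false_imp_iff, implies_true, and_true]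
    refine ⟨?_, ?_, ?_, ?_, ?_, ?_⟩ <;>
    · refine ⟨by decide, fun x hx => ?_⟩
      simp [row1] at hx ⊢ <;> grind
  · intro x hx hg
    simp [row1, Fin.forall_fin_succ] at hx hg ⊢ <;> grind

theorem finrank_cocycles_d3_two : finrank ℂ (cocycles d3.Alg 2) = 12 := by
  refine finrank_cocycles_of_rows _ exists_tup2 exists_tup3
    (coord_coboundary_two hasBracket_d3)
    [(0, 0), (0, 1), (0, 2), (1, 0), (1, 1), (1, 2), (1, 3), (2, 0), (2, 1), (2, 3), (3, 0),
     (3, 3)]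
    [((2, 2), [(1, 1)]), ((3, 1), [(2, 0)]), ((3, 2), [(1, 0)])]
    [(0, 2), (0, 3), (1, 1), (1, 2), (1, 3), (3, 0), (3, 1), (3, 2), (3, 3), (4, 0), (5, 0),
     (5, 1)]
    rfl ?_ ?_ ?_
  · intro x a k
    fin_cases a <;> fin_cases k <;> simp [row2]
  · simp only [List.forall_mem_cons, List.not_mem_nil, false_imp_iff, implies_true, and_true]
    refine ⟨?_, ?_, ?_⟩ <;>
    · refine ⟨by decide, fun x hx => ?_⟩
      simp [row2] at hx ⊢ <;> grind
  · intro x hx hg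
    simp [row2, Fin.forall_fin_succ] at hx hg ⊢ <;> grind

theorem finrank_cocycles_d3_three : finrank ℂ (cocycles d3.Alg 3) = 13 := by
  refine finrank_cocycles_of_rows _ exists_tup3 exists_tup4
    (coord_coboundary_three hasBracket_d3)
    [(0, 0), (0, 1), (0, 2)]
    []
    [(0, 0), (0, 1), (0, 2), (0, 3), (1, 2), (1, 3), (2, 1), (2, 2), (2, 3), (3, 0), (3, 1),
     (3, 2), (3, 3)]
    rfl ?_ ?_ ?_
  · intro x a k
    fin_cases a <;> fin_cases k <;> simp [row3]
  · simp
  · intro x hx hg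
    simp [row3, Fin.forall_fin_succ] at hx hg ⊢ <;> grind

theorem finrank_cocycles_d2Sharp_zero : finrank ℂ (cocycles d2Sharp.Alg 0) = 0 := by
  refine finrank_cocycles_of_rows _ exists_tup0 exists_tup1
    (coord_coboundary_zero hasBracket_d2Sharp)
    [(0, 0), (1, 0), (2, 2), (3, 2)]
    []
    []
    rfl ?_ ?_ ?_
  · intro x a k
    fin_cases a <;> fin_cases k <;> simp [row0]
  · simp
  · intro x hx hg
    simp [row0, Fin.forall_fin_succ] at hx hg ⊢ <;> grind

theorem finrank_cocycles_d2Sharp_one : finrank ℂ (cocycles d2Sharp.Alg 1) = 4 := by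
  refine finrank_cocycles_of_rows _ exists_tup1 exists_tup2
    (coord_coboundary_one hasBracket_d2Sharp)
    [(0, 0), (0, 1), (0, 2), (0, 3), (1, 0), (2, 0), (3, 0), (3, 2), (4, 0), (4, 2), (5, 2),
     (5, 3)]
    [((1, 2), [(0, 3)]), ((2, 2), [(0, 2)]), ((5, 0), [(3, 0)]), ((5, 1), [(1, 0)])]
    [(0, 0), (1, 0), (2, 2), (3, 2)]
    rfl ?_ ?_ ?_
  · intro x a k
    fin_cases a <;> fin_cases k <;> simp [row1]
  · simp only [List.forall_mem_cons, List.not_mem_nil, false_imp_iff, implies_true, and_true]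
    refine ⟨?_, ?_, ?_, ?_⟩ <;>
    · refine ⟨by decide, fun x hx => ?_⟩
      simp [row1] at hx ⊢ <;> grind
  · intro x hx hg
    simp [row1, Fin.forall_fin_succ] at hx hg ⊢ <;> grind

theorem finrank_cocycles_d2Sharp_two : finrank ℂ (cocycles d2Sharp.Alg 2) = 12 := by
  refine finrank_cocycles_of_rows _ exists_tup2 exists_tup3
    (coord_coboundary_two hasBracket_d2Sharp)
    [(0, 0), (0, 1), (0, 2), (0, 3), (1, 0), (1, 1), (1, 2), (1, 3), (2, 0), (3, 0), (3, 2),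
     (3, 3)]
    [((2, 1), [(0, 1)]), ((2, 2), [(1, 3)]), ((2, 3), [(0, 3)]), ((3, 1), [(0, 0)])]
    [(0, 0), (0, 1), (1, 2), (2, 0), (2, 2), (3, 2), (4, 0), (4, 2), (5, 0), (5, 1), (5, 2),
     (5, 3)]
    rfl ?_ ?_ ?_
  · intro x a k
    fin_cases a <;> fin_cases k <;> simp [row2]
  · simp only [List.forall_mem_cons, List.not_mem_nil, false_imp_iff, implies_true, and_true]
    refine ⟨?_, ?_, ?_, ?_⟩ <;>
    · refine ⟨by decide, fun x hx => ?_⟩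
      simp [row2] at hx ⊢ <;> grind
  · intro x hx hg
    simp [row2, Fin.forall_fin_succ] at hx hg ⊢ <;> grind

theorem finrank_cocycles_d2Sharp_three : finrank ℂ (cocycles d2Sharp.Alg 3) = 12 := by
  refine finrank_cocycles_of_rows _ exists_tup3 exists_tup4
    (coord_coboundary_three hasBracket_d2Sharp)
    [(0, 0), (0, 1), (0, 2), (0, 3)]
    []
    [(0, 2), (1, 0), (1, 1), (1, 2), (2, 0), (2, 1), (2, 2), (2, 3), (3, 0), (3, 1), (3, 2),
     (3, 3)]
    rfl ?_ ?_ ?_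
  · intro x a k
    fin_cases a <;> fin_cases k <;> simp [row3]
  · simp
  · intro x hx hg
    simp [row3, Fin.forall_fin_succ] at hx hg ⊢ <;> grind

end Table

theorem lie_eq_neg_of_lie {L : Type*} [LieRing L] {x y z : L} (h : ⁅x, y⁆ = z) : ⁅y, x⁆ = -z := by
  rw [← h, lie_skew]

/-! ### Invariance under isomorphism, and recognising an algebra from a basis. -/

section Transport

variable {L L' : Type*} [LieRing L] [LieAlgebra ℂ L] [LieRing L'] [LieAlgebra ℂ L']

/-- Transport of cochains along an isomorphism. -/
def transport (e : L ≃ₗ⁅ℂ⁆ L') (n : ℕ) : (L [⋀^Fin n]→ₗ[ℂ] L) →ₗ[ℂ] (L' [⋀^Fin n]→ₗ[ℂ] L') where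
  toFun φ := ((e : L →ₗ[ℂ] L').compAlternatingMap φ).compLinearMap (e.symm : L' →ₗ[ℂ] L)
  map_add' φ ψ := by ext v; simp
  map_smul' c φ := by ext v; simp

theorem transport_apply (e : L ≃ₗ⁅ℂ⁆ L') {n : ℕ} (φ : L [⋀^Fin n]→ₗ[ℂ] L) (v : Fin n → L') :
    transport e n φ v = e (φ fun i => e.symm (v i)) := rfl

theorem coboundary_transport (e : L ≃ₗ⁅ℂ⁆ L') {n : ℕ} (φ : L [⋀^Fin n]→ₗ[ℂ] L) :
    coboundary L' n (transport e n φ) = transport e (n + 1) (coboundary L n φ) := by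
  ext v
  simp only [transport_apply, coboundary_apply, coboundaryFun, map_sum, map_zsmul, map_sub,
    LieEquiv.map_lie, LieEquiv.apply_symm_apply]
  refine Finset.sum_congr rfl fun i _ => ?_
  congr 2
  refine Finset.sum_congr rfl fun j _ => ?_
  congr 2
  funext k
  simp only [Fin.removeNth, Function.update_apply, apply_ite e.symm, LieEquiv.map_lie]

theorem finrank_cocycles_le [Module.Finite ℂ L'] (e : L ≃ₗ⁅ℂ⁆ L') (n : ℕ) :
    finrank ℂ (cocycles L n) ≤ finrank ℂ (cocycles L' n) := by
  refine LinearMap.finrank_le_finrank_of_injective (f := (transport e n).restrict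
    (p := cocycles L n) (q := cocycles L' n) fun φ hφ => ?_) fun φ ψ h => ?_
  · rw [cocycles, LinearMap.mem_ker] at hφ ⊢
    rw [coboundary_transport, hφ, map_zero]
  · ext v
    have := DFunLike.congr_fun (congrArg Subtype.val h) fun i => e (v i)
    simpa [transport_apply] using this

theorem finrank_cocycles_congr [Module.Finite ℂ L] [Module.Finite ℂ L'] (e : L ≃ₗ⁅ℂ⁆ L') (n : ℕ) :
    finrank ℂ (cocycles L n) = finrank ℂ (cocycles L' n) :=
  (finrank_cocycles_le e n).antisymm (finrank_cocycles_le e.symm n)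

theorem HasCohomologyDims.of_equiv [Module.Finite ℂ L] [Module.Finite ℂ L'] (e : L ≃ₗ⁅ℂ⁆ L')
    {h₁ h₂ h₃ h₄ : ℕ} (h : HasCohomologyDims L h₁ h₂ h₃ h₄) :
    HasCohomologyDims L' h₁ h₂ h₃ h₄ := by
  have key : ∀ n, finrank ℂ (Cohomology L' (n + 1)) = finrank ℂ (Cohomology L (n + 1)) := by
    intro n
    have a := finrank_cohomology_add L (n + 1)
    have a' := finrank_cohomology_add L' (n + 1)
    have b := finrank_coboundaries_add L n
    have b' := finrank_coboundaries_add L' n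
    rw [finrank_cocycles_congr e, e.toLinearEquiv.finrank_eq] at b
    rw [finrank_cocycles_congr e] at a
    omega
  simpa only [HasCohomologyDims, key] using h

/-- Both brackets are bilinear, so equality of the six brackets of basis vectors, and of their
negatives, makes the identification of bases a Lie isomorphism. -/
theorem nonempty_equiv_of_basis {d : LieStructure ℂ} {a b c ε l m n p q : ℂ}
    (h : HasBracket d a b c ε l m n p q) (v : Basis (Fin 4) ℂ L)
    (h01 : ⁅v 0, v 1⁆ = c • v 0 + a • v 2) (h02 : ⁅v 0, v 2⁆ = b • v 1)
    (h12 : ⁅v 1, v 2⁆ = ε • v 0) (h03 : ⁅v 0, v 3⁆ = l • v 0)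
    (h13 : ⁅v 1, v 3⁆ = p • v 0 + m • v 1) (h23 : ⁅v 2, v 3⁆ = q • v 1 + n • v 2) :
    Nonempty (L ≃ₗ⁅ℂ⁆ d.Alg) := by
  obtain ⟨k01, k02, k12, k03, k13, k23⟩ := LieStructure.lie_basis h
  let e := v.equiv d.basis (Equiv.refl _)
  have he : ∀ i, e (v i) = d.basis i := fun i => by simp [e]
  have key : (LieModule.toEnd ℂ L L : L →ₗ[ℂ] L →ₗ[ℂ] L).compr₂ (e : L →ₗ[ℂ] d.Alg) =
      (LieModule.toEnd ℂ d.Alg d.Alg : d.Alg →ₗ[ℂ] d.Alg →ₗ[ℂ] d.Alg).compl₁₂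
        (e : L →ₗ[ℂ] d.Alg) (e : L →ₗ[ℂ] d.Alg) := by
    refine v.ext fun i => v.ext fun j => ?_
    simp only [LinearMap.compr₂_apply, LinearMap.compl₁₂_apply, LieHom.coe_toLinearMap,
      LieModule.toEnd_apply_apply, LinearEquiv.coe_coe, he]
    fin_cases i <;> fin_cases j <;>
      simp [h01, h02, h12, h03, h13, h23, k01, k02, k12, k03, k13, k23, he,
        lie_eq_neg_of_lie h01, lie_eq_neg_of_lie h02, lie_eq_neg_of_lie h12,
        lie_eq_neg_of_lie h03, lie_eq_neg_of_lie h13, lie_eq_neg_of_lie h23,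
        lie_eq_neg_of_lie k01, lie_eq_neg_of_lie k02, lie_eq_neg_of_lie k12,
        lie_eq_neg_of_lie k03, lie_eq_neg_of_lie k13, lie_eq_neg_of_lie k23]
  exact ⟨{ e with map_lie' := fun {x y} => DFunLike.congr_fun (DFunLike.congr_fun key x) y }⟩

theorem linearIndependent_four_iff {V : Type*} [AddCommGroup V] [Module ℂ V] {x y z w : V} :
    LinearIndependent ℂ ![x, y, z, w] ↔ ∀ a b c d : ℂ,
      a • x + b • y + c • z + d • w = 0 → a = 0 ∧ b = 0 ∧ c = 0 ∧ d = 0 := by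
  rw [Fintype.linearIndependent_iff]
  constructor
  · intro h a b c d e
    have := h ![a, b, c, d] (by simpa [Fin.sum_univ_four] using e)
    exact ⟨this 0, this 1, this 2, this 3⟩
  · intro h g hg
    obtain ⟨h0, h1, h2, h3⟩ := h (g 0) (g 1) (g 2) (g 3) (by simpa [Fin.sum_univ_four] using hg)
    intro i
    fin_cases i <;> assumption

theorem nonempty_equiv_of_linearIndependent {d : LieStructure ℂ} {a b c ε l m n p q : ℂ}
    (h : HasBracket d a b c ε l m n p q) (hL : finrank ℂ L = 4) {x y z w : L}
    (hv : LinearIndependent ℂ ![x, y, z, w])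
    (h01 : ⁅x, y⁆ = c • x + a • z) (h02 : ⁅x, z⁆ = b • y) (h12 : ⁅y, z⁆ = ε • x)
    (h03 : ⁅x, w⁆ = l • x) (h13 : ⁅y, w⁆ = p • x + m • y) (h23 : ⁅z, w⁆ = q • y + n • z) :
    Nonempty (L ≃ₗ⁅ℂ⁆ d.Alg) :=
  nonempty_equiv_of_basis h (basisOfLinearIndependentOfCardEqFinrank hv (by simp [hL]))
    (by simpa using h01) (by simpa using h02) (by simpa using h12) (by simpa using h03)
    (by simpa using h13) (by simpa using h23)

/-- The vector e₁ + (m - l)e₂ is an eigenvector for m of the bracket with e₄, and [e₂,e₄] is this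
vector plus l e₂. The change of basis is unipotent, so it works for l = m too. -/
theorem d3Big_swap_left (l m n : ℂ) :
    Nonempty ((d3Big l m n).Alg ≃ₗ⁅ℂ⁆ (d3Big m l n).Alg) := by
  have hb := hasBracket_d3Big l m n
  set d := d3Big l m n
  obtain ⟨h01, h02, h12, h03, h13, h23⟩ := LieStructure.lie_basis hb
  refine nonempty_equiv_of_linearIndependent (hasBracket_d3Big m l n) d.finrank_alg
    (x := d.basis 0 + (m - l) • d.basis 1) (y := d.basis 1) (z := d.basis 2) (w := d.basis 3)
    (linearIndependent_four_iff.2 fun s t u v h => ?_) ?_ ?_ ?_ ?_ ?_ ?_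
  · have := fun i => congrArg (fun x => d.basis.repr x i) h
    have h0 := this 0; have h1 := this 1; have h2 := this 2; have h3 := this 3
    simp at h0 h1 h2 h3
    simp_all
  all_goals simp only [add_lie, smul_lie, h01, h02, h12, h03, h13, h23, lie_self] <;> module

/-- With y = e₂ + (n - m)e₃ one has [y,e₄] = e₁ + n y and [e₃,e₄] = y + m e₃. The two transpositions
generate all permutations of the parameters. -/
theorem d3Big_swap_right (l m n : ℂ) :
    Nonempty ((d3Big l m n).Alg ≃ₗ⁅ℂ⁆ (d3Big l n m).Alg) := by
  have hb := hasBracket_d3Big l m n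
  set d := d3Big l m n
  obtain ⟨h01, h02, h12, h03, h13, h23⟩ := LieStructure.lie_basis hb
  refine nonempty_equiv_of_linearIndependent (hasBracket_d3Big l n m) d.finrank_alg
    (x := d.basis 0) (y := d.basis 1 + (n - m) • d.basis 2) (z := d.basis 2) (w := d.basis 3)
    (linearIndependent_four_iff.2 fun s t u v h => ?_) ?_ ?_ ?_ ?_ ?_ ?_
  · have := fun i => congrArg (fun x => d.basis.repr x i) h
    have h0 := this 0; have h1 := this 1; have h2 := this 2; have h3 := this 3
    simp at h0 h1 h2 h3
    simp_all
  all_goals simp only [add_lie, smul_lie, lie_add, lie_smul, h01, h02, h12, h03, h13, h23,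
    lie_self] <;> module

end Transport

/-! ### The table of dimensions. -/

theorem hasCohomologyDims_d3 : HasCohomologyDims d3.Alg 1 0 1 1 :=
  hasCohomologyDims_of_cocycles _ d3.finrank_alg finrank_cocycles_d3_zero finrank_cocycles_d3_one
    finrank_cocycles_d3_two finrank_cocycles_d3_three rfl rfl rfl rfl

theorem hasCohomologyDims_d2Sharp : HasCohomologyDims d2Sharp.Alg 0 0 0 0 :=
  hasCohomologyDims_of_cocycles _ d2Sharp.finrank_alg finrank_cocycles_d2Sharp_zero
    finrank_cocycles_d2Sharp_one finrank_cocycles_d2Sharp_two finrank_cocycles_d2Sharp_three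
    rfl rfl rfl rfl

theorem hasCohomologyDims_d1Sharp : HasCohomologyDims d1Sharp.Alg 3 3 0 0 :=
  hasCohomologyDims_of_cocycles _ d1Sharp.finrank_alg finrank_cocycles_d1Sharp_zero
    finrank_cocycles_d1Sharp_one finrank_cocycles_d1Sharp_two finrank_cocycles_d1Sharp_three
    rfl rfl rfl rfl

theorem hasCohomologyDims_d1 : HasCohomologyDims d1.Alg 8 13 10 3 :=
  hasCohomologyDims_of_cocycles _ d1.finrank_alg finrank_cocycles_d1_zero finrank_cocycles_d1_one
    finrank_cocycles_d1_two finrank_cocycles_d1_three rfl rfl rfl rfl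

theorem hasCohomologyDims_d2Star : HasCohomologyDims d2Star.Alg 4 6 5 2 :=
  hasCohomologyDims_of_cocycles _ d2Star.finrank_alg finrank_cocycles_d2Star_zero
    finrank_cocycles_d2Star_one finrank_cocycles_d2Star_two finrank_cocycles_d2Star_three
    rfl rfl rfl rfl

theorem hasCohomologyDims_d3Star : HasCohomologyDims d3Star.Alg 8 8 0 0 :=
  hasCohomologyDims_of_cocycles _ d3Star.finrank_alg finrank_cocycles_d3Star_zero
    finrank_cocycles_d3Star_one finrank_cocycles_d3Star_two finrank_cocycles_d3Star_three
    rfl rfl rfl rfl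

theorem hasCohomologyDims_d1Fam (l m : ℂ) (h : l ≠ 0 ∨ m ≠ 0) :
    (l + m = 0 → HasCohomologyDims (d1Fam l m).Alg 2 2 2 1) ∧
    (l = 0 ∨ m = 0 → HasCohomologyDims (d1Fam l m).Alg 1 2 1 0) ∧
    (l + m ≠ 0 → l ≠ 0 → m ≠ 0 → HasCohomologyDims (d1Fam l m).Alg 1 1 0 0) := by
  refine ⟨fun hs => ?_, fun hz => ?_, fun hs hl hm => ?_⟩
  · obtain rfl : m = -l := eq_neg_of_add_eq_zero_right hs
    have hl : l ≠ 0 := by simpa using h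
    exact hasCohomologyDims_of_cocycles _ (LieStructure.finrank_alg _)
      (finrank_cocycles_d1Fam_zero_neg l hl) (finrank_cocycles_d1Fam_one _ _ h)
      (finrank_cocycles_d1Fam_two_neg l hl) (finrank_cocycles_d1Fam_three_neg l hl)
      rfl rfl rfl rfl
  · rcases hz with rfl | rfl
    · have hm : m ≠ 0 := by simpa using h
      have hs : 0 + m ≠ 0 := by simpa using hm
      exact hasCohomologyDims_of_cocycles _ (LieStructure.finrank_alg _)
        (finrank_cocycles_d1Fam_zero_ne 0 m hs) (finrank_cocycles_d1Fam_one _ _ h)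
        (finrank_cocycles_d1Fam_two_left m hm) (finrank_cocycles_d1Fam_three_ne 0 m hs)
        rfl rfl rfl rfl
    · have hl : l ≠ 0 := by simpa using h
      have hs : l + 0 ≠ 0 := by simpa using hl
      exact hasCohomologyDims_of_cocycles _ (LieStructure.finrank_alg _)
        (finrank_cocycles_d1Fam_zero_ne l 0 hs) (finrank_cocycles_d1Fam_one _ _ h)
        (finrank_cocycles_d1Fam_two_right l hl) (finrank_cocycles_d1Fam_three_ne l 0 hs)
        rfl rfl rfl rfl
  · exact hasCohomologyDims_of_cocycles _ (LieStructure.finrank_alg _)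
      (finrank_cocycles_d1Fam_zero_ne l m hs) (finrank_cocycles_d1Fam_one _ _ h)
      (finrank_cocycles_d1Fam_two_generic l m hl hm hs) (finrank_cocycles_d1Fam_three_ne l m hs)
      rfl rfl rfl rfl

theorem hasCohomologyDims_d3Small (l m : ℂ) (h : l ≠ 0 ∨ m ≠ 0) :
    (m = 0 → HasCohomologyDims (d3Small l m).Alg 5 7 3 0) ∧
    (l = 0 → HasCohomologyDims (d3Small l m).Alg 6 6 2 0) ∧
    (m = 2 * l → HasCohomologyDims (d3Small l m).Alg 4 5 1 0) ∧
    (m = -2 * l → HasCohomologyDims (d3Small l m).Alg 4 4 1 1) ∧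
    (m ≠ 0 → l ≠ 0 → m ≠ 2 * l → m ≠ -2 * l → HasCohomologyDims (d3Small l m).Alg 4 4 0 0) := by
  have h0 := LieStructure.finrank_alg (d3Small l m)
  have h1 := finrank_cocycles_d3Small_one l m h
  refine ⟨fun e => ?_, fun e => ?_, fun e => ?_, fun e => ?_, fun hm hl h2 h3 => ?_⟩
  · subst e
    have hl : l ≠ 0 := by simpa using h
    exact hasCohomologyDims_of_cocycles _ h0 (finrank_cocycles_d3Small_zero_right l hl) h1
      (finrank_cocycles_d3Small_two_right l hl)
      (finrank_cocycles_d3Small_three_trace_ne l 0 hl (by simpa using hl)) rfl rfl rfl rfl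
  · subst e
    have hm : m ≠ 0 := by simpa using h
    exact hasCohomologyDims_of_cocycles _ h0 (finrank_cocycles_d3Small_zero_left m hm) h1
      (finrank_cocycles_d3Small_two_left m hm) (finrank_cocycles_d3Small_three_left m hm)
      rfl rfl rfl rfl
  · subst e
    have hl : l ≠ 0 := by simpa using h
    exact hasCohomologyDims_of_cocycles _ h0
      (finrank_cocycles_d3Small_zero_ne l _ hl (by simpa using hl)) h1
      (finrank_cocycles_d3Small_two_double l hl)
      (finrank_cocycles_d3Small_three_trace_ne l _ hl fun e => hl (by linear_combination e / 4))
      rfl rfl rfl rfl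
  · subst e
    have hl : l ≠ 0 := by simpa using h
    exact hasCohomologyDims_of_cocycles _ h0
      (finrank_cocycles_d3Small_zero_ne l _ hl (by simpa using hl)) h1
      (finrank_cocycles_d3Small_two_generic l _ hl (by simpa using hl)
        fun e => hl (by linear_combination -e / 4))
      (finrank_cocycles_d3Small_three_trace_zero l hl) rfl rfl rfl rfl
  · exact hasCohomologyDims_of_cocycles _ h0 (finrank_cocycles_d3Small_zero_ne l _ hl hm) h1
      (finrank_cocycles_d3Small_two_generic l m hl hm h2)
      (finrank_cocycles_d3Small_three_trace_ne l m hl h3) rfl rfl rfl rfl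

theorem HasCohomologyDims.d3Big_swap_left {l m n : ℂ} {h₁ h₂ h₃ h₄ : ℕ}
    (h : HasCohomologyDims (d3Big l m n).Alg h₁ h₂ h₃ h₄) :
    HasCohomologyDims (d3Big m l n).Alg h₁ h₂ h₃ h₄ :=
  (FourDimLie.d3Big_swap_left l m n).elim fun e => h.of_equiv e

theorem HasCohomologyDims.d3Big_swap_right {l m n : ℂ} {h₁ h₂ h₃ h₄ : ℕ}
    (h : HasCohomologyDims (d3Big l m n).Alg h₁ h₂ h₃ h₄) :
    HasCohomologyDims (d3Big l n m).Alg h₁ h₂ h₃ h₄ :=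
  (FourDimLie.d3Big_swap_right l m n).elim fun e => h.of_equiv e

theorem hasCohomologyDims_d3Big_antisymm (l : ℂ) (hl : l ≠ 0) :
    HasCohomologyDims (d3Big l (-l) 0).Alg 3 5 5 2 :=
  hasCohomologyDims_of_cocycles _ (LieStructure.finrank_alg _)
    (finrank_cocycles_d3Big_zero_zero l _ hl) (finrank_cocycles_d3Big_one _ _ _ hl)
    (finrank_cocycles_d3Big_two_antisymm l hl) (finrank_cocycles_d3Big_three_antisymm l hl)
    rfl rfl rfl rfl

theorem hasCohomologyDims_d3Big_zero (l m : ℂ) (h : l + m ≠ 0) :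
    HasCohomologyDims (d3Big l m 0).Alg 3 3 1 0 := by
  have key : ∀ l m : ℂ, l ≠ 0 → l + m ≠ 0 → HasCohomologyDims (d3Big l m 0).Alg 3 3 1 0 :=
    fun l m hl h => hasCohomologyDims_of_cocycles _ (LieStructure.finrank_alg _)
      (finrank_cocycles_d3Big_zero_zero l _ hl) (finrank_cocycles_d3Big_one _ _ _ hl)
      (finrank_cocycles_d3Big_two_zero l m hl h)
      (finrank_cocycles_d3Big_three_trace_ne l m 0 (by simpa using h)) rfl rfl rfl rfl
  -- If l = 0 then m ≠ 0, and exchanging the two reduces to the case of a nonzero first parameter.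
  by_cases hl : l = 0
  · subst hl
    exact (key m 0 (by simpa using h) (by simpa using h)).d3Big_swap_left
  · exact key l m hl h

theorem hasCohomologyDims_d3Big_sum (m n : ℂ) (hm : m ≠ 0) (hn : n ≠ 0) (h : m + n ≠ 0) :
    HasCohomologyDims (d3Big (m + n) m n).Alg 2 3 1 0 :=
  hasCohomologyDims_of_cocycles _ (LieStructure.finrank_alg _)
    (finrank_cocycles_d3Big_zero_ne _ m n h hm hn) (finrank_cocycles_d3Big_one _ _ _ h)
    (finrank_cocycles_d3Big_two_sum m n hm hn h)
    (finrank_cocycles_d3Big_three_trace_ne _ m n fun e => h (by linear_combination e / 2))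
    rfl rfl rfl rfl

theorem hasCohomologyDims_d3Big (l m n : ℂ) (h : l ≠ 0 ∨ m ≠ 0 ∨ n ≠ 0) :
    ((l = 0 ∨ m = 0 ∨ n = 0) → l + m + n = 0 →
      HasCohomologyDims (d3Big l m n).Alg 3 5 5 2) ∧
    ((l ≠ 0 ∧ m ≠ 0 ∧ n ≠ 0) → (l = m + n ∨ m = l + n ∨ n = l + m) →
      HasCohomologyDims (d3Big l m n).Alg 2 3 1 0) ∧
    ((l = 0 ∨ m = 0 ∨ n = 0) → l + m + n ≠ 0 →
      HasCohomologyDims (d3Big l m n).Alg 3 3 1 0) ∧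
    ((l ≠ 0 ∧ m ≠ 0 ∧ n ≠ 0) → l + m + n = 0 →
      HasCohomologyDims (d3Big l m n).Alg 2 2 1 1) ∧
    ((l ≠ 0 ∧ m ≠ 0 ∧ n ≠ 0) → (l ≠ m + n ∧ m ≠ l + n ∧ n ≠ l + m) → l + m + n ≠ 0 →
      HasCohomologyDims (d3Big l m n).Alg 2 2 0 0) := by
  refine ⟨fun hz hs => ?_, fun ⟨hl, hm, hn⟩ hs => ?_, fun hz hs => ?_, fun ⟨hl, hm, hn⟩ hs => ?_,
    fun ⟨hl, hm, hn⟩ ⟨h1, h2, h3⟩ hs => ?_⟩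
  · rcases hz with rfl | rfl | rfl
    · obtain rfl : n = -m := by linear_combination hs
      exact (hasCohomologyDims_d3Big_antisymm m (by simpa using h)).d3Big_swap_right.d3Big_swap_left
    · obtain rfl : n = -l := by linear_combination hs
      exact (hasCohomologyDims_d3Big_antisymm l (by simpa using h)).d3Big_swap_right
    · obtain rfl : m = -l := by linear_combination hs
      exact hasCohomologyDims_d3Big_antisymm l (by simpa using h)
  · rcases hs with rfl | rfl | rfl
    · exact hasCohomologyDims_d3Big_sum m n hm hn hl
    · exact (hasCohomologyDims_d3Big_sum l n hl hn hm).d3Big_swap_left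
    · exact (hasCohomologyDims_d3Big_sum l m hl hm hn).d3Big_swap_left.d3Big_swap_right
  · rcases hz with rfl | rfl | rfl
    · exact (hasCohomologyDims_d3Big_zero m n
        (by simpa using hs)).d3Big_swap_right.d3Big_swap_left
    · exact (hasCohomologyDims_d3Big_zero l n (by simpa using hs)).d3Big_swap_right
    · exact hasCohomologyDims_d3Big_zero l m (by simpa using hs)
  · obtain rfl : l = -(m + n) := by linear_combination hs
    exact hasCohomologyDims_of_cocycles _ (LieStructure.finrank_alg _)
      (finrank_cocycles_d3Big_zero_ne _ m n hl hm hn) (finrank_cocycles_d3Big_one _ _ _ hl)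
      (finrank_cocycles_d3Big_two_generic _ m n hl hm hn
        (fun e => hl (by linear_combination e / 2)) (fun e => hm (by linear_combination e / 2))
        fun e => hn (by linear_combination e / 2))
      (finrank_cocycles_d3Big_three_trace_zero m n hm hn (neg_ne_zero.1 hl)) rfl rfl rfl rfl
  · exact hasCohomologyDims_of_cocycles _ (LieStructure.finrank_alg _)
      (finrank_cocycles_d3Big_zero_ne _ m n hl hm hn) (finrank_cocycles_d3Big_one _ _ _ hl)
      (finrank_cocycles_d3Big_two_generic _ m n hl hm hn h1 h2 h3)
      (finrank_cocycles_d3Big_three_trace_ne _ m n hs) rfl rfl rfl rfl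

theorem hasCohomologyDims_of_isLieAbelian (L : Type*) [LieRing L] [LieAlgebra ℂ L]
    (hL : finrank ℂ L = 4) (h : IsLieAbelian L) : HasCohomologyDims L 16 24 16 4 := by
  have : Module.Finite ℂ L := Module.finite_of_finrank_pos (by omega)
  have key : ∀ n, finrank ℂ (cocycles L n) = Nat.choose 4 n * 4 := by
    intro n
    have : cocycles L n = ⊤ := by
      refine LinearMap.ker_eq_top.2 (LinearMap.ext fun φ => AlternatingMap.ext fun v => ?_)
      rw [coboundary_apply]
      refine Finset.sum_eq_zero fun i _ => ?_
      refine (congrArg _ ?_).trans (smul_zero _)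
      rw [trivial_lie_zero, zero_sub, neg_eq_zero]
      refine Finset.sum_eq_zero fun j hj => ?_
      obtain ⟨k, rfl⟩ := Fin.exists_succAbove_eq (Finset.mem_Ioi.1 hj).ne'
      rw [trivial_lie_zero, Fin.removeNth_update_succAbove, AlternatingMap.map_update_zero]
    rw [this, finrank_top, finrank_cochains, hL]
  exact hasCohomologyDims_of_cocycles _ hL (key 0) (key 1) (key 2) (key 3) rfl rfl rfl rfl

theorem subsingleton_cohomology_d3_two : Subsingleton (Cohomology d3.Alg 2) :=
  finrank_zero_iff.1 hasCohomologyDims_d3.2.1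

theorem subsingleton_cohomology_d2Sharp (n : ℕ) : Subsingleton (Cohomology d2Sharp.Alg n) := by
  obtain ⟨h1, h2, h3, h4⟩ := hasCohomologyDims_d2Sharp
  match n with
  | 0 =>
    have : Subsingleton (cocycles d2Sharp.Alg 0) := finrank_zero_iff.1 finrank_cocycles_d2Sharp_zero
    infer_instance
  | 1 => exact finrank_zero_iff.1 h1
  | 2 => exact finrank_zero_iff.1 h2
  | 3 => exact finrank_zero_iff.1 h3
  | 4 => exact finrank_zero_iff.1 h4
  | n + 5 =>
    have := subsingleton_cochains d2Sharp.Alg (n := n + 5) (by rw [LieStructure.finrank_alg]; omega)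
    infer_instance

/-! ### Structure constants and a linear formula for primitives. -/

section Rigidity

/-- The structure constants of `d`. -/
def LieStructure.const (d : LieStructure ℂ) (i j k : Fin 4) : ℂ :=
  d.br (Pi.single i 1) (Pi.single j 1) k

theorem LieStructure.repr_lie_basis (d : LieStructure ℂ) (i j k : Fin 4) :
    d.basis.repr ⁅d.basis i, d.basis j⁆ k = d.const i j k := by
  have h : ∀ i, d.basis i = (Pi.single i 1 : Fin 4 → ℂ) := fun i => Pi.basisFun_apply ℂ _ i
  rw [h, h]
  rfl

theorem LieStructure.lie_basis_eq_sum (d : LieStructure ℂ) (i j : Fin 4) :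
    ⁅d.basis i, d.basis j⁆ = ∑ k, d.const i j k • d.basis k := by
  simp_rw [← d.repr_lie_basis]
  exact (d.basis.sum_repr _).symm

theorem LieStructure.const_swap (d : LieStructure ℂ) (i j k : Fin 4) :
    d.const j i k = -d.const i j k := by
  rw [← d.repr_lie_basis, ← d.repr_lie_basis, ← lie_skew, map_neg, Finsupp.neg_apply]

theorem LieStructure.const_jacobi (d : LieStructure ℂ) (i j k t : Fin 4) :
    ∑ l, d.const j k l * d.const i l t =
      ∑ l, d.const i j l * d.const l k t + ∑ l, d.const i k l * d.const j l t := by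
  have := congrArg (fun x => d.basis.repr x t) (leibniz_lie (d.basis i) (d.basis j) (d.basis k))
  simpa [lie_basis_eq_sum, sum_lie, lie_sum, Finsupp.single_apply] using this

/-- An elementary alternating bilinear map. -/
noncomputable def LieStructure.elementary (d : LieStructure ℂ) (a b l : Fin 4) :
    d.Alg [⋀^Fin 2]→ₗ[ℂ] d.Alg :=
  -- The factor 1/2 compensates for counting (a,b) and (b,a) separately when the sum runs over all
  -- ordered pairs.
  (LinearMap.toSpanSingleton ℂ d.Alg ((2⁻¹ : ℂ) • d.basis l)).compAlternatingMap
    ((Matrix.detRowAlternating (n := Fin 2) (R := ℂ)).compLinearMap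
      (LinearMap.pi ![d.basis.coord a, d.basis.coord b]))

theorem LieStructure.elementary_apply (d : LieStructure ℂ) (a b l i j : Fin 4) :
    d.elementary a b l ![d.basis i, d.basis j] =
      ((if i = a then if j = b then (2⁻¹ : ℂ) else 0 else 0) -
        if i = b then if j = a then (2⁻¹ : ℂ) else 0 else 0) • d.basis l := by
  have : d.elementary a b l ![d.basis i, d.basis j] =
      (Matrix.of ![LinearMap.pi ![d.basis.coord a, d.basis.coord b] (d.basis i),
        LinearMap.pi ![d.basis.coord a, d.basis.coord b] (d.basis j)]).det •
        (2⁻¹ : ℂ) • d.basis l := by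
    simp only [elementary, LinearMap.compAlternatingMap_apply, AlternatingMap.compLinearMap_apply,
      LinearMap.toSpanSingleton_apply]
    congr 1
  rw [this, Matrix.det_fin_two, smul_smul]
  congr 1
  simp [Finsupp.single_apply]
  split_ifs <;> norm_num

theorem alternating_sum_apply {ι M N : Type*} [AddCommGroup M] [Module ℂ M] [AddCommGroup N]
    [Module ℂ N] {n : ℕ} (s : Finset ι) (f : ι → M [⋀^Fin n]→ₗ[ℂ] N) (v : Fin n → M) :
    (∑ a ∈ s, f a) v = ∑ a ∈ s, f a v :=
  map_sum (⟨⟨fun φ => φ v, rfl⟩, fun _ _ => rfl⟩ : (M [⋀^Fin n]→ₗ[ℂ] N) →+ N) f s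

/-- The alternating bilinear map with the given antisymmetric coefficients. -/
noncomputable def LieStructure.ofCoeff (d : LieStructure ℂ) (e : Fin 4 → Fin 4 → Fin 4 → ℂ) :
    d.Alg [⋀^Fin 2]→ₗ[ℂ] d.Alg :=
  ∑ a, ∑ b, ∑ l, e a b l • d.elementary a b l

theorem LieStructure.ofCoeff_apply (d : LieStructure ℂ) (e : Fin 4 → Fin 4 → Fin 4 → ℂ)
    (he : ∀ i j k, e j i k = -e i j k) (i j : Fin 4) :
    cur2 (d.ofCoeff e) (d.basis i) (d.basis j) = ∑ l, e i j l • d.basis l := by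
  rw [cur2_apply]
  simp only [ofCoeff, alternating_sum_apply, AlternatingMap.smul_apply, elementary_apply,
    sub_smul, smul_sub, Finset.sum_sub_distrib, ite_smul, smul_ite, zero_smul, smul_zero,
    Finset.sum_ite_irrel, Finset.sum_const_zero, Finset.sum_ite_eq, Finset.mem_univ, if_true]
  rw [← Finset.sum_sub_distrib]
  refine Finset.sum_congr rfl fun l _ => ?_
  rw [he i j l]
  module

/-- If the second cohomology vanishes, there is a linear formula for a primitive of a cocycle. -/
theorem exists_primitive (d : LieStructure ℂ) [Subsingleton (Cohomology d.Alg 2)] :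
    ∃ η : Fin 4 → Fin 4 → Fin 4 → Fin 4 → Fin 4 → ℂ, ∀ e : Fin 4 → Fin 4 → Fin 4 → ℂ,
      (∀ i j k, e j i k = -e i j k) →
      (∀ i j k t, ∑ l, (d.const j k l * e i l t + e j k l * d.const i l t) =
        ∑ l, (d.const i j l * e l k t + e i j l * d.const l k t) +
        ∑ l, (d.const i k l * e j l t + e i k l * d.const j l t)) →
      ∀ i j k, e i j k = ∑ l, ((∑ a, ∑ b, ∑ t, η j l a b t * e a b t) * d.const i l k -
        d.const i j l * (∑ a, ∑ b, ∑ t, η l k a b t * e a b t) -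
        (∑ a, ∑ b, ∑ t, η i l a b t * e a b t) * d.const j l k) := by
  obtain ⟨s, hs⟩ := (coboundary d.Alg 1).rangeRestrict.exists_rightInverse_of_surjective
    (LinearMap.range_rangeRestrict _)
  obtain ⟨H, hH⟩ := LinearMap.exists_extend s
  refine ⟨fun i k a b t => d.basis.repr (cur1 (H (d.elementary a b t)) (d.basis i)) k,
    fun e he hc i j k => ?_⟩
  have hmem : d.ofCoeff e ∈ LinearMap.range (coboundary d.Alg 1) := by
    have h0 : (coboundaries d.Alg 2).submoduleOf (cocycles d.Alg 2) = ⊤ :=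
      Submodule.Quotient.subsingleton_iff.1 inferInstance
    refine Submodule.submoduleOf_eq_top.1 h0 ?_
    -- The hypothesis on `e` is the linearised Jacobi identity, that is, the cocycle condition in
    -- coordinates; H² = 0 then makes the cochain a coboundary.
    refine LinearMap.mem_ker.2 (Basis.ext_alternating d.basis fun v _ => ?_)
    rw [show (fun i => d.basis (v i)) = ![d.basis (v 0), d.basis (v 1), d.basis (v 2)] by
      funext i; fin_cases i <;> rfl, coboundary_two_apply]
    refine d.basis.ext_elem fun t => ?_
    have := hc (v 0) (v 1) (v 2) t
    simp only [Finset.sum_add_distrib] at this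
    simp only [d.ofCoeff_apply e he, d.lie_basis_eq_sum, map_sum, map_smul, LinearMap.sum_apply,
      LinearMap.smul_apply, lie_sum, lie_smul, map_sub, map_add, Finsupp.sub_apply,
      Finsupp.add_apply, Finsupp.finsetSum_apply, Finsupp.smul_apply, Basis.repr_self,
      Finsupp.single_apply, smul_eq_mul, AlternatingMap.zero_apply, map_zero, Finsupp.zero_apply,
      mul_ite, mul_one, mul_zero, Finset.sum_ite_eq', Finset.mem_univ, if_true]
    have e3 : ∑ l, e (v 0) (v 1) l * d.const l (v 2) t =
        -∑ l, e (v 0) (v 1) l * d.const (v 2) l t := by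
      rw [← Finset.sum_neg_distrib]
      exact Finset.sum_congr rfl fun l _ => by rw [d.const_swap (v 2) l]; ring
    linear_combination this + e3
  have hu : coboundary d.Alg 1 (H (d.ofCoeff e)) = d.ofCoeff e := by
    have h1 := LinearMap.congr_fun hH ⟨_, hmem⟩
    have h2 := congrArg Subtype.val (LinearMap.congr_fun hs ⟨_, hmem⟩)
    simpa [← h1] using h2
  have hcur : ∀ i l, d.basis.repr (cur1 (H (d.ofCoeff e)) (d.basis i)) l =
      ∑ a, ∑ b, ∑ t, d.basis.repr (cur1 (H (d.elementary a b t)) (d.basis i)) l * e a b t := by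
    intro i l
    simp [cur1_apply, LieStructure.ofCoeff, alternating_sum_apply, map_sum,
      Finsupp.finsetSum_apply, mul_comm]
  have h3 := d.ofCoeff_apply e he i j
  rw [← hu, cur2_apply, coboundary_one_apply] at h3
  have h4 := congrArg (fun x => d.basis.repr x k) h3
  have hexp : ∀ j, cur1 (H (d.ofCoeff e)) (d.basis j) = ∑ l, (∑ a, ∑ b, ∑ t,
      d.basis.repr (cur1 (H (d.elementary a b t)) (d.basis j)) l * e a b t) • d.basis l := by
    intro j
    rw [← d.basis.sum_repr (cur1 _ _)]
    simp only [hcur]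
  simp only [hexp, d.lie_basis_eq_sum, map_sum, map_smul, lie_sum, lie_smul, map_sub,
    Finsupp.sub_apply, Finsupp.finsetSum_apply, Finsupp.smul_apply, Basis.repr_self,
    Finsupp.single_apply, smul_eq_mul, mul_ite, mul_one, mul_zero, Finset.sum_ite_eq',
    Finset.mem_univ, if_true] at h4
  simp only [Finset.sum_sub_distrib]
  exact h4.symm

end Rigidity

/-! ### Order-by-order trivialisation of a deformation. -/

section Lifting

variable {A : Type*} [CommRing A]

/-- The vectors of `A⁴` with entries in an ideal. -/
abbrev vectorsIn (J : Ideal A) : Submodule A (Fin 4 → A) := Submodule.pi Set.univ fun _ => J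

theorem mem_vectorsIn {J : Ideal A} {x : Fin 4 → A} : x ∈ vectorsIn J ↔ ∀ k, x k ∈ J := by
  simp [Submodule.mem_pi]

theorem map_mem_vectorsIn {J K : Ideal A} (F : (Fin 4 → A) →ₗ[A] (Fin 4 → A))
    (hF : ∀ l, F (Pi.single l 1) ∈ vectorsIn K) {x : Fin 4 → A} (hx : x ∈ vectorsIn J) :
    F x ∈ vectorsIn (J * K) := by
  rw [F.pi_apply_eq_sum_univ]
  refine Submodule.sum_mem _ fun l _ => mem_vectorsIn.2 fun k => ?_
  have h := mem_vectorsIn.1 (hF l) k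
  rw [show (fun j => if l = j then (1 : A) else 0) = Pi.single l 1 by
    funext j; simp [Pi.single_apply, eq_comm]]
  exact Ideal.mul_mem_mul (mem_vectorsIn.1 hx l) h

theorem map_mem_vectorsIn_self {J : Ideal A} (F : (Fin 4 → A) →ₗ[A] (Fin 4 → A))
    {x : Fin 4 → A} (hx : x ∈ vectorsIn J) : F x ∈ vectorsIn J := by
  have := map_mem_vectorsIn (K := ⊤) F (fun l => by simp) hx
  rwa [Ideal.mul_top] at this

theorem LieStructure.br_swap (D : LieStructure A) (x y : Fin 4 → A) : D.br y x = -D.br x y := by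
  have := D.self (x + y)
  simp only [map_add, LinearMap.add_apply, D.self, zero_add, add_zero] at this
  exact eq_neg_of_add_eq_zero_left this

variable [Algebra ℂ A]

/-- The failure of `e_i ↦ f i` to carry the constant structure `d` to `D`. -/
noncomputable def defect (d : LieStructure ℂ) (D : LieStructure A) (f : Fin 4 → Fin 4 → A)
    (i j : Fin 4) : Fin 4 → A :=
  ∑ l, d.const i j l • f l - D.br (f i) (f j)

theorem defect_swap (d : LieStructure ℂ) (D : LieStructure A) (f : Fin 4 → Fin 4 → A)
    (i j : Fin 4) : defect d D f j i = -defect d D f i j := by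
  rw [defect, defect, D.br_swap (f i)]
  simp only [d.const_swap i j, neg_smul, Finset.sum_neg_distrib]
  abel

theorem map_const_smul (D : (Fin 4 → A) →ₗ[A] (Fin 4 → A)) (c : ℂ) (x : Fin 4 → A) :
    D (c • x) = c • D x := by
  rw [← algebraMap_smul A c x, map_smul, algebraMap_smul]

theorem defect_jacobi (d : LieStructure ℂ) (D : LieStructure A) (f : Fin 4 → Fin 4 → A)
    -- Subtracting the Jacobi identity of D on f i, f j, f k from that of d cancels the mixed terms.
    -- Where the defect is small and f is close to the standard basis, the outcome is the cocycle
    -- condition for the defect to leading order.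
    (i j k : Fin 4) :
    ∑ l, d.const j k l • defect d D f i l + D.br (f i) (defect d D f j k) =
      (∑ l, d.const i j l • defect d D f l k + D.br (defect d D f i j) (f k)) +
      (∑ l, d.const i k l • defect d D f j l + D.br (f j) (defect d D f i k)) := by
  have hs : ∀ j k i, D.br (f i) (defect d D f j k) =
      ∑ l, d.const j k l • D.br (f i) (f l) - D.br (f i) (D.br (f j) (f k)) := by
    intro j k i
    rw [defect, map_sub, map_sum]
    simp only [map_const_smul]
  have h1 : ∀ j k i, ∑ l, d.const j k l • defect d D f i l + D.br (f i) (defect d D f j k) =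
      ∑ t, (∑ l, d.const j k l * d.const i l t) • f t - D.br (f i) (D.br (f j) (f k)) := by
    intro j k i
    rw [hs]
    simp only [defect, smul_sub, Finset.sum_sub_distrib, Finset.smul_sum, smul_smul,
      Finset.sum_smul]
    rw [Finset.sum_comm]
    abel
  have h2 : ∑ l, d.const i j l • defect d D f l k + D.br (defect d D f i j) (f k) =
      ∑ t, (∑ l, d.const i j l * d.const l k t) • f t - D.br (D.br (f i) (f j)) (f k) := by
    have h3 : D.br.flip (f k) (defect d D f i j) =
        ∑ l, d.const i j l • D.br.flip (f k) (f l) - D.br.flip (f k) (D.br (f i) (f j)) := by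
      rw [defect, map_sub, map_sum]
      simp only [map_const_smul]
    simp only [LinearMap.flip_apply] at h3
    rw [h3]
    simp only [defect, smul_sub, Finset.sum_sub_distrib, Finset.smul_sum, smul_smul,
      Finset.sum_smul]
    rw [Finset.sum_comm]
    abel
  rw [h1, h1, h2]
  simp only [d.const_jacobi i j k, add_smul, Finset.sum_add_distrib, D.jacobi (f i)]
  abel

/-- Adic continuity of the defect, needed to pass to the limit of successive approximations. -/
theorem defect_sub_mem (d : LieStructure ℂ) (D : LieStructure A) {J : Ideal A}
    {f f' : Fin 4 → Fin 4 → A} (h : ∀ i, f' i - f i ∈ vectorsIn J) (i j : Fin 4) :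
    defect d D f' i j - defect d D f i j ∈ vectorsIn J := by
  have e : defect d D f' i j - defect d D f i j = ∑ l, d.const i j l • (f' l - f l) -
      (D.br (f' i) (f' j - f j) + D.br.flip (f j) (f' i - f i)) := by
    simp only [defect, smul_sub, Finset.sum_sub_distrib, map_sub, LinearMap.flip_apply]
    abel
  rw [e]
  refine sub_mem (sum_mem fun l _ => ?_)
    (add_mem (map_mem_vectorsIn_self _ (h j)) (map_mem_vectorsIn_self _ (h i)))
  rw [← algebraMap_smul A]
  exact Submodule.smul_mem _ _ (h l)

/-- Bracketing with f i differs from the constant ad eᵢ by a matrix with entries in I, so on vectors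
with entries in J the error lies in J * I. -/
theorem br_sub_mem {d : LieStructure ℂ} {D : LieStructure A} {I J : Ideal A}
    (hD : ∀ i j, D.br (Pi.single i 1) (Pi.single j 1) - d.bracketIn A i j ∈ vectorsIn I)
    {f : Fin 4 → Fin 4 → A} (hf : ∀ i, f i - Pi.single i 1 ∈ vectorsIn I) {x : Fin 4 → A}
    (hx : x ∈ vectorsIn J) (i t : Fin 4) :
    D.br (f i) x t - ∑ l, d.const i l t • x l ∈ J * I := by
  let G : (Fin 4 → A) →ₗ[A] (Fin 4 → A) :=
    Matrix.mulVecLin (Matrix.of fun t l => algebraMap ℂ A (d.const i l t))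
  have hG : ∀ y t, G y t = ∑ l, d.const i l t • y l := by
    intro y t
    simp [G, Matrix.mulVec, dotProduct, Algebra.smul_def]
  have := mem_vectorsIn.1 (map_mem_vectorsIn (D.br (f i) - G) (K := I) (fun l => ?_) hx) t
  · rwa [LinearMap.sub_apply, Pi.sub_apply, hG] at this
  · have e : (D.br (f i) - G) (Pi.single l 1) = D.br.flip (Pi.single l 1) (f i - Pi.single i 1) +
        (D.br (Pi.single i 1) (Pi.single l 1) - d.bracketIn A i l) := by
      have : G (Pi.single l 1) = d.bracketIn A i l := by
        funext t
        simp [hG, Pi.single_apply, LieStructure.bracketIn, LieStructure.const, Algebra.smul_def]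
      rw [LinearMap.sub_apply, this, map_sub, LinearMap.flip_apply, LinearMap.flip_apply]
      abel
    rw [e]
    exact add_mem (map_mem_vectorsIn_self _ (hf i)) (hD i l)

/-- One step of Newton type: with E the defect, choose u with Du = E modulo I^(n+2) and replace f by
f + u. The linear part of the change cancels E, and the quadratic part has order 2n + 2 ≥ n + 2. -/
theorem exists_correction {d : LieStructure ℂ} [Subsingleton (Cohomology d.Alg 2)]
    {D : LieStructure A} {I : Ideal A}
    (hD : ∀ i j, D.br (Pi.single i 1) (Pi.single j 1) - d.bracketIn A i j ∈ vectorsIn I)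
    {f : Fin 4 → Fin 4 → A} (hf : ∀ i, f i - Pi.single i 1 ∈ vectorsIn I) {n : ℕ}
    (hn : ∀ i j, defect d D f i j ∈ vectorsIn (I ^ (n + 1))) :
    ∃ f' : Fin 4 → Fin 4 → A, (∀ i, f' i - f i ∈ vectorsIn (I ^ (n + 1))) ∧
      ∀ i j, defect d D f' i j ∈ vectorsIn (I ^ (n + 2)) := by
  obtain ⟨η, hη⟩ := exists_primitive d
  set E := defect d D f with hE
  let u : Fin 4 → Fin 4 → A := fun i l => ∑ a, ∑ b, ∑ t, η i l a b t • E a b t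
  have hu : ∀ i, u i ∈ vectorsIn (I ^ (n + 1)) := fun i => mem_vectorsIn.2 fun l =>
    sum_mem fun a _ => sum_mem fun b _ => sum_mem fun t _ => by
      rw [Algebra.smul_def]
      exact Ideal.mul_mem_left _ _ (mem_vectorsIn.1 (hn a b) t)
  have hbr : ∀ {x : Fin 4 → A}, x ∈ vectorsIn (I ^ (n + 1)) → ∀ i t,
      Ideal.Quotient.mkₐ ℂ (I ^ (n + 2)) (D.br (f i) x t) =
        ∑ l, d.const i l t • Ideal.Quotient.mkₐ ℂ (I ^ (n + 2)) (x l) := by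
    intro x hx i t
    simp only [← map_smul, ← map_sum]
    exact Ideal.Quotient.eq.2 (br_sub_mem hD hf hx i t)
  have key : ∀ i j k, Ideal.Quotient.mkₐ ℂ (I ^ (n + 2)) (E i j k) = ∑ l,
      (d.const i l k • Ideal.Quotient.mkₐ ℂ (I ^ (n + 2)) (u j l) -
        d.const i j l • Ideal.Quotient.mkₐ ℂ (I ^ (n + 2)) (u l k) -
        d.const j l k • Ideal.Quotient.mkₐ ℂ (I ^ (n + 2)) (u i l)) := by
    intro i j k
    -- The primitive formula is a statement about complex coefficients. Applying an arbitrary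
    -- ℂ-linear functional of the quotient turns the defect into such coefficients, and functionals
    -- separate points.
    rw [← sub_eq_zero, ← Module.forall_dual_apply_eq_zero_iff ℂ]
    intro F
    have := hη (fun i j k => F (Ideal.Quotient.mkₐ ℂ (I ^ (n + 2)) (E i j k)))
      (fun i j k => by rw [hE, defect_swap, Pi.neg_apply, map_neg, map_neg])
      (fun i j k t => ?_) i j k
    · rw [map_sub, this, sub_eq_zero]
      simp only [u, map_sum, map_smul, map_sub, smul_eq_mul]
      exact Finset.sum_congr rfl fun l _ => by ring
    · have h := congrArg (fun x => F (Ideal.Quotient.mkₐ ℂ (I ^ (n + 2)) (x t)))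
        (defect_jacobi d D f i j k)
      rw [D.br_swap (f k)] at h
      simp only [Pi.add_apply, Pi.neg_apply, Finset.sum_apply, Pi.smul_apply, map_add, map_neg,
        map_sum, map_smul, hbr (hn _ _), smul_eq_mul, ← hE, d.const_swap k, neg_mul,
        Finset.sum_neg_distrib] at h
      simp only [Finset.sum_add_distrib]
      rw [Finset.sum_congr rfl fun l _ => mul_comm _ (d.const i l t),
        Finset.sum_congr rfl fun l _ => mul_comm _ (d.const l k t),
        Finset.sum_congr rfl fun l _ => mul_comm _ (d.const j l t)]
      simp only [d.const_swap _ k, neg_mul, Finset.sum_neg_distrib, neg_neg] at h ⊢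
      linear_combination h
  refine ⟨fun i => f i + u i, fun i => by simpa using hu i, fun i j => mem_vectorsIn.2 fun k => ?_⟩
  have e : defect d D (fun i => f i + u i) i j = E i j + ∑ l, d.const i j l • u l +
      D.br (f j) (u i) - D.br (f i) (u j) - D.br (u i) (u j) := by
    simp only [hE, defect, smul_add, Finset.sum_add_distrib, map_add, LinearMap.add_apply]
    rw [D.br_swap (u i) (f j)]
    abel
  have hq : D.br (u i) (u j) k ∈ I ^ (n + 2) := by
    have h1 := map_mem_vectorsIn (D.br (u i)) (K := I ^ (n + 1))
      (fun l => map_mem_vectorsIn_self (D.br.flip _) (hu i)) (hu j)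
    refine Ideal.pow_le_pow_right ?_ (by simpa only [← pow_add] using mem_vectorsIn.1 h1 k)
    omega
  rw [e]
  refine (Submodule.sub_mem_iff_left _ hq).2 (Ideal.Quotient.eq_zero_iff_mem.1 ?_)
  change Ideal.Quotient.mkₐ ℂ (I ^ (n + 2)) _ = 0
  simp only [Pi.sub_apply, Pi.add_apply, Finset.sum_apply, Pi.smul_apply, map_sub, map_add, map_sum,
    map_smul, hbr (hu _), key, Finset.sum_sub_distrib]
  abel

/-- The lifting argument: if the second cohomology vanishes, a structure that is constant modulo
an ideal with respect to which the ring is complete is constant. -/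
theorem exists_defect_eq_zero {d : LieStructure ℂ} [Subsingleton (Cohomology d.Alg 2)]
    {D : LieStructure A} {I : Ideal A} [IsAdicComplete I A]
    (hD : ∀ i j, D.br (Pi.single i 1) (Pi.single j 1) - d.bracketIn A i j ∈ vectorsIn I) :
    ∃ f : Fin 4 → Fin 4 → A, (∀ i, f i - Pi.single i 1 ∈ vectorsIn I) ∧
      ∀ i j, defect d D f i j = 0 := by
  -- Level n holds the frames whose defect has order n + 1; the type carries the invariants along
  -- the recursion.
  let S : ℕ → Type _ := fun n => {f : Fin 4 → Fin 4 → A //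
    (∀ i, f i - Pi.single i 1 ∈ vectorsIn I) ∧ ∀ i j, defect d D f i j ∈ vectorsIn (I ^ (n + 1))}
  have step : ∀ n (s : S n), ∃ s' : S (n + 1), ∀ i, s'.1 i - s.1 i ∈ vectorsIn (I ^ (n + 1)) := by
    intro n s
    obtain ⟨f', h1, h2⟩ := exists_correction hD s.2.1 s.2.2
    refine ⟨⟨f', fun i => ?_, h2⟩, h1⟩
    have := add_mem (mem_vectorsIn.2 fun k => Ideal.pow_le_self n.succ_ne_zero
      (mem_vectorsIn.1 (h1 i) k)) (s.2.1 i)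
    simpa using this
  choose next hnext using step
  let s0 : S 0 := ⟨fun i => Pi.single i 1, fun i => by simp, fun i j => by
    have e : defect d D (fun i => Pi.single i 1) i j =
        -(D.br (Pi.single i 1) (Pi.single j 1) - d.bracketIn A i j) := by
      funext k
      simp [defect, LieStructure.bracketIn, LieStructure.const, Pi.single_apply,
        Algebra.smul_def]
    rw [e, pow_one]
    exact neg_mem (hD i j)⟩
  let s : ∀ n, S n := fun n => Nat.rec s0 next n
  have hs : ∀ n i k, (s (n + 1)).1 i k - (s n).1 i k ∈ I ^ (n + 1) := fun n i k =>
    mem_vectorsIn.1 (hnext n (s n) i) k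
  have hc : ∀ i k {m n : ℕ}, m ≤ n → (s n).1 i k - (s m).1 i k ∈ I ^ m := by
    intro i k m n h
    induction n, h using Nat.le_induction with
    | base => simp
    | succ n h ih =>
      have := add_mem (Ideal.pow_le_pow_right (by omega : m ≤ n + 1) (hs n i k)) ih
      simpa using this
  have hlim : ∀ i k, ∃ y : A, ∀ n, (s n).1 i k - y ∈ I ^ n := by
    intro i k
    obtain ⟨y, hy⟩ := IsPrecomplete.prec' (I := I) (fun n => (s n).1 i k) fun {m n} h => by
      rw [SModEq.comm, SModEq.sub_mem, smul_eq_mul, Ideal.mul_top]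
      exact hc i k h
    refine ⟨y, fun n => ?_⟩
    have := hy n
    rwa [SModEq.sub_mem, smul_eq_mul, Ideal.mul_top] at this
  choose f hf using hlim
  have hfs : ∀ n i, f i - (s n).1 i ∈ vectorsIn (I ^ n) := fun n i => mem_vectorsIn.2 fun k => by
    have := neg_mem (hf i k n)
    rwa [neg_sub] at this
  refine ⟨f, fun i => ?_, fun i j => funext fun k => ?_⟩
  · have := add_mem (hfs 1 i) (by simpa using (s 1).2.1 i)
    simpa using this
  -- The defect of the limit differs from that of stage n by an element of Iⁿ, hence lies in every
  -- power of I.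
  · refine IsHausdorff.haus' (I := I) _ fun n => ?_
    rw [SModEq.zero, smul_eq_mul, Ideal.mul_top]
    have h1 := mem_vectorsIn.1 (defect_sub_mem d D (hfs n) i j) k
    have h2 := Ideal.pow_le_pow_right n.le_succ (mem_vectorsIn.1 ((s n).2.2 i j) k)
    have := add_mem h1 h2
    simpa using this

end Lifting

/-- A Lie algebra structure whose second cohomology vanishes is rigid. -/
theorem isRigid_of_subsingleton_cohomology (d : LieStructure ℂ)
    [Subsingleton (Cohomology d.Alg 2)] : IsRigid d := by
  intro A _ _ _ _ _ D hD
  obtain ⟨f, hf, h0⟩ := exists_defect_eq_zero (d := d) (D := D)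
    (I := IsLocalRing.maximalIdeal A) fun i j => mem_vectorsIn.2 (hD i j)
  -- The rows of M are the new frame vectors. Since M reduces to the identity, its determinant is a
  -- unit, and x ↦ xM is the required automorphism.
  let M : Matrix (Fin 4) (Fin 4) A := Matrix.of f
  have hM : IsUnit M.det := by
    have h1 : (IsLocalRing.residue A).mapMatrix M = 1 := by
      ext i k
      have := mem_vectorsIn.1 (hf i) k
      rw [Pi.sub_apply, ← IsLocalRing.residue_eq_zero_iff, map_sub, sub_eq_zero] at this
      rw [RingHom.mapMatrix_apply, Matrix.map_apply]
      refine this.trans ?_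
      rw [Matrix.one_apply, Pi.single_apply, apply_ite (IsLocalRing.residue A), map_one, map_zero]
      simp only [eq_comm]
    have h2 : IsLocalRing.residue A M.det = 1 := by rw [RingHom.map_det, h1, Matrix.det_one]
    exact isUnit_of_map_unit (IsLocalRing.residue A) _ (by rw [h2]; exact isUnit_one)
  let g : (Fin 4 → A) ≃ₗ[A] (Fin 4 → A) :=
    Matrix.toLinearEquivRight'OfInv (M := M⁻¹) (M' := M) (Matrix.nonsing_inv_mul M hM)
      (Matrix.mul_nonsing_inv M hM)
  have hg : ∀ x, g x = ∑ i, x i • f i := by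
    intro x
    funext k
    change Matrix.vecMul x M k = _
    simp only [Matrix.vecMul, dotProduct, Finset.sum_apply, Pi.smul_apply, smul_eq_mul]
    rfl
  have hgs : ∀ i, g (Pi.single i 1) = f i := by
    intro i
    simp [hg, Pi.single_apply]
  refine ⟨g, fun i k => ?_, fun i j => ?_⟩
  · rw [hgs]
    exact mem_vectorsIn.1 (hf i) k
  · rw [hgs, hgs, hg, ← sub_eq_zero]
    refine Eq.trans ?_ (h0 i j)
    simp only [defect, LieStructure.bracketIn, LieStructure.const, algebraMap_smul]

/-! ### Normal form of an endomorphism in dimension three. -/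

section NormalForm

theorem exists_add_eq_mul_eq (s p : ℂ) : ∃ l m : ℂ, l + m = s ∧ l * m = p := by
  obtain ⟨r, hr⟩ := IsAlgClosed.exists_eq_mul_self (s ^ 2 - 4 * p)
  exact ⟨(s + r) / 2, (s - r) / 2, by ring, by linear_combination hr / 4⟩

theorem exists_root_cubic (a b c : ℂ) : ∃ n : ℂ, n ^ 3 = a + b * n + c * n ^ 2 := by
  open Polynomial in
  obtain ⟨n, hn⟩ := IsAlgClosed.exists_root
    (X ^ 3 - (C c * X ^ 2 + C b * X + C a) : ℂ[X]) (by
      rw [degree_sub_eq_left_of_degree_lt]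
      · simp
      · rw [degree_X_pow]
        exact (degree_quadratic_le).trans_lt (by decide))
  refine ⟨n, ?_⟩
  simp [Polynomial.IsRoot] at hn
  linear_combination hn

variable {V : Type*} [AddCommGroup V] [Module ℂ V]

theorem linearIndependent_three {x y z : V} : LinearIndependent ℂ ![x, y, z] ↔
    ∀ a b c : ℂ, a • x + b • y + c • z = 0 → a = 0 ∧ b = 0 ∧ c = 0 := by
  rw [Fintype.linearIndependent_iff]
  constructor
  · intro h a b c e
    have := h ![a, b, c] (by simpa [Fin.sum_univ_three] using e)
    exact ⟨this 0, this 1, this 2⟩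
  · intro h g hg
    obtain ⟨h0, h1, h2⟩ := h (g 0) (g 1) (g 2) (by simpa [Fin.sum_univ_three] using hg)
    intro i
    fin_cases i <;> assumption

theorem exists_combination_three (hV : finrank ℂ V = 3) {x y z : V}
    (h : LinearIndependent ℂ ![x, y, z]) (u : V) : ∃ a b c : ℂ, u = a • x + b • y + c • z := by
  let v := basisOfLinearIndependentOfCardEqFinrank h (by simp [hV])
  refine ⟨v.repr u 0, v.repr u 1, v.repr u 2, ?_⟩
  conv_lhs => rw [← v.sum_repr u]
  simp [Fin.sum_univ_three, v]

theorem exists_combination_of_not {x y z : V} (h : LinearIndependent ℂ ![x, y])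
    (h' : ¬LinearIndependent ℂ ![x, y, z]) : ∃ a b : ℂ, z = a • x + b • y := by
  rw [linearIndependent_three] at h'
  push Not at h'
  obtain ⟨a, b, c, e, h0⟩ := h'
  by_cases hc : c = 0
  · subst hc
    obtain ⟨rfl, rfl⟩ := LinearIndependent.pair_iff.1 h a b (by simpa using e)
    exact absurd rfl (h0 rfl rfl)
  · refine ⟨-a / c, -b / c, ?_⟩
    have : c • z = -a • x + -b • y := by
      rw [← sub_eq_zero, ← e]
      module
    rw [← inv_smul_smul₀ hc z, this]
    module

theorem exists_linearIndependent_three (hV : 2 < finrank ℂ V) {x y : V}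
    (h : LinearIndependent ℂ ![x, y]) : ∃ z, LinearIndependent ℂ ![x, y, z] := by
  by_contra hc
  push Not at hc
  have : Module.Finite ℂ V := Module.finite_of_finrank_pos (by omega)
  have hle : (⊤ : Submodule ℂ V) ≤ Submodule.span ℂ (Set.range ![x, y]) := fun z _ => by
    obtain ⟨a, b, rfl⟩ := exists_combination_of_not h (hc z)
    exact add_mem (Submodule.smul_mem _ _ (Submodule.subset_span ⟨0, rfl⟩))
      (Submodule.smul_mem _ _ (Submodule.subset_span ⟨1, rfl⟩))
  have h1 := Submodule.finrank_mono hle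
  have h2 := finrank_range_le_card (R := ℂ) ![x, y]
  rw [finrank_top] at h1
  simp [Set.finrank] at h2
  omega

/-- A linear map for which every vector is an eigenvector is a scalar. -/
theorem exists_eq_smul_of_forall (M : V →ₗ[ℂ] V)
    (h : ∀ v, ¬LinearIndependent ℂ ![v, M v]) : ∃ l : ℂ, ∀ v, M v = l • v := by
  rcases subsingleton_or_nontrivial V with hV | hV
  · exact ⟨0, fun v => Subsingleton.elim _ _⟩
  obtain ⟨x, hx⟩ := exists_ne (0 : V)
  have hx' : ∀ y, ¬LinearIndependent ℂ ![x, y] → ∃ l : ℂ, y = l • x := by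
    intro y hy
    rw [LinearIndependent.pair_iff' hx] at hy
    push Not at hy
    exact hy.imp fun _ => Eq.symm
  obtain ⟨l, hl⟩ := hx' _ (h x)
  refine ⟨l, fun v => ?_⟩
  by_cases hv : LinearIndependent ℂ ![x, v]
  · have hv0 : v ≠ 0 := hv.ne_zero 1
    have h1 := h v
    rw [LinearIndependent.pair_iff' hv0] at h1
    push Not at h1
    obtain ⟨m, hm⟩ := h1
    have hxv : x + v ≠ 0 := fun e => by
      have := LinearIndependent.pair_iff.1 hv 1 1 (by simpa using e)
      exact one_ne_zero this.1
    have h2 := h (x + v)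
    rw [LinearIndependent.pair_iff' hxv] at h2
    push Not at h2
    obtain ⟨n, hn⟩ := h2
    rw [map_add, hl, ← hm] at hn
    obtain ⟨e1, e2⟩ := LinearIndependent.pair_iff.1 hv (n - l) (n - m) (by
      rw [← sub_eq_zero] at hn
      rw [← hn]
      module)
    rw [← hm]
    congr 1
    linear_combination e1 - e2
  · obtain ⟨m, rfl⟩ := hx' _ hv
    rw [map_smul, hl, smul_comm]

/-- A normal form for endomorphisms of a three-dimensional complex space. -/
theorem exists_normal_form (hV : finrank ℂ V = 3) (M : V →ₗ[ℂ] V) :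
    (∃ l : ℂ, ∀ v, M v = l • v) ∨
    (∃ (l m : ℂ) (x y z : V), LinearIndependent ℂ ![x, y, z] ∧ M x = l • x ∧ M y = l • y ∧
      M z = y + m • z) ∨
    (∃ (l m n : ℂ) (x y z : V), LinearIndependent ℂ ![x, y, z] ∧ M x = l • x ∧
      M y = x + m • y ∧ M z = y + n • z) := by
  by_cases hcyc : ∃ v, LinearIndependent ℂ ![v, M v, M (M v)]
  · obtain ⟨v, hv⟩ := hcyc
    obtain ⟨a, b, c, e⟩ := exists_combination_three hV hv (M (M (M v)))
    obtain ⟨n, hn⟩ := exists_root_cubic a b c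
    obtain ⟨l, m, hs, hp⟩ := exists_add_eq_mul_eq (c - n) (-b - n * (c - n))
    -- For a cyclic vector v and the roots l, m, n of its cubic relation, take z = v, y = (M - n)v
    -- and x = (M - m)(M - n)v.
    refine Or.inr (Or.inr ⟨l, m, n, M (M v) - (m + n) • M v + (m * n) • v, M v - n • v, v,
      linearIndependent_three.2 fun p q r h => ?_, ?_, ?_, ?_⟩)
    · obtain ⟨h1, h2, h3⟩ := linearIndependent_three.1 hv (p * (m * n) - q * n + r)
        (q - p * (m + n)) p (by rw [← h]; module)
      have h4 : q = 0 := by linear_combination h2 + (m + n) * h3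
      exact ⟨h3, h4, by linear_combination h1 - m * n * h3 + n * h4⟩
    · have hc : c = l + m + n := by linear_combination -hs
      have hb : b = -(l * m + l * n + m * n) := by
        linear_combination hp + n * hs
      have ha : a = l * m * n := by rw [hc, hb] at hn; linear_combination -hn
      simp only [map_add, map_sub, map_smul, e, ha, hb, hc]
      module
    · simp only [map_sub, map_smul]
      module
    · module
  push Not at hcyc
  by_cases hpair : ∃ v, LinearIndependent ℂ ![v, M v]
  swap
  · push Not at hpair
    exact Or.inl (exists_eq_smul_of_forall M hpair)
  obtain ⟨v, hv⟩ := hpair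
  obtain ⟨a, b, e⟩ := exists_combination_of_not hv (hcyc v)
  obtain ⟨u, hu⟩ := exists_linearIndependent_three (by omega) hv
  obtain ⟨p, q, s, eu⟩ := exists_combination_three hV hu (M u)
  have hu' := linearIndependent_three.1 hu
  -- Here M acts on ⟨v, Mv⟩ with characteristic polynomial t² - bt - a, and s is the eigenvalue on
  -- the quotient line. If s were not a root, u could be corrected to an eigenvector w for s, and v
  -- + w would be cyclic.
  have hs : s ^ 2 = a + b * s := by
    by_contra hs
    have hd : s ^ 2 - b * s - a ≠ 0 := fun h => hs (by linear_combination h)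
    -- Cramer's rule for (M - s)(αv + βMv) = -(pv + qMv); the determinant is s² - bs - a.
    obtain ⟨α, hα⟩ : ∃ α, α * (s ^ 2 - b * s - a) = a * q - p * (b - s) :=
      ⟨_, div_mul_cancel₀ _ hd⟩
    obtain ⟨β, hβ⟩ : ∃ β, β * (s ^ 2 - b * s - a) = s * q + p := ⟨_, div_mul_cancel₀ _ hd⟩
    have hw : M (u + (α • v + β • M v)) = s • (u + (α • v + β • M v)) := by
      have hp : p = s * α - a * β := by
        refine mul_right_cancel₀ hd ?_
        linear_combination a * hβ - s * hα
      have hq : q = s * β - b * β - α := by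
        refine mul_right_cancel₀ hd ?_
        linear_combination hα - (s - b) * hβ
      simp only [map_add, map_smul, eu, e, hp, hq]
      module
    refine hcyc (v + (u + (α • v + β • M v))) (linearIndependent_three.2 fun x y z h => ?_)
    rw [map_add, hw, map_add, map_smul, hw, e] at h
    obtain ⟨h1, h2, h3⟩ := hu' (x + z * a + α * (x + y * s + z * s ^ 2))
      (y + z * b + β * (x + y * s + z * s ^ 2)) (x + y * s + z * s ^ 2) (by rw [← h]; module)
    rw [h3, mul_zero, add_zero] at h1 h2
    have hz : z = 0 := by
      refine (mul_eq_zero.1 (?_ : z * (s ^ 2 - b * s - a) = 0)).resolve_right hd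
      linear_combination h3 - h1 - s * h2
    exact ⟨by linear_combination h1 - a * hz, by linear_combination h2 - b * hz, hz⟩
  have key : ∀ l m : ℂ, l + m = b → l * m = -a → s = l → ∃ (l m : ℂ) (x y z : V),
      LinearIndependent ℂ ![x, y, z] ∧ M x = l • x ∧ M y = l • y ∧ M z = y + m • z := by
    rintro l m hb ha rfl
    have ha' : a = -(s * m) := by rw [ha, neg_neg]
    subst ha'
    subst hb
    -- Since M(u - qv) = s(u - qv) + (p + qs)v, a nonzero coefficient would make u - qv cyclic; so
    -- it is a second eigenvector for s.
    have hp : p + q * s = 0 := by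
      by_contra hp
      refine hcyc (u - q • v) (linearIndependent_three.2 fun x y z h => ?_)
      simp only [map_sub, map_add, map_smul, eu, e] at h
      obtain ⟨h1, h2, h3⟩ := hu' (-q * (x + y * s + z * s ^ 2) + (y + z * s) * (p + q * s))
        (z * (p + q * s)) (x + y * s + z * s ^ 2) (by rw [← h]; module)
      rw [h3, mul_zero, zero_add] at h1
      have hz := (mul_eq_zero.1 h2).resolve_right hp
      have hy := (mul_eq_zero.1 h1).resolve_right hp
      have hy' : y = 0 := by linear_combination hy - s * hz
      exact ⟨by linear_combination h3 - s * hy' - s ^ 2 * hz, hy', hz⟩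
    refine ⟨s, m, u - q • v, M v - m • v, v, linearIndependent_three.2 fun x y z h => ?_,
      ?_, ?_, ?_⟩
    · obtain ⟨h1, h2, h3⟩ := hu' (z - y * m - x * q) y x (by rw [← h]; module)
      exact ⟨h3, h2, by linear_combination h1 + m * h2 + q * h3⟩
    · obtain rfl : p = -(q * s) := by linear_combination hp
      simp only [map_sub, map_smul, eu]
      module
    · simp only [map_sub, map_smul, e]
      module
    · module
  refine Or.inr (Or.inl ?_)
  obtain ⟨l, m, h1, h2⟩ := exists_add_eq_mul_eq b (-a)
  have : (s - l) * (s - m) = 0 := by linear_combination hs - s * h1 + h2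
  rcases mul_eq_zero.1 this with h | h
  · exact key l m h1 h2 (sub_eq_zero.1 h)
  · exact key m l (by rw [add_comm, h1]) (by rw [mul_comm, h2]) (sub_eq_zero.1 h)

end NormalForm

/-- `L` is isomorphic to one of the algebras of the table. -/
def Classified (L : Type*) [LieRing L] [LieAlgebra ℂ L] : Prop :=
  Nonempty (L ≃ₗ⁅ℂ⁆ d3.Alg) ∨
  Nonempty (L ≃ₗ⁅ℂ⁆ d2Sharp.Alg) ∨
  (∃ l m : ℂ, (l ≠ 0 ∨ m ≠ 0) ∧ Nonempty (L ≃ₗ⁅ℂ⁆ (d1Fam l m).Alg)) ∨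
  Nonempty (L ≃ₗ⁅ℂ⁆ d1Sharp.Alg) ∨
  (∃ l m n : ℂ, (l ≠ 0 ∨ m ≠ 0 ∨ n ≠ 0) ∧ Nonempty (L ≃ₗ⁅ℂ⁆ (d3Big l m n).Alg)) ∨
  (∃ l m : ℂ, (l ≠ 0 ∨ m ≠ 0) ∧ Nonempty (L ≃ₗ⁅ℂ⁆ (d3Small l m).Alg)) ∨
  Nonempty (L ≃ₗ⁅ℂ⁆ d1.Alg) ∨
  Nonempty (L ≃ₗ⁅ℂ⁆ d2Star.Alg) ∨
  Nonempty (L ≃ₗ⁅ℂ⁆ d3Star.Alg)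

/-! ### Algebras with a nilpotent ideal of codimension one. -/

section Extensions

variable {L : Type*} [LieRing L] [LieAlgebra ℂ L]

theorem Classified.d3 (h : Nonempty (L ≃ₗ⁅ℂ⁆ d3.Alg)) : Classified L := Or.inl h

theorem Classified.d2Sharp (h : Nonempty (L ≃ₗ⁅ℂ⁆ d2Sharp.Alg)) : Classified L :=
  Or.inr (Or.inl h)

theorem Classified.d1Fam {l m : ℂ} (hlm : l ≠ 0 ∨ m ≠ 0)
    (h : Nonempty (L ≃ₗ⁅ℂ⁆ (d1Fam l m).Alg)) : Classified L :=
  Or.inr (Or.inr (Or.inl ⟨l, m, hlm, h⟩))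

theorem Classified.d1Sharp (h : Nonempty (L ≃ₗ⁅ℂ⁆ d1Sharp.Alg)) : Classified L :=
  Or.inr (Or.inr (Or.inr (Or.inl h)))

theorem Classified.d3Big {l m n : ℂ} (hlmn : l ≠ 0 ∨ m ≠ 0 ∨ n ≠ 0)
    (h : Nonempty (L ≃ₗ⁅ℂ⁆ (d3Big l m n).Alg)) : Classified L :=
  Or.inr (Or.inr (Or.inr (Or.inr (Or.inl ⟨l, m, n, hlmn, h⟩))))

theorem Classified.d3Small {l m : ℂ} (hlm : l ≠ 0 ∨ m ≠ 0)
    (h : Nonempty (L ≃ₗ⁅ℂ⁆ (d3Small l m).Alg)) : Classified L :=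
  Or.inr (Or.inr (Or.inr (Or.inr (Or.inr (Or.inl ⟨l, m, hlm, h⟩)))))

theorem Classified.d1 (h : Nonempty (L ≃ₗ⁅ℂ⁆ d1.Alg)) : Classified L :=
  Or.inr (Or.inr (Or.inr (Or.inr (Or.inr (Or.inr (Or.inl h))))))

theorem Classified.d2Star (h : Nonempty (L ≃ₗ⁅ℂ⁆ d2Star.Alg)) : Classified L :=
  Or.inr (Or.inr (Or.inr (Or.inr (Or.inr (Or.inr (Or.inr (Or.inl h)))))))

theorem Classified.d3Star (h : Nonempty (L ≃ₗ⁅ℂ⁆ d3Star.Alg)) : Classified L :=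
  Or.inr (Or.inr (Or.inr (Or.inr (Or.inr (Or.inr (Or.inr (Or.inr h)))))))

theorem linearIndependent_four_of_notMem {V : Submodule ℂ L} {w : L} (hw : w ∉ V) {x y z : V}
    (h : LinearIndependent ℂ ![x, y, z]) : LinearIndependent ℂ ![(x : L), y, z, w] := by
  refine linearIndependent_four_iff.2 fun a b c d e => ?_
  have hd : d = 0 := by
    by_contra hd
    refine hw ((V.smul_mem_iff hd).1 ?_)
    have : d • w = -((a • x + b • y + c • z : V) : L) := by
      push_cast
      rw [← sub_eq_zero, ← e]
      module
    rw [this]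
    exact neg_mem (Submodule.coe_mem _)
  subst hd
  obtain ⟨h1, h2, h3⟩ := linearIndependent_three.1 h a b c (Subtype.ext (by simpa using e))
  exact ⟨h1, h2, h3, rfl⟩

theorem exists_add_smul_eq (hL : finrank ℂ L = 4) {V : Submodule ℂ L} (hV : finrank ℂ V = 3)
    {w : L} (hw : w ∉ V) (u : L) : ∃ v ∈ V, ∃ t : ℂ, u = v + t • w := by
  have : Module.Finite ℂ L := Module.finite_of_finrank_pos (by omega)
  have h1 : finrank ℂ (L ⧸ V) = 1 := by
    have := V.finrank_quotient_add_finrank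
    omega
  have hw' : V.mkQ w ≠ 0 := fun e => hw ((Submodule.Quotient.mk_eq_zero V).1 e)
  obtain ⟨t, ht⟩ := (finrank_eq_one_iff_of_nonzero' _ hw').1 h1 (V.mkQ u)
  refine ⟨u - t • w, ?_, t, by abel⟩
  rw [← Submodule.Quotient.mk_eq_zero, ← V.mkQ_apply, map_sub, map_smul, ht, sub_self]

theorem exists_triple {V : Type*} [AddCommGroup V] [Module ℂ V] (hV : finrank ℂ V = 3) :
    ∃ x y z : V, LinearIndependent ℂ ![x, y, z] := by
  have : Module.Finite ℂ V := Module.finite_of_finrank_pos (by omega)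
  let v := finBasisOfFinrankEq ℂ V hV
  refine ⟨v 0, v 1, v 2, ?_⟩
  convert v.linearIndependent
  ext i
  fin_cases i <;> rfl

/-- Algebras with an abelian ideal of codimension one. -/
theorem classified_of_abelian (hL : finrank ℂ L = 4) (hna : ¬IsLieAbelian L)
    {V : Submodule ℂ L} (hV : finrank ℂ V = 3) {w : L} (hw : w ∉ V)
    (hVw : ∀ u ∈ V, ⁅u, w⁆ ∈ V) (hVV : ∀ u ∈ V, ∀ v ∈ V, ⁅u, v⁆ = 0) : Classified L := by
  let M : V →ₗ[ℂ] V := ((-LieAlgebra.ad ℂ L w : Module.End ℂ L)).restrict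
    (p := V) (q := V) fun u hu => by
      rw [LinearMap.neg_apply, LieAlgebra.ad_apply, lie_skew]
      exact hVw u hu
  have hM : ∀ u : V, ⁅(u : L), w⁆ = (M u : L) := fun u => by
    simp [M]
  have h0 : ∀ u v : V, ⁅(u : L), (v : L)⁆ = 0 := fun u v => hVV u u.2 v v.2
  rcases exists_normal_form hV M with ⟨l, h⟩ | ⟨l, m, x, y, z, hi, hx, hy, hz⟩ |
    ⟨l, m, n, x, y, z, hi, hx, hy, hz⟩
  -- A scalar action: zero would make L abelian, and otherwise rescaling w gives scalar 1.
  · have hl : l ≠ 0 := by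
      rintro rfl
      refine hna ⟨fun a b => ?_⟩
      obtain ⟨v, hv, t, rfl⟩ := exists_add_smul_eq hL hV hw a
      obtain ⟨v', hv', t', rfl⟩ := exists_add_smul_eq hL hV hw b
      have h1 : ∀ v ∈ V, ⁅v, w⁆ = 0 := fun v hv => by rw [hM ⟨v, hv⟩, h, zero_smul]; rfl
      have h2 : ⁅w, v'⁆ = 0 := by rw [← lie_skew, h1 v' hv', neg_zero]
      simp [hVV v hv v' hv', h1 v hv, h2]
    obtain ⟨x, y, z, hi⟩ := exists_triple hV
    refine Classified.d3Star (nonempty_equiv_of_linearIndependent hasBracket_d3Star hL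
      (x := x) (y := y) (z := z) (w := l⁻¹ • w) (linearIndependent_four_iff.2 fun a b c d e => ?_)
      (by simp [h0]) (by simp [h0]) (by simp [h0]) (by simp [hM, h, hl]) (by simp [hM, h, hl])
      (by simp [hM, h, hl]))
    obtain ⟨e1, e2, e3, e4⟩ := linearIndependent_four_iff.1
      (linearIndependent_four_of_notMem hw hi) a b c (d * l⁻¹) (by rw [← e]; module)
    exact ⟨e1, e2, e3, (mul_eq_zero.1 e4).resolve_right (inv_ne_zero hl)⟩
  · have hi4 := linearIndependent_four_of_notMem hw hi
    by_cases hlm : l ≠ 0 ∨ m ≠ 0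
    · exact Classified.d3Small hlm (nonempty_equiv_of_linearIndependent (hasBracket_d3Small l m) hL
        hi4 (by simp [h0]) (by simp [h0]) (by simp [h0]) (by simp [hM, hx]) (by simp [hM, hy])
        (by simp [hM, hz]))
    · push Not at hlm
      obtain ⟨rfl, rfl⟩ := hlm
      refine Classified.d1 (nonempty_equiv_of_linearIndependent hasBracket_d1 hL
        (x := y) (y := z) (z := x) (w := w) (linearIndependent_four_iff.2 fun a b c d e => ?_)
        (by simp [h0]) (by simp [h0]) (by simp [h0]) (by simp [hM, hy]) (by simp [hM, hz])
        (by simp [hM, hx]))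
      obtain ⟨e1, e2, e3, e4⟩ := linearIndependent_four_iff.1 hi4 c a b d (by rw [← e]; module)
      exact ⟨e2, e3, e1, e4⟩
  · have hi4 := linearIndependent_four_of_notMem hw hi
    by_cases hlmn : l ≠ 0 ∨ m ≠ 0 ∨ n ≠ 0
    · exact Classified.d3Big hlmn (nonempty_equiv_of_linearIndependent (hasBracket_d3Big l m n) hL
        hi4 (by simp [h0]) (by simp [h0]) (by simp [h0]) (by simp [hM, hx]) (by simp [hM, hy])
        (by simp [hM, hz]))
    · push Not at hlmn
      obtain ⟨rfl, rfl, rfl⟩ := hlmn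
      exact Classified.d2Star (nonempty_equiv_of_linearIndependent hasBracket_d2Star hL
        hi4 (by simp [h0]) (by simp [h0]) (by simp [h0]) (by simp [hM, hx]) (by simp [hM, hy])
        (by simp [hM, hz]))

/-- The condition b ≠ 0 says that y is cyclic for the action of w on ⟨y,z⟩. If l, m are the
eigenvalues, then (a - m)y + bz = [y,w] - my is an eigenvector for l, and with y it gives the basis
of d₁(l:m); the factor -b on x normalises their bracket. -/
theorem classified_of_heisenberg_of_ne (hL : finrank ℂ L = 4) {x y z w : L}
    (hi : LinearIndependent ℂ ![x, y, z, w]) (hxy : ⁅x, y⁆ = 0) (hxz : ⁅x, z⁆ = 0)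
    (hyz : ⁅y, z⁆ = x) {a b c d : ℂ} (hxw : ⁅x, w⁆ = (a + d) • x) (hyw : ⁅y, w⁆ = a • y + b • z)
    (hzw : ⁅z, w⁆ = c • y + d • z) (hb : b ≠ 0) : Classified L := by
  have hi' := linearIndependent_four_iff.1 hi
  obtain ⟨l, m, hs, hp⟩ := exists_add_eq_mul_eq (a + d) (a * d - b * c)
  obtain rfl : d = l + m - a := by linear_combination -hs
  have hbc : b * c = -(a - l) * (a - m) := by linear_combination hp
  have hzy := lie_eq_neg_of_lie hyz
  have h12 : ⁅(a - m) • y + b • z, y⁆ = -b • x := by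
    simp only [add_lie, smul_lie, lie_self, hzy]; module
  have h13 : ⁅(a - m) • y + b • z, w⁆ = l • ((a - m) • y + b • z) := by
    simp only [add_lie, smul_lie, hyw, hzw, smul_add, smul_smul, hbc]; module
  have h23 : ⁅y, w⁆ = ((a - m) • y + b • z) + m • y := by rw [hyw]; module
  have h01 : ⁅-b • x, (a - m) • y + b • z⁆ = 0 := by
    simp only [lie_add, lie_smul, smul_lie, hxy, hxz, smul_zero, add_zero]
  have h02 : ⁅-b • x, y⁆ = 0 := by simp only [smul_lie, hxy, smul_zero]
  have h03 : ⁅-b • x, w⁆ = (l + m) • (-b • x) := by rw [smul_lie, hxw]; module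
  have hj : LinearIndependent ℂ ![-b • x, (a - m) • y + b • z, y, w] := by
    refine linearIndependent_four_iff.2 fun p q r s e => ?_
    obtain ⟨e1, e2, e3, e4⟩ := hi' (p * -b) (q * (a - m) + r) (q * b) s (by rw [← e]; module)
    have hq := (mul_eq_zero.1 e3).resolve_right hb
    exact ⟨(mul_eq_zero.1 e1).resolve_right (neg_ne_zero.2 hb), hq,
      by linear_combination e2 - (a - m) * hq, e4⟩
  by_cases hlm : l ≠ 0 ∨ m ≠ 0
  · exact Classified.d1Fam hlm (nonempty_equiv_of_linearIndependent (hasBracket_d1Fam l m) hL hj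
      (by rw [h01]; module) (by rw [h02]; module) (by rw [h12]; module) h03
      (by rw [h13]; module) (by rw [h23]; module))
  -- For l = m = 0 the roles of y and w are exchanged: y acts on the abelian ideal spanned by x, the
  -- eigenvector and w as one nilpotent Jordan block.
  · push Not at hlm
    obtain ⟨rfl, rfl⟩ := hlm
    refine Classified.d2Star (nonempty_equiv_of_linearIndependent hasBracket_d2Star hL
      (x := -b • x) (y := (a - 0) • y + b • z) (z := -w) (w := y)
      (linearIndependent_four_iff.2 fun p q r s e => ?_) (by rw [h01]; module)
      (by rw [lie_neg, h03]; module) (by rw [lie_neg, h13]; module) (by rw [h02]; module)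
      (by rw [h12]; module) (by rw [neg_lie, lie_eq_neg_of_lie h23]; module))
    obtain ⟨e1, e2, e3, e4⟩ := linearIndependent_four_iff.1 hj p q s (-r) (by rw [← e]; module)
    exact ⟨e1, e2, neg_eq_zero.1 e4, e3⟩

/-- The Jacobi identity makes w act on x = [y,z] by the trace of its 2 × 2 block. Unless the block
is scalar, one of y, z, y + z is cyclic; a scalar block gives d₁♯, or d₁ if it is zero. -/
theorem classified_of_heisenberg (hL : finrank ℂ L = 4) {x y z w : L}
    (hi : LinearIndependent ℂ ![x, y, z, w]) (hxy : ⁅x, y⁆ = 0) (hxz : ⁅x, z⁆ = 0)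
    (hyz : ⁅y, z⁆ = x) {a b c d : ℂ} (hyw : ⁅y, w⁆ = a • y + b • z)
    (hzw : ⁅z, w⁆ = c • y + d • z) : Classified L := by
  have hi' := linearIndependent_four_iff.1 hi
  have hzy := lie_eq_neg_of_lie hyz
  have hxw : ⁅x, w⁆ = (a + d) • x := by
    rw [← hyz, lie_lie, hzw, hyw]
    simp only [lie_add, lie_smul, lie_self, hyz, hzy]
    module
  by_cases hb : b = 0
  swap
  · exact classified_of_heisenberg_of_ne hL hi hxy hxz hyz hxw hyw hzw hb
  subst hb
  by_cases hc : c = 0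
  swap
  · refine classified_of_heisenberg_of_ne hL (x := -x) (y := z) (z := y) (w := w) (a := d)
      (b := c) (c := 0) (d := a) (linearIndependent_four_iff.2 fun p q r s e => ?_) (by simp [hxz])
      (by simp [hxy]) hzy (by rw [neg_lie, hxw]; module) (by rw [hzw]; module)
      (by rw [hyw]; module) hc
    obtain ⟨e1, e2, e3, e4⟩ := hi' (-p) r q s (by rw [← e]; module)
    exact ⟨neg_eq_zero.1 e1, e3, e2, e4⟩
  subst hc
  by_cases had : a = d
  swap
  · refine classified_of_heisenberg_of_ne hL (x := x) (y := y + z) (z := z) (w := w) (a := a)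
      (b := d - a) (c := 0) (d := d) (linearIndependent_four_iff.2 fun p q r s e => ?_)
      (by simp [hxz, hxy]) hxz (by simp [hyz]) hxw (by rw [add_lie, hyw, hzw]; module)
      (by rw [hzw]; module) (sub_ne_zero.2 (Ne.symm had))
    obtain ⟨e1, e2, e3, e4⟩ := hi' p q (q + r) s (by rw [← e]; module)
    exact ⟨e1, e2, by linear_combination e3 - e2, e4⟩
  subst had
  by_cases ha : a = 0
  · subst ha
    refine Classified.d1 (nonempty_equiv_of_linearIndependent hasBracket_d1 hL
      (x := x) (y := y) (z := w) (w := z) (linearIndependent_four_iff.2 fun p q r s e => ?_)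
      (by simp [hxy]) (by simp [hxw]) (by simp [hyw]) (by simp [hxz]) (by simp [hyz])
      (by rw [lie_eq_neg_of_lie hzw]; module))
    obtain ⟨e1, e2, e3, e4⟩ := hi' p q s r (by rw [← e]; module)
    exact ⟨e1, e2, e4, e3⟩
  · refine Classified.d1Sharp (nonempty_equiv_of_linearIndependent hasBracket_d1Sharp hL
      (x := x) (y := y) (z := z) (w := a⁻¹ • w)
      (linearIndependent_four_iff.2 fun p q r s e => ?_)
      (by simp [hxy]) (by simp [hxz]) (by simp [hyz])
      (by rw [lie_smul, hxw, smul_smul]; congr 1; field_simp; ring)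
      (by simp [hyw, ha]) (by simp [hzw, ha]))
    obtain ⟨e1, e2, e3, e4⟩ := hi' p q r (s * a⁻¹) (by rw [← e]; module)
    exact ⟨e1, e2, e3, (mul_eq_zero.1 e4).resolve_right (inv_ne_zero ha)⟩

/-- Algebras with a nilpotent ideal of codimension one. -/
theorem classified_of_nilpotent (hL : finrank ℂ L = 4) (hna : ¬IsLieAbelian L)
    {V : Submodule ℂ L} (hV : finrank ℂ V = 3) {w : L} (hw : w ∉ V)
    (hVw : ∀ u ∈ V, ⁅u, w⁆ ∈ V) {x y z : V} (hi : LinearIndependent ℂ ![x, y, z])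
    (hxy : ⁅(x : L), (y : L)⁆ = 0) (hxz : ⁅(x : L), (z : L)⁆ = 0) {r : ℂ}
    (hyz : ⁅(y : L), (z : L)⁆ = r • (x : L)) : Classified L := by
  have hcomb : ∀ u ∈ V, ∃ a b c : ℂ, u = a • (x : L) + b • (y : L) + c • (z : L) := by
    intro u hu
    obtain ⟨a, b, c, e⟩ := exists_combination_three hV hi ⟨u, hu⟩
    exact ⟨a, b, c, congrArg Subtype.val e⟩
  have hyx := lie_eq_neg_of_lie hxy
  have hzx := lie_eq_neg_of_lie hxz
  have hzy := lie_eq_neg_of_lie hyz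
  by_cases hr : r = 0
  · subst hr
    refine classified_of_abelian hL hna hV hw hVw fun u hu v hv => ?_
    obtain ⟨a, b, c, rfl⟩ := hcomb u hu
    obtain ⟨a', b', c', rfl⟩ := hcomb v hv
    simp [hxy, hxz, hyz, hyx, hzx, hzy]
  · obtain ⟨s, a, b, hyw⟩ := hcomb _ (hVw y y.2)
    obtain ⟨t, c, d, hzw⟩ := hcomb _ (hVw z z.2)
    -- The multiples of y and z added to w cancel the x-components of [y,w] and [z,w].
    refine classified_of_heisenberg hL (x := r • x) (y := y) (z := z)
      (w := w + (r⁻¹ * t) • (y : L) - (r⁻¹ * s) • (z : L)) (a := a) (b := b) (c := c) (d := d)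
      (linearIndependent_four_iff.2 fun p q u v e => ?_) (by simp [hxy]) (by simp [hxz]) hyz ?_ ?_
    · obtain ⟨e1, e2, e3, e4⟩ := linearIndependent_four_iff.1
        (linearIndependent_four_of_notMem hw hi) (p * r) (q + v * (r⁻¹ * t)) (u - v * (r⁻¹ * s)) v
        (by rw [← e]; module)
      exact ⟨(mul_eq_zero.1 e1).resolve_right hr, by linear_combination e2 - (r⁻¹ * t) * e4,
        by linear_combination e3 + (r⁻¹ * s) * e4, e4⟩
    · simp only [lie_add, lie_sub, lie_smul, lie_self, hyw, hyz, smul_smul]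
      rw [mul_right_comm, inv_mul_cancel₀ hr]
      module
    · simp only [lie_add, lie_sub, lie_smul, lie_self, hzw, hzy, smul_neg, smul_smul]
      rw [mul_right_comm, inv_mul_cancel₀ hr]
      module

end Extensions

/-! ### Linear independence and nilpotent endomorphisms. -/

section Independence

variable {V : Type*} [AddCommGroup V] [Module ℂ V]

theorem exists_linearIndependent_two (hV : 1 < finrank ℂ V) {x : V} (hx : x ≠ 0) :
    ∃ y, LinearIndependent ℂ ![x, y] := by
  by_contra hc
  push Not at hc
  have : finrank ℂ V ≤ 1 := by
    refine finrank_le_one x fun y => ?_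
    have := hc y
    rw [LinearIndependent.pair_iff' hx] at this
    push Not at this
    exact this
  omega

theorem exists_combination_two (hV : finrank ℂ V = 2) {x y : V}
    (h : LinearIndependent ℂ ![x, y]) (u : V) : ∃ a b : ℂ, u = a • x + b • y := by
  let v := basisOfLinearIndependentOfCardEqFinrank h (by simp [hV])
  refine ⟨v.repr u 0, v.repr u 1, ?_⟩
  conv_lhs => rw [← v.sum_repr u]
  simp [Fin.sum_univ_two, v]

theorem exists_linearIndependent_four (hV : 3 < finrank ℂ V) {x y z : V}
    (h : LinearIndependent ℂ ![x, y, z]) : ∃ w, LinearIndependent ℂ ![x, y, z, w] := by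
  by_contra hc
  push Not at hc
  have : Module.Finite ℂ V := Module.finite_of_finrank_pos (by omega)
  have hle : (⊤ : Submodule ℂ V) ≤ Submodule.span ℂ (Set.range ![x, y, z]) := fun w _ => by
    have h' := hc w
    rw [linearIndependent_four_iff] at h'
    push Not at h'
    obtain ⟨a, b, c, d, e, h0⟩ := h'
    by_cases hd : d = 0
    · subst hd
      obtain ⟨rfl, rfl, rfl⟩ := linearIndependent_three.1 h a b c (by simpa using e)
      exact absurd rfl (h0 rfl rfl rfl)
    · have e' : d • w = -(a • x + b • y + c • z) := by
        rw [← sub_eq_zero, ← e]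
        module
      rw [← inv_smul_smul₀ hd w, e']
      exact Submodule.smul_mem _ _ (neg_mem (add_mem (add_mem
        (Submodule.smul_mem _ _ (Submodule.subset_span ⟨0, rfl⟩))
        (Submodule.smul_mem _ _ (Submodule.subset_span ⟨1, rfl⟩)))
        (Submodule.smul_mem _ _ (Submodule.subset_span ⟨2, rfl⟩))))
  have h1 := Submodule.finrank_mono hle
  have h2 := finrank_range_le_card (R := ℂ) ![x, y, z]
  rw [finrank_top] at h1
  simp [Set.finrank] at h2
  omega

theorem linearIndependent_coe_three {K : Submodule ℂ V} {x y z : K}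
    (h : LinearIndependent ℂ ![x, y, z]) : LinearIndependent ℂ ![(x : V), y, z] := by
  refine linearIndependent_three.2 fun a b c e => ?_
  exact linearIndependent_three.1 h a b c (Subtype.ext (by simpa using e))

theorem isNilpotent_of_forall_eigenvalue [Module.Finite ℂ V] (f : End ℂ V)
    (h : ∀ μ, f.HasEigenvalue μ → μ = 0) : IsNilpotent f := by
  rw [LinearMap.isNilpotent_iff_charpoly]
  have hs := IsAlgClosed.splits f.charpoly
  have hr : f.charpoly.roots = Multiset.replicate (finrank ℂ V) 0 := by
    refine Multiset.eq_replicate.2 ⟨?_, fun μ hμ => h μ ?_⟩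
    · rw [← hs.natDegree_eq_card_roots, LinearMap.charpoly_natDegree]
    · exact (Module.End.hasEigenvalue_iff_isRoot_charpoly f μ).2
        (Polynomial.isRoot_of_mem_roots hμ)
  rw [hs.eq_prod_roots_of_monic f.charpoly_monic, hr]
  simp

end Independence

/-! ### The derived algebra; derived algebra of dimension one. -/

section Derived

variable {L : Type*} [LieRing L] [LieAlgebra ℂ L]

/-- Algebras whose derived algebra is contained in a nilpotent three-dimensional subspace. -/
theorem classified_of_nilpotent_span (hL : finrank ℂ L = 4) (hna : ¬IsLieAbelian L) {x y z : L}
    (hi : LinearIndependent ℂ ![x, y, z]) (hxy : ⁅x, y⁆ = 0) (hxz : ⁅x, z⁆ = 0) {r : ℂ}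
    (hyz : ⁅y, z⁆ = r • x) (hs : ∀ u v : L, ∃ a b c : ℂ, ⁅u, v⁆ = a • x + b • y + c • z) :
    Classified L := by
  obtain ⟨w, hw⟩ := exists_linearIndependent_four (by omega) hi
  let V := Submodule.span ℂ (Set.range ![x, y, z])
  have hx : x ∈ V := Submodule.subset_span ⟨0, rfl⟩
  have hy : y ∈ V := Submodule.subset_span ⟨1, rfl⟩
  have hz : z ∈ V := Submodule.subset_span ⟨2, rfl⟩
  -- A subspace containing all brackets is an ideal, so V qualifies for every w outside it.
  refine classified_of_nilpotent hL hna (V := V) (finrank_span_eq_card hi) (w := w)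
    (fun hwV => ?_) (fun u _ => ?_) (x := ⟨x, hx⟩) (y := ⟨y, hy⟩) (z := ⟨z, hz⟩)
    (linearIndependent_three.2 fun a b c e => linearIndependent_three.1 hi a b c
      (by simpa using congrArg Subtype.val e)) hxy hxz hyz
  · obtain ⟨g, hg⟩ := (Submodule.mem_span_range_iff_exists_fun ℂ).1 hwV
    have hg' : g 0 • x + g 1 • y + g 2 • z = w := by simpa [Fin.sum_univ_three] using hg
    have := linearIndependent_four_iff.1 hw (g 0) (g 1) (g 2) (-1) (by rw [hg']; module)
    exact neg_ne_zero.2 one_ne_zero this.2.2.2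
  · obtain ⟨a, b, c, e⟩ := hs u w
    rw [e]
    exact add_mem (add_mem (V.smul_mem _ hx) (V.smul_mem _ hy)) (V.smul_mem _ hz)

variable (L) in
/-- The derived algebra. -/
abbrev derived : LieIdeal ℂ L := ⁅(⊤ : LieIdeal ℂ L), (⊤ : LieIdeal ℂ L)⁆

theorem lie_mem_derived (u v : L) : ⁅u, v⁆ ∈ derived L :=
  LieSubmodule.lie_mem_lie (LieSubmodule.mem_top u) (LieSubmodule.mem_top v)

theorem derived_le {W : Submodule ℂ L} (h : ∀ u v : L, ⁅u, v⁆ ∈ W) :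
    (derived L).toSubmodule ≤ W := by
  rw [LieSubmodule.lieIdeal_oper_eq_linear_span', Submodule.span_le]
  rintro _ ⟨u, -, v, -, rfl⟩
  exact h u v

/-- Commutators have trace zero. Applied to L and to its derived algebra, this drives the cases
below. -/
theorem trace_toEnd_eq_zero (M : Type*) [AddCommGroup M] [Module ℂ M] [LieRingModule L M]
    [LieModule ℂ L M] {u : L} (hu : u ∈ derived L) :
    LinearMap.trace ℂ M (LieModule.toEnd ℂ L M u) = 0 := by
  refine derived_le (W := LinearMap.ker (LinearMap.trace ℂ M ∘ₗ
    (LieModule.toEnd ℂ L M : L →ₗ[ℂ] Module.End ℂ M))) (fun u v => ?_) hu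
  simp [LieRing.of_associative_ring_bracket, LinearMap.trace_mul_comm]

/-- If x spans L', then ad x has rank at most 1. Its kernel contains x and two further independent
vectors y, z commuting with x, and [y,z] is a multiple of x. -/
theorem classified_of_finrank_derived_eq_one (hL : finrank ℂ L = 4) (hna : ¬IsLieAbelian L)
    (h : finrank ℂ (derived L) = 1) : Classified L := by
  have : Module.Finite ℂ L := Module.finite_of_finrank_pos (by omega)
  obtain ⟨⟨x, hxJ⟩, hx0, hx⟩ := finrank_eq_one_iff'.1 h
  have hx' : ∀ u v : L, ∃ c : ℂ, ⁅u, v⁆ = c • x := fun u v => by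
    obtain ⟨c, hc⟩ := hx ⟨_, lie_mem_derived u v⟩
    exact ⟨c, (congrArg Subtype.val hc).symm⟩
  let f : L →ₗ[ℂ] L := LieAlgebra.ad ℂ L x
  have hK : 2 < finrank ℂ (LinearMap.ker f) := by
    have h1 := f.finrank_range_add_finrank_ker
    have h2 : finrank ℂ (LinearMap.range f) ≤ 1 := by
      rw [← h]
      refine Submodule.finrank_mono (t := (derived L).toSubmodule) ?_
      rintro _ ⟨u, rfl⟩
      exact lie_mem_derived x u
    omega
  have hne : (⟨x, by simp [f]⟩ : LinearMap.ker f) ≠ 0 := fun e => by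
    have e' : x = 0 := congrArg Subtype.val e
    exact hx0 (Subtype.ext e')
  obtain ⟨y, hy⟩ := exists_linearIndependent_two (by omega) hne
  obtain ⟨z, hz⟩ := exists_linearIndependent_three hK hy
  obtain ⟨r, hr⟩ := hx' y z
  refine classified_of_nilpotent_span hL hna (linearIndependent_coe_three hz) y.2 z.2 hr
    fun u v => ?_
  obtain ⟨c, hc⟩ := hx' u v
  exact ⟨c, 0, 0, by simp [hc]⟩

end Derived

/-! ### There is no perfect algebra of dimension four. -/

section Perfect

variable {L : Type*} [LieRing L] [LieAlgebra ℂ L]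

/-- The coefficients of the structure forms of a four-dimensional algebra. -/
noncomputable def formMatrix (b : Basis (Fin 4) ℂ L) : Matrix (Fin 6) (Fin 4) ℂ :=
  Matrix.of fun p k => b.repr (![⁅b 0, b 1⁆, ⁅b 0, b 2⁆, ⁅b 0, b 3⁆, ⁅b 1, b 2⁆, ⁅b 1, b 3⁆,
    ⁅b 2, b 3⁆] p) k

/-- The Hodge dual coefficients. -/
noncomputable def dualFormMatrix (b : Basis (Fin 4) ℂ L) : Matrix (Fin 6) (Fin 4) ℂ :=
  Matrix.of fun p k => b.repr (![⁅b 2, b 3⁆, -⁅b 1, b 3⁆, ⁅b 1, b 2⁆, ⁅b 0, b 3⁆, -⁅b 0, b 2⁆,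
    ⁅b 0, b 1⁆] p) k

theorem lie_mem_span_of_basis {b : Basis (Fin 4) ℂ L} {W : Submodule ℂ L}
    (h01 : ⁅b 0, b 1⁆ ∈ W) (h02 : ⁅b 0, b 2⁆ ∈ W) (h03 : ⁅b 0, b 3⁆ ∈ W) (h12 : ⁅b 1, b 2⁆ ∈ W)
    (h13 : ⁅b 1, b 3⁆ ∈ W) (h23 : ⁅b 2, b 3⁆ ∈ W) (u v : L) : ⁅u, v⁆ ∈ W := by
  have hs : ∀ i j, ⁅b i, b j⁆ ∈ W → ⁅b j, b i⁆ ∈ W := fun i j h => by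
    rw [← lie_skew]
    exact neg_mem h
  have hb : ∀ i j, ⁅b i, b j⁆ ∈ W := by
    intro i j
    fin_cases i <;> fin_cases j <;>
      first | exact (lie_self (b _)).symm ▸ W.zero_mem | assumption | exact hs _ _ (by assumption)
  rw [← b.sum_repr u, ← b.sum_repr v]
  simp only [sum_lie, lie_sum, smul_lie, lie_smul]
  exact sum_mem fun i _ => W.smul_mem _ (sum_mem fun j _ => W.smul_mem _ (hb _ _))

/-- A functional that vanishes on all brackets vanishes on L' = L. Hence the structure forms of a
perfect algebra are linearly independent. -/
theorem eq_zero_of_forall_lie {b : Basis (Fin 4) ℂ L} (h : derived L = ⊤) {a : Fin 4 → ℂ}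
    (h01 : ∑ k, b.repr ⁅b 0, b 1⁆ k * a k = 0) (h02 : ∑ k, b.repr ⁅b 0, b 2⁆ k * a k = 0)
    (h03 : ∑ k, b.repr ⁅b 0, b 3⁆ k * a k = 0) (h12 : ∑ k, b.repr ⁅b 1, b 2⁆ k * a k = 0)
    (h13 : ∑ k, b.repr ⁅b 1, b 3⁆ k * a k = 0) (h23 : ∑ k, b.repr ⁅b 2, b 3⁆ k * a k = 0) :
    a = 0 := by
  let f : L →ₗ[ℂ] ℂ := b.constr ℂ a
  have hf : ∀ x, f x = ∑ k, b.repr x k * a k := fun x => by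
    simp [f, Basis.constr_apply_fintype]
  have hle : (derived L).toSubmodule ≤ LinearMap.ker f :=
    derived_le fun u v => lie_mem_span_of_basis (b := b) (by simpa [hf] using h01)
      (by simpa [hf] using h02) (by simpa [hf] using h03) (by simpa [hf] using h12)
      (by simpa [hf] using h13) (by simpa [hf] using h23) u v
  funext i
  have : f (b i) = 0 := hle (by rw [h]; trivial)
  simpa [f] using this

theorem rank_eq_four_of_injective {M : Matrix (Fin 6) (Fin 4) ℂ}
    (h : ∀ a : Fin 4 → ℂ, M.mulVec a = 0 → a = 0) : M.rank = 4 := by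
  have hi : Function.Injective M.mulVecLin :=
    (injective_iff_map_eq_zero M.mulVecLin).2 fun a ha => h a ha
  rw [Matrix.rank, LinearMap.finrank_range_of_inj hi, finrank_fin_fun]

theorem rank_formMatrix (b : Basis (Fin 4) ℂ L) (h : derived L = ⊤) : (formMatrix b).rank = 4 := by
  refine rank_eq_four_of_injective fun a ha => ?_
  have h' : ∀ p, ∑ k, formMatrix b p k * a k = 0 := fun p => congrFun ha p
  exact eq_zero_of_forall_lie h (h' 0) (h' 1) (h' 2) (h' 3) (h' 4) (h' 5)

theorem rank_dualFormMatrix (b : Basis (Fin 4) ℂ L) (h : derived L = ⊤) :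
    (dualFormMatrix b).rank = 4 := by
  refine rank_eq_four_of_injective fun a ha => ?_
  have h' : ∀ p, ∑ k, dualFormMatrix b p k * a k = 0 := fun p => congrFun ha p
  have h1 := h' 1
  have h4 := h' 4
  refine eq_zero_of_forall_lie h (h' 5) ?_ (h' 3) (h' 2) ?_ (h' 0)
  · simpa [dualFormMatrix, -lie_skew] using h4
  · simpa [dualFormMatrix, -lie_skew] using h1

theorem trace_ad_eq_sum (b : Basis (Fin 4) ℂ L) (u : L) :
    LinearMap.trace ℂ L (LieModule.toEnd ℂ L L u) = ∑ j, b.repr ⁅u, b j⁆ j := by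
  rw [LinearMap.trace_eq_matrix_trace ℂ b, Matrix.trace]
  simp [LinearMap.toMatrix_apply]

/-- The structure forms of a perfect algebra span an isotropic space. -/
theorem formMatrix_mul_dualFormMatrix (b : Basis (Fin 4) ℂ L) (h : derived L = ⊤) :
    (formMatrix b).transpose * dualFormMatrix b = 0 := by
  obtain ⟨C, hC⟩ : ∃ C : Fin 4 → Fin 4 → Fin 4 → ℂ, ∀ i j k, b.repr ⁅b i, b j⁆ k = C i j k :=
    ⟨_, fun _ _ _ => rfl⟩
  have hs : ∀ i k, C i i k = 0 := fun i k => by simp [← hC]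
  have hn : ∀ i j k, C i j k = -C j i k := fun i j k => by
    rw [← hC, ← lie_skew, map_neg, Finsupp.neg_apply, hC]
  have ht : ∀ i, ∑ j, C i j j = 0 := fun i => by
    simp only [← hC]
    rw [← trace_ad_eq_sum]
    exact trace_toEnd_eq_zero L (by rw [h]; trivial)
  have hexp : ∀ i j, ⁅b i, b j⁆ = ∑ m, C i j m • b m := fun i j => by
    simp_rw [← hC]
    exact (b.sum_repr _).symm
  have hj : ∀ i j k l, ∑ m, C j k m * C i m l =
      ∑ m, C i j m * C m k l + ∑ m, C i k m * C j m l := fun i j k l => by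
    have := congrArg (fun x => b.repr x l) (leibniz_lie (b i) (b j) (b k))
    simpa [hexp, sum_lie, lie_sum, Finsupp.single_apply] using this
  have t0 := ht 0
  have t1 := ht 1
  have t2 := ht 2
  have t3 := ht 3
  ext k l
  -- This is ω^k ∧ ω^l = 0 for the structure forms ω^k, which up to sign are the differentials of
  -- the dual basis. In a unimodular algebra every 3-form is closed, and the differential of e^k ∧
  -- ω^l is ω^k ∧ ω^l up to sign because dω^l = 0. The Jacobi identities express closedness and the
  -- traces unimodularity.
  have key : C 0 1 k * C 2 3 l - C 0 2 k * C 1 3 l + C 0 3 k * C 1 2 l + C 1 2 k * C 0 3 l -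
      C 1 3 k * C 0 2 l + C 2 3 k * C 0 1 l = 0 := by
    have j0 := hj 1 2 3 l
    have j1 := hj 0 2 3 l
    have j2 := hj 0 1 3 l
    have j3 := hj 0 1 2 l
    simp only [Fin.sum_univ_four, hs, hn 1 0, hn 2 0, hn 3 0, hn 2 1, hn 3 1, hn 3 2]
      at t0 t1 t2 t3 j0 j1 j2 j3
    fin_cases k <;> simp only [Fin.zero_eta, Fin.mk_one, Fin.reduceFinMk]
    · linear_combination -j0 - t1 * C 2 3 l + t2 * C 1 3 l - t3 * C 1 2 l
    · linear_combination j1 + t0 * C 2 3 l - t2 * C 0 3 l + t3 * C 0 2 l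
    · linear_combination -j2 - t0 * C 1 3 l + t1 * C 0 3 l - t3 * C 0 1 l
    · linear_combination j3 + t0 * C 1 2 l - t1 * C 0 2 l + t2 * C 0 1 l
  rw [Matrix.mul_apply, Matrix.zero_apply, ← key]
  simp [Fin.sum_univ_succ, formMatrix, dualFormMatrix, hC, -lie_skew]
  ring

/-- Two matrices of rank 4 with six rows cannot satisfy AᵀB = 0: a totally isotropic subspace of Λ²
has dimension at most 3. -/
theorem finrank_derived_ne_four (hL : finrank ℂ L = 4) : finrank ℂ (derived L) ≠ 4 := by
  intro h
  have : Module.Finite ℂ L := Module.finite_of_finrank_pos (by omega)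
  have htop : derived L = ⊤ := by
    rw [← LieSubmodule.toSubmodule_inj]
    exact Submodule.eq_top_of_finrank_eq (h.trans hL.symm)
  let b := finBasisOfFinrankEq ℂ L hL
  have := Matrix.rank_add_rank_le_card_of_mul_eq_zero (formMatrix_mul_dualFormMatrix b htop)
  rw [Matrix.rank_transpose, rank_formMatrix b htop, rank_dualFormMatrix b htop] at this
  simp at this

end Perfect

/-! ### Derived algebra of dimension three. -/

section Derived

variable {L : Type*} [LieRing L] [LieAlgebra ℂ L]

/-- With κ = 1/(2c), ad h exchanges x - κy and x + κy, and their bracket is 2κc h = h; this is the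
basis used for d₃. -/
theorem classified_of_sl2 (hL : finrank ℂ L = 4) {h x y w : L}
    (hi : LinearIndependent ℂ ![h, x, y, w]) (hx : ⁅h, x⁆ = x) (hy : ⁅h, y⁆ = -y) {c : ℂ}
    (hc : c ≠ 0) (hxy : ⁅x, y⁆ = c • h) (hhw : ⁅h, w⁆ = 0) (hxw : ⁅x, w⁆ = 0)
    (hyw : ⁅y, w⁆ = 0) : Classified L := by
  have hyx := lie_eq_neg_of_lie hxy
  refine Classified.d3 (nonempty_equiv_of_linearIndependent hasBracket_d3 hL (x := h)
    (y := x - (2 * c)⁻¹ • y) (z := x + (2 * c)⁻¹ • y) (w := w)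
    (linearIndependent_four_iff.2 fun p q r s e => ?_) ?_ ?_ ?_ (by simp [hhw])
    (by simp [hxw, hyw]) (by simp [hxw, hyw]))
  · obtain ⟨e1, e2, e3, e4⟩ := linearIndependent_four_iff.1 hi p (q + r)
      ((r - q) * (2 * c)⁻¹) s (by rw [← e]; module)
    have h2 := (mul_eq_zero.1 e3).resolve_right (inv_ne_zero (mul_ne_zero two_ne_zero hc))
    exact ⟨e1, by linear_combination (e2 - h2) / 2, by linear_combination (e2 + h2) / 2, e4⟩
  · simp only [lie_sub, lie_smul, hx, hy]
    module
  · simp only [lie_add, lie_smul, hx, hy]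
    module
  · simp only [lie_add, sub_lie, lie_smul, smul_lie, lie_self, hxy, hyx]
    match_scalars
    field_simp
    norm_num

/-- The Jacobi identity makes brackets of ad h-weight vectors homogeneous. After w is adjusted to
weight 0, it acts on x and y by scalars, opposite to each other when [x,y] ≠ 0; a multiple of h then
makes w central, leaving sl₂ ⊕ ℂ. -/
theorem classified_of_weight_vectors (hL : finrank ℂ L = 4) {h x y w : L} (hJ : h ∈ derived L)
    (hi : LinearIndependent ℂ ![h, x, y, w]) (hx : ⁅h, x⁆ = x) (hy : ⁅h, y⁆ = -y)
    (hcomb : ∀ u v : L, ∃ a b c : ℂ, ⁅u, v⁆ = a • h + b • x + c • y) : Classified L := by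
  have hxh := lie_eq_neg_of_lie hx
  have hyh := lie_eq_neg_of_lie hy
  rw [neg_neg] at hyh
  have hi0 := linearIndependent_four_iff.1 hi
  obtain ⟨c, hxy⟩ : ∃ c : ℂ, ⁅x, y⁆ = c • h := by
    obtain ⟨a, b, c, e⟩ := hcomb x y
    have hj := leibniz_lie h x y
    simp only [e, hx, hy, lie_add, lie_smul, lie_self, lie_neg] at hj
    obtain ⟨-, hb, hc, -⟩ := hi0 0 b (-c) 0 (by rw [← sub_eq_zero] at hj; rw [← hj]; module)
    exact ⟨a, by rw [e, hb, neg_eq_zero.1 hc]; module⟩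
  obtain ⟨w, hi, p, hhw⟩ : ∃ w, LinearIndependent ℂ ![h, x, y, w] ∧ ∃ p : ℂ, ⁅h, w⁆ = p • h := by
    obtain ⟨p, q, r, e⟩ := hcomb h w
    refine ⟨w - q • x + r • y, linearIndependent_four_iff.2 fun s t u v e => ?_, p, ?_⟩
    · obtain ⟨e1, e2, e3, e4⟩ := hi0 s (t - v * q) (u + v * r) v (by rw [← e]; module)
      exact ⟨e1, by linear_combination e2 + q * e4, by linear_combination e3 - r * e4, e4⟩
    · simp only [lie_add, lie_sub, lie_smul, e, hx, hy]
      module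
  clear hi0
  have hi0 := linearIndependent_four_iff.1 hi
  obtain ⟨b, hxw⟩ : ∃ b : ℂ, p = 0 ∧ ⁅x, w⁆ = b • x := by
    obtain ⟨a, b, c, e⟩ := hcomb x w
    have hj := leibniz_lie h x w
    simp only [e, hx, hy, hhw, hxh, lie_add, lie_smul, lie_self] at hj
    obtain ⟨h1, h2, h3, -⟩ := hi0 (-a) p (-2 * c) 0
      (by rw [← sub_eq_zero] at hj; rw [← hj]; module)
    refine ⟨b, h2, ?_⟩
    rw [e, neg_eq_zero.1 h1, (mul_eq_zero.1 h3).resolve_left (by norm_num)]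
    module
  obtain ⟨rfl, hxw⟩ := hxw
  rw [zero_smul] at hhw
  obtain ⟨f, hyw⟩ : ∃ f : ℂ, ⁅y, w⁆ = f • y := by
    obtain ⟨a, b, c, e⟩ := hcomb y w
    have hj := leibniz_lie h y w
    simp only [hy, hhw, neg_lie, e, lie_add, lie_smul, lie_self, hx, lie_zero] at hj
    obtain ⟨h1, h2, -, -⟩ := hi0 a (2 * b) 0 0
      (by rw [← sub_eq_zero] at hj; rw [← hj]; module)
    refine ⟨c, ?_⟩
    rw [e, h1, (mul_eq_zero.1 h2).resolve_left (by norm_num)]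
    module
  -- If x and y commuted, all brackets would lie in ⟨x,y⟩, although h belongs to the derived
  -- algebra.
  by_cases hc : c = 0
  · exfalso
    have : Module.Finite ℂ L := Module.finite_of_finrank_pos (by omega)
    let v := basisOfLinearIndependentOfCardEqFinrank hi (by simp [hL])
    have hxS : ∀ a b : ℂ, a • x + b • y ∈ Submodule.span ℂ {x, y} := fun a b =>
      Submodule.mem_span_pair.2 ⟨a, b, rfl⟩
    have hle : (derived L).toSubmodule ≤ Submodule.span ℂ {x, y} := by
      refine derived_le (lie_mem_span_of_basis (b := v) ?_ ?_ ?_ ?_ ?_ ?_)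
      · simpa [v, hx] using hxS 1 0
      · simpa [v, hy] using hxS 0 1
      · simp [v, hhw]
      · simp [v, hxy, hc]
      · simpa [v, hxw] using hxS b 0
      · simpa [v, hyw] using hxS 0 f
    obtain ⟨s, t, e⟩ := Submodule.mem_span_pair.1 (hle hJ)
    have := hi0 (-1) s t 0 (by rw [← e]; module)
    exact neg_ne_zero.2 one_ne_zero this.1
  · have hf : f + b = 0 := by
      have hj := lie_lie x y w
      have hyx := lie_eq_neg_of_lie hxy
      simp only [hxy, smul_lie, hhw, hyw, hxw, lie_smul, hyx] at hj
      have := (hi0 (c * (f + b)) 0 0 0 (by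
        rw [smul_zero] at hj
        rw [hj]
        module)).1
      exact (mul_eq_zero.1 this).resolve_left hc
    refine classified_of_sl2 hL (h := h) (x := x) (y := y) (w := w + b • h)
      (linearIndependent_four_iff.2 fun s t u v e => ?_) hx hy hc hxy ?_ ?_ ?_
    · obtain ⟨e1, e2, e3, e4⟩ := hi0 (s + v * b) t u v (by rw [← e]; module)
      exact ⟨by linear_combination e1 - b * e4, e2, e3, e4⟩
    · simp [hhw]
    · simp only [lie_add, lie_smul, hxw, hxh]
      module
    · simp only [lie_add, lie_smul, hyw, hyh]
      rw [← add_smul, hf, zero_smul]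

/-- The case of a three-dimensional derived algebra containing a non-nilpotent element. -/
theorem classified_of_eigenvector (hL : finrank ℂ L = 4) (h3 : finrank ℂ (derived L) = 3)
    {h x : derived L} (hx0 : x ≠ 0) (hx : ⁅(h : L), (x : L)⁆ = x) : Classified L := by
  have : Module.Finite ℂ L := Module.finite_of_finrank_pos (by omega)
  have hi2 : LinearIndependent ℂ ![h, x] := by
    refine LinearIndependent.pair_iff.2 fun s t e => ?_
    have e' : s • (h : L) + t • (x : L) = 0 := congrArg Subtype.val e
    have e1 := congrArg (fun u => ⁅(h : L), u⁆) e'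
    simp only [lie_add, lie_smul, lie_self, hx, smul_zero, zero_add, lie_zero] at e1
    have hx0' : (x : L) ≠ 0 := fun e => hx0 (Subtype.ext e)
    have ht := (smul_eq_zero.1 e1).resolve_right hx0'
    subst ht
    rw [zero_smul, add_zero] at e'
    refine ⟨(smul_eq_zero.1 e').resolve_right fun h0 => hx0' ?_, rfl⟩
    rw [← hx, h0, zero_lie]
  obtain ⟨y, hi3⟩ := exists_linearIndependent_three (by omega) hi2
  have hcomb : ∀ u v : L, ∃ a b c : ℂ, ⁅u, v⁆ = a • (h : L) + b • (x : L) + c • (y : L) := by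
    intro u v
    obtain ⟨a, b, c, e⟩ := exists_combination_three h3 hi3 ⟨_, lie_mem_derived u v⟩
    exact ⟨a, b, c, congrArg Subtype.val e⟩
  obtain ⟨w, hi⟩ := exists_linearIndependent_four (by omega) (linearIndependent_coe_three hi3)
  obtain ⟨p, q, r, hy⟩ := hcomb h y
  -- The trace of ad h on L' vanishes because h ∈ L', and the eigenvalues so far are 0 and 1.
  have hr : r = -1 := by
    let v := basisOfLinearIndependentOfCardEqFinrank hi3 (by simp [h3])
    have htr := trace_toEnd_eq_zero (derived L) h.2
    rw [LinearMap.trace_eq_matrix_trace ℂ v, Matrix.trace, Fin.sum_univ_three] at htr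
    have v0 : v 0 = h := by simp [v]
    have v1 : v 1 = x := by simp [v]
    have v2 : v 2 = y := by simp [v]
    have e0 : ⁅(h : L), v 0⁆ = 0 := by rw [v0]; exact Subtype.ext (lie_self (h : L))
    have e1 : ⁅(h : L), v 1⁆ = v 1 := by rw [v1]; exact Subtype.ext hx
    have e2 : ⁅(h : L), v 2⁆ = p • v 0 + q • v 1 + r • v 2 := by
      rw [v0, v1, v2]; exact Subtype.ext hy
    simp [LinearMap.toMatrix_apply, e0, e1, e2] at htr
    linear_combination htr
  subst hr
  -- Subtracting p h + (q/2) x from y removes the lower terms of [h,y], leaving an eigenvector for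
  -- -1.
  refine classified_of_weight_vectors hL h.2 (x := x) (y := y - p • (h : L) - (q / 2) • (x : L))
    (w := w) (linearIndependent_four_iff.2 fun a b c d e => ?_) hx ?_ fun u v => ?_
  · obtain ⟨e1, e2, e3, e4⟩ := linearIndependent_four_iff.1 hi (a - c * p) (b - c * (q / 2)) c d
      (by rw [← e]; module)
    exact ⟨by linear_combination e1 + p * e3, by linear_combination e2 + q / 2 * e3, e3, e4⟩
  · simp only [lie_sub, lie_smul, lie_self, hx, hy]
    module
  · obtain ⟨a, b, c, e⟩ := hcomb u v
    exact ⟨a + c * p, b + c * (q / 2), c, by rw [e]; module⟩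

/-- Either some ad h on L' has a nonzero eigenvalue, which leads to sl₂, or all are nilpotent. Then
Engel's theorem provides a central x ≠ 0 in L', and for a complement y, z a component of [y,z]
outside ℂx would make [y,z] an eigenvector of ad y or ad z with nonzero eigenvalue. -/
theorem classified_of_finrank_derived_eq_three (hL : finrank ℂ L = 4) (hna : ¬IsLieAbelian L)
    (h3 : finrank ℂ (derived L) = 3) : Classified L := by
  have : Module.Finite ℂ L := Module.finite_of_finrank_pos (by omega)
  by_cases hA : ∃ (h x : derived L) (α : ℂ), x ≠ 0 ∧ α ≠ 0 ∧ ⁅h, x⁆ = α • x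
  · obtain ⟨h, x, α, hx, hα, e⟩ := hA
    refine classified_of_eigenvector hL h3 (h := α⁻¹ • h) hx ?_
    have e' : ⁅(h : L), (x : L)⁆ = α • (x : L) := congrArg Subtype.val e
    simp [e', hα]
  push Not at hA
  have hnil : LieModule.IsNilpotent (derived L) (derived L) := by
    rw [LieModule.isNilpotent_iff_forall (R := ℂ)]
    refine fun h => isNilpotent_of_forall_eigenvalue _ fun μ hμ => ?_
    obtain ⟨x, hx⟩ := hμ.exists_hasEigenvector
    by_contra h0
    exact hA h x μ hx.2 h0 hx.apply_eq_smul
  have : Nontrivial (derived L) := Module.nontrivial_of_finrank_pos (R := ℂ) (by omega)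
  have := LieModule.nontrivial_max_triv_of_isNilpotent ℂ (derived L) (derived L)
  obtain ⟨⟨x, hx⟩, hx0⟩ := exists_ne (0 : LieModule.maxTrivSubmodule ℂ (derived L) (derived L))
  have hx0' : x ≠ 0 := fun e => hx0 (Subtype.ext e)
  have hc : ∀ u : derived L, ⁅u, x⁆ = 0 := fun u => hx u
  have hc' : ∀ u : derived L, ⁅x, u⁆ = 0 := fun u => by rw [← lie_skew, hc, neg_zero]
  obtain ⟨y, hi2⟩ := exists_linearIndependent_two (by omega) hx0'
  obtain ⟨z, hi3⟩ := exists_linearIndependent_three (by omega) hi2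
  obtain ⟨p, q, r, e⟩ := exists_combination_three h3 hi3 ⁅y, z⁆
  have hne : ∀ a b c : ℂ, b ≠ 0 ∨ c ≠ 0 → a • x + b • y + c • z ≠ 0 := fun a b c h e => by
    obtain ⟨-, h2, h3⟩ := linearIndependent_three.1 hi3 a b c e
    exact h.elim (fun h => h h2) fun h => h h3
  have hr : r = 0 := by
    by_contra hr
    refine hA y ⁅y, z⁆ r (by rw [e]; exact hne _ _ _ (Or.inr hr)) hr ?_
    conv_lhs => rw [e]
    simp only [lie_add, lie_smul, hc, lie_self]
    module
  have hq : q = 0 := by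
    by_contra hq
    refine hA z ⁅y, z⁆ (-q) (by rw [e]; exact hne _ _ _ (Or.inl hq)) (neg_ne_zero.2 hq) ?_
    conv_lhs => rw [e]
    simp only [lie_add, lie_smul, hc, lie_self, ← lie_skew z y]
    module
  have hyz : ⁅(y : L), (z : L)⁆ = p • (x : L) := by
    rw [hq, hr, zero_smul, zero_smul, add_zero, add_zero] at e
    exact congrArg Subtype.val e
  refine classified_of_nilpotent_span hL hna (linearIndependent_coe_three hi3)
    (congrArg Subtype.val (hc' y)) (congrArg Subtype.val (hc' z)) hyz fun u v => ?_
  obtain ⟨a, b, c, e⟩ := exists_combination_three h3 hi3 ⟨_, lie_mem_derived u v⟩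
  exact ⟨a, b, c, congrArg Subtype.val e⟩

end Derived

/-! ### Derived algebra of dimension two, and the classification. -/

section Derived

variable {L : Type*} [LieRing L] [LieAlgebra ℂ L]

/-- Here c and d act on the abelian plane ⟨a,b⟩ with weights (1,0) and (0,1). Commutativity of the
actions gives e = -g, so b - ga is the second common eigenvector. Adding q(b - ga) to c and
subtracting (p + qg)a from d makes them commute. -/
theorem classified_of_diagonal (hL : finrank ℂ L = 4) {a b c d : L}
    (hi : LinearIndependent ℂ ![a, b, c, d]) (hab : ⁅a, b⁆ = 0) (hca : ⁅c, a⁆ = a) {g e : ℂ}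
    (hcb : ⁅c, b⁆ = g • a) (hda : ⁅d, a⁆ = 0) (hdb : ⁅d, b⁆ = b + e • a) {p q : ℂ}
    (hcd : ⁅c, d⁆ = p • a + q • b) : Classified L := by
  have hi' := linearIndependent_four_iff.1 hi
  obtain rfl : e = -g := by
    have hj := leibniz_lie c d b
    simp only [hcd, hcb, hdb, hca, hda, hab, add_lie, smul_lie, lie_add, lie_smul, lie_self] at hj
    have := (hi' (e + g) 0 0 0 (by rw [← sub_eq_zero] at hj; rw [← hj]; module)).1
    linear_combination this
  have hac := lie_eq_neg_of_lie hca
  have had := lie_eq_neg_of_lie hda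
  have hbd := lie_eq_neg_of_lie hdb
  have hba := lie_eq_neg_of_lie hab
  refine Classified.d2Sharp (nonempty_equiv_of_linearIndependent hasBracket_d2Sharp hL
    (x := a) (y := -(c + q • (b - g • a))) (z := b - g • a) (w := -(d - (p + q * g) • a))
    (linearIndependent_four_iff.2 fun s t u v e => ?_) ?_ ?_ ?_ ?_ ?_ ?_)
  · obtain ⟨e1, e2, e3, e4⟩ := hi' (s + t * (q * g) - u * g + v * (p + q * g)) (u - t * q) (-t)
      (-v) (by rw [← e]; module)
    have ht := neg_eq_zero.1 e3
    have hv := neg_eq_zero.1 e4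
    have hu : u = 0 := by linear_combination e2 + q * ht
    exact ⟨by linear_combination e1 - q * g * ht + g * hu - (p + q * g) * hv, ht, hu, hv⟩
  all_goals
    simp only [lie_add, lie_sub, lie_neg, lie_smul, add_lie, sub_lie, neg_lie, smul_lie, lie_self,
      hab, hca, hcb, hcd, hac, had, hbd, hba]
    module

theorem exists_common_eigenvector {V : Type*} [AddCommGroup V] [Module ℂ V] [Module.Finite ℂ V]
    [Nontrivial V] (f g : End ℂ V) (h : ∀ v, f (g v) = g (f v)) :
    ∃ (v : V) (α β : ℂ), v ≠ 0 ∧ f v = α • v ∧ g v = β • v := by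
  obtain ⟨α, hα⟩ := f.exists_eigenvalue
  have hmaps : ∀ v ∈ f.eigenspace α, g v ∈ f.eigenspace α := fun v hv => by
    rw [Module.End.mem_eigenspace_iff] at hv ⊢
    rw [h, hv, map_smul]
  have : Nontrivial (f.eigenspace α) := Submodule.nontrivial_iff_ne_bot.2 hα
  obtain ⟨β, hβ⟩ := Module.End.exists_eigenvalue (LinearMap.restrict g hmaps)
  obtain ⟨v, hv⟩ := hβ.exists_hasEigenvector
  exact ⟨v, α, β, fun e => hv.2 (Subtype.ext e), Module.End.mem_eigenspace_iff.1 v.2,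
    congrArg Subtype.val hv.apply_eq_smul⟩

theorem linearIndependent_coe_two {V : Type*} [AddCommGroup V] [Module ℂ V] {K : Submodule ℂ V}
    {x y : K} (h : LinearIndependent ℂ ![x, y]) : LinearIndependent ℂ ![(x : V), y] := by
  refine LinearIndependent.pair_iff.2 fun a b e => ?_
  exact LinearIndependent.pair_iff.1 h a b (Subtype.ext (by simpa using e))

/-- Vanishing traces force L' to be abelian. Hence [c,d] acts trivially on L', so c and d act by
commuting matrices, simultaneously triangular with weights (α, α') and (β, β'); the determinant αβ'
- α'β separates the two cases. -/
theorem classified_of_finrank_derived_eq_two (hL : finrank ℂ L = 4) (hna : ¬IsLieAbelian L)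
    (h2 : finrank ℂ (derived L) = 2) : Classified L := by
  have : Module.Finite ℂ L := Module.finite_of_finrank_pos (by omega)
  have : Nontrivial (derived L) := Module.nontrivial_of_finrank_pos (R := ℂ) (by omega)
  have hab : ∀ u v : derived L, ⁅(u : L), (v : L)⁆ = 0 := by
    obtain ⟨x, hx⟩ := exists_ne (0 : derived L)
    obtain ⟨y, hi⟩ := exists_linearIndependent_two (by omega) hx
    obtain ⟨p, q, e⟩ := exists_combination_two h2 hi ⟨_, lie_mem_derived (x : L) (y : L)⟩
    have e' : ⁅(x : L), (y : L)⁆ = p • (x : L) + q • (y : L) := congrArg Subtype.val e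
    let v := basisOfLinearIndependentOfCardEqFinrank hi (by simp [h2])
    have v0 : v 0 = x := by simp [v]
    have v1 : v 1 = y := by simp [v]
    have htr : ∀ u : derived L, v.repr ⁅(u : L), v 0⁆ 0 + v.repr ⁅(u : L), v 1⁆ 1 = 0 := by
      intro u
      have := trace_toEnd_eq_zero (derived L) u.2
      rw [LinearMap.trace_eq_matrix_trace ℂ v, Matrix.trace, Fin.sum_univ_two] at this
      simpa [LinearMap.toMatrix_apply] using this
    have k00 : ⁅(x : L), v 0⁆ = 0 := by rw [v0]; exact Subtype.ext (lie_self (x : L))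
    have k01 : ⁅(x : L), v 1⁆ = p • v 0 + q • v 1 := by rw [v0, v1]; exact Subtype.ext e'
    have k10 : ⁅(y : L), v 0⁆ = -(p • v 0 + q • v 1) := by
      rw [v0, v1]; exact Subtype.ext (lie_eq_neg_of_lie e')
    have k11 : ⁅(y : L), v 1⁆ = 0 := by rw [v1]; exact Subtype.ext (lie_self (y : L))
    have hq := htr x
    have hp := htr y
    simp [k00, k01] at hq
    simp [k10, k11] at hp
    rw [hp, hq, zero_smul, zero_smul, add_zero] at e'
    intro u u'
    obtain ⟨a, b, rfl⟩ := exists_combination_two h2 hi u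
    obtain ⟨a', b', rfl⟩ := exists_combination_two h2 hi u'
    simp [e', lie_eq_neg_of_lie e']
  have hcomm : ∀ (u v : L) (z : derived L), ⁅u, ⁅v, (z : L)⁆⁆ = ⁅v, ⁅u, (z : L)⁆⁆ := by
    intro u v z
    rw [leibniz_lie, hab ⟨_, lie_mem_derived u v⟩ z, zero_add]
  obtain ⟨a0, ha0⟩ := exists_ne (0 : derived L)
  obtain ⟨b0, hi0⟩ := exists_linearIndependent_two (by omega) ha0
  obtain ⟨c, hi1⟩ := exists_linearIndependent_three (by omega)
    (linearIndependent_coe_two hi0)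
  obtain ⟨d, hi⟩ := exists_linearIndependent_four (by omega) hi1
  obtain ⟨a, α, β, ha, hca, hda⟩ := exists_common_eigenvector
    (LieModule.toEnd ℂ L (derived L) c) (LieModule.toEnd ℂ L (derived L) d) fun z =>
      Subtype.ext (hcomm c d z)
  replace hca : ⁅c, (a : L)⁆ = α • (a : L) := congrArg Subtype.val hca
  replace hda : ⁅d, (a : L)⁆ = β • (a : L) := congrArg Subtype.val hda
  obtain ⟨b, hi2⟩ := exists_linearIndependent_two (by omega) ha
  have hcomb : ∀ u v : L, ∃ p q : ℂ, ⁅u, v⁆ = p • (a : L) + q • (b : L) := by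
    intro u v
    obtain ⟨p, q, e⟩ := exists_combination_two h2 hi2 ⟨_, lie_mem_derived u v⟩
    exact ⟨p, q, congrArg Subtype.val e⟩
  have hi4 : ∀ p q r s : ℂ, p • (a : L) + q • (b : L) + r • c + s • d = 0 →
      p = 0 ∧ q = 0 ∧ r = 0 ∧ s = 0 := by
    intro p q r s e
    obtain ⟨x, y, hxy⟩ := exists_combination_two h2 hi0 (p • a + q • b)
    have hxy' : p • (a : L) + q • (b : L) = x • (a0 : L) + y • (b0 : L) :=
      congrArg Subtype.val hxy
    rw [hxy'] at e
    obtain ⟨rfl, rfl, rfl, rfl⟩ := linearIndependent_four_iff.1 hi x y r s e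
    obtain ⟨hp, hq⟩ := LinearIndependent.pair_iff.1 hi2 p q (by rw [hxy]; module)
    exact ⟨hp, hq, rfl, rfl⟩
  obtain ⟨γ, α', hcb⟩ := hcomb c b
  obtain ⟨δ, β', hdb⟩ := hcomb d b
  by_cases hΔ : α * β' - α' * β = 0
  -- A zero determinant yields a nonzero combination s c + t d with both weights zero; together with
  -- a and b it spans a nilpotent ideal containing L'.
  · obtain ⟨s, t, hst, h1, h2⟩ : ∃ s t : ℂ, (s ≠ 0 ∨ t ≠ 0) ∧ s * α + t * β = 0 ∧
        s * α' + t * β' = 0 := by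
      by_cases h1 : α = 0 ∧ β = 0
      · by_cases h2 : α' = 0 ∧ β' = 0
        · exact ⟨1, 0, Or.inl one_ne_zero, by simp [h1], by simp [h2]⟩
        · refine ⟨β', -α', ?_, by simp [h1], by ring⟩
          rw [neg_ne_zero]
          tauto
      · refine ⟨β, -α, ?_, by ring, by linear_combination -hΔ⟩
        rw [neg_ne_zero]
        tauto
    refine classified_of_nilpotent_span hL hna (x := a) (y := b) (z := s • c + t • d)
      (r := -(s * γ + t * δ)) (linearIndependent_three.2 fun p q r e => ?_) (hab a b) ?_ ?_
      fun u v => ?_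
    · obtain ⟨e1, e2, e3, e4⟩ := hi4 p q (r * s) (r * t) (by rw [← e]; module)
      refine ⟨e1, e2, ?_⟩
      rcases hst with h | h
      · exact (mul_eq_zero.1 e3).resolve_right h
      · exact (mul_eq_zero.1 e4).resolve_right h
    · rw [← lie_skew, add_lie, smul_lie, smul_lie, hca, hda, smul_smul, smul_smul, ← add_smul, h1,
        zero_smul, neg_zero]
    · have : ⁅s • c + t • d, (b : L)⁆ =
          (s * γ + t * δ) • (a : L) + (s * α' + t * β') • (b : L) := by
        rw [add_lie, smul_lie, smul_lie, hcb, hdb]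
        module
      rw [lie_eq_neg_of_lie this, h2]
      module
    · obtain ⟨p, q, e⟩ := hcomb u v
      exact ⟨p, q, 0, by rw [e]; module⟩
  · obtain ⟨i, hi⟩ : ∃ i : ℂ, i * (α * β' - α' * β) = 1 := ⟨_, inv_mul_cancel₀ hΔ⟩
    obtain ⟨p, q, hpq⟩ := hcomb ((i * β') • c - (i * α') • d) ((i * α) • d - (i * β) • c)
    -- The combinations of c and d come from the inverse of the weight matrix, with `i` the inverse
    -- determinant, and have weights (1,0) and (0,1).
    refine classified_of_diagonal hL (a := a) (b := b) (c := (i * β') • c - (i * α') • d)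
      (d := (i * α) • d - (i * β) • c) (g := i * β' * γ - i * α' * δ)
      (e := i * α * δ - i * β * γ) (linearIndependent_four_iff.2 fun s t u v e => ?_) (hab a b)
      ?_ ?_ ?_ ?_ hpq
    · obtain ⟨e1, e2, e3, e4⟩ := hi4 s t (u * (i * β') - v * (i * β)) (v * (i * α) - u * (i * α'))
        (by rw [← e]; module)
      exact ⟨e1, e2, by linear_combination α * e3 + β * e4 - u * hi,
        by linear_combination α' * e3 + β' * e4 - v * hi⟩
    · rw [sub_lie, smul_lie, smul_lie, hca, hda]
      match_scalars
      linear_combination hi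
    · rw [sub_lie, smul_lie, smul_lie, hcb, hdb]
      module
    · rw [sub_lie, smul_lie, smul_lie, hca, hda]
      module
    · rw [sub_lie, smul_lie, smul_lie, hcb, hdb]
      match_scalars
      · ring
      · linear_combination hi

/-- The classification of the four-dimensional complex Lie algebras. -/
theorem classified_of_not_isLieAbelian (hL : finrank ℂ L = 4) (hna : ¬IsLieAbelian L) :
    Classified L := by
  have : Module.Finite ℂ L := Module.finite_of_finrank_pos (by omega)
  have hle : finrank ℂ (derived L) ≤ 4 := hL ▸ Submodule.finrank_le (derived L).toSubmodule
  have h0 : finrank ℂ (derived L) ≠ 0 := fun h0 => by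
    have := finrank_zero_iff.1 h0
    exact hna ⟨fun u v => congrArg Subtype.val
      (Subsingleton.elim (⟨_, lie_mem_derived u v⟩ : derived L) 0)⟩
  have h4 := finrank_derived_ne_four hL
  obtain h | h | h : finrank ℂ (derived L) = 1 ∨ finrank ℂ (derived L) = 2 ∨
      finrank ℂ (derived L) = 3 := by omega
  · exact classified_of_finrank_derived_eq_one hL hna h
  · exact classified_of_finrank_derived_eq_two hL hna h
  · exact classified_of_finrank_derived_eq_three hL hna h

end Derived

end FourDimLie

theorem mainTheorem3 :
    -- Row by row, the table of the dimensions of `H¹, H², H³, H⁴`.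
    FourDimLie.HasCohomologyDims FourDimLie.d3.Alg 1 0 1 1 ∧
    FourDimLie.HasCohomologyDims FourDimLie.d2Sharp.Alg 0 0 0 0 ∧
    -- The family `d₁(l:m)`.
    (∀ l m : ℂ, (l ≠ 0 ∨ m ≠ 0) →
      (l + m = 0 → FourDimLie.HasCohomologyDims (FourDimLie.d1Fam l m).Alg 2 2 2 1) ∧
      (l = 0 ∨ m = 0 → FourDimLie.HasCohomologyDims (FourDimLie.d1Fam l m).Alg 1 2 1 0) ∧
      (l + m ≠ 0 → l ≠ 0 → m ≠ 0 →
        FourDimLie.HasCohomologyDims (FourDimLie.d1Fam l m).Alg 1 1 0 0)) ∧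
    FourDimLie.HasCohomologyDims FourDimLie.d1Sharp.Alg 3 3 0 0 ∧
    -- The family `d₃(l:m:n)`.
    (∀ l m n : ℂ, (l ≠ 0 ∨ m ≠ 0 ∨ n ≠ 0) →
      ((l = 0 ∨ m = 0 ∨ n = 0) → l + m + n = 0 →
        FourDimLie.HasCohomologyDims (FourDimLie.d3Big l m n).Alg 3 5 5 2) ∧
      ((l ≠ 0 ∧ m ≠ 0 ∧ n ≠ 0) → (l = m + n ∨ m = l + n ∨ n = l + m) →
        FourDimLie.HasCohomologyDims (FourDimLie.d3Big l m n).Alg 2 3 1 0) ∧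
      ((l = 0 ∨ m = 0 ∨ n = 0) → l + m + n ≠ 0 →
        FourDimLie.HasCohomologyDims (FourDimLie.d3Big l m n).Alg 3 3 1 0) ∧
      ((l ≠ 0 ∧ m ≠ 0 ∧ n ≠ 0) → l + m + n = 0 →
        FourDimLie.HasCohomologyDims (FourDimLie.d3Big l m n).Alg 2 2 1 1) ∧
      ((l ≠ 0 ∧ m ≠ 0 ∧ n ≠ 0) → (l ≠ m + n ∧ m ≠ l + n ∧ n ≠ l + m) → l + m + n ≠ 0 →
        FourDimLie.HasCohomologyDims (FourDimLie.d3Big l m n).Alg 2 2 0 0)) ∧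
    -- The family `d₃(l:m)`.
    (∀ l m : ℂ, (l ≠ 0 ∨ m ≠ 0) →
      (m = 0 → FourDimLie.HasCohomologyDims (FourDimLie.d3Small l m).Alg 5 7 3 0) ∧
      (l = 0 → FourDimLie.HasCohomologyDims (FourDimLie.d3Small l m).Alg 6 6 2 0) ∧
      (m = 2 * l → FourDimLie.HasCohomologyDims (FourDimLie.d3Small l m).Alg 4 5 1 0) ∧
      (m = -2 * l → FourDimLie.HasCohomologyDims (FourDimLie.d3Small l m).Alg 4 4 1 1) ∧
      (m ≠ 0 → l ≠ 0 → m ≠ 2 * l → m ≠ -2 * l →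
        FourDimLie.HasCohomologyDims (FourDimLie.d3Small l m).Alg 4 4 0 0)) ∧
    FourDimLie.HasCohomologyDims FourDimLie.d1.Alg 8 13 10 3 ∧
    FourDimLie.HasCohomologyDims FourDimLie.d2Star.Alg 4 6 5 2 ∧
    FourDimLie.HasCohomologyDims FourDimLie.d3Star.Alg 8 8 0 0 ∧
    -- The table covers every four-dimensional complex Lie algebra with a nonzero bracket.
    (∀ (L : Type*) [LieRing L] [LieAlgebra ℂ L], Module.finrank ℂ L = 4 → ¬ IsLieAbelian L →
      Nonempty (L ≃ₗ⁅ℂ⁆ FourDimLie.d3.Alg) ∨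
      Nonempty (L ≃ₗ⁅ℂ⁆ FourDimLie.d2Sharp.Alg) ∨
      (∃ l m : ℂ, (l ≠ 0 ∨ m ≠ 0) ∧ Nonempty (L ≃ₗ⁅ℂ⁆ (FourDimLie.d1Fam l m).Alg)) ∨
      Nonempty (L ≃ₗ⁅ℂ⁆ FourDimLie.d1Sharp.Alg) ∨
      (∃ l m n : ℂ, (l ≠ 0 ∨ m ≠ 0 ∨ n ≠ 0) ∧
        Nonempty (L ≃ₗ⁅ℂ⁆ (FourDimLie.d3Big l m n).Alg)) ∨
      (∃ l m : ℂ, (l ≠ 0 ∨ m ≠ 0) ∧ Nonempty (L ≃ₗ⁅ℂ⁆ (FourDimLie.d3Small l m).Alg)) ∨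
      Nonempty (L ≃ₗ⁅ℂ⁆ FourDimLie.d1.Alg) ∨
      Nonempty (L ≃ₗ⁅ℂ⁆ FourDimLie.d2Star.Alg) ∨
      Nonempty (L ≃ₗ⁅ℂ⁆ FourDimLie.d3Star.Alg)) ∧
    -- For the zero bracket every cochain is a nontrivial cocycle.
    (∀ (L : Type*) [LieRing L] [LieAlgebra ℂ L], Module.finrank ℂ L = 4 → IsLieAbelian L →
      FourDimLie.HasCohomologyDims L 16 24 16 4) ∧
    -- Rigidity of `d₃ = sl₂ ⊕ ℂ`.
    Subsingleton (FourDimLie.Cohomology FourDimLie.d3.Alg 2) ∧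
    FourDimLie.IsRigid FourDimLie.d3 ∧
    -- All cohomology of `d₂♯ = r₂ ⊕ r₂` vanishes, and `d₂♯` is rigid.
    (∀ n : ℕ, Subsingleton (FourDimLie.Cohomology FourDimLie.d2Sharp.Alg n)) ∧
    FourDimLie.IsRigid FourDimLie.d2Sharp := by
  refine ⟨FourDimLie.hasCohomologyDims_d3, FourDimLie.hasCohomologyDims_d2Sharp,
    FourDimLie.hasCohomologyDims_d1Fam, FourDimLie.hasCohomologyDims_d1Sharp,
    FourDimLie.hasCohomologyDims_d3Big, FourDimLie.hasCohomologyDims_d3Small,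
    FourDimLie.hasCohomologyDims_d1, FourDimLie.hasCohomologyDims_d2Star,
    FourDimLie.hasCohomologyDims_d3Star, fun L _ _ hL h => FourDimLie.classified_of_not_isLieAbelian hL h,
    fun L _ _ hL h => FourDimLie.hasCohomologyDims_of_isLieAbelian L hL h,
    FourDimLie.subsingleton_cohomology_d3_two, ?_, FourDimLie.subsingleton_cohomology_d2Sharp, ?_⟩
  · have := FourDimLie.subsingleton_cohomology_d3_two
    exact FourDimLie.isRigid_of_subsingleton_cohomology _
  · have := FourDimLie.subsingleton_cohomology_d2Sharp 2
    exact FourDimLie.isRigid_of_subsingleton_cohomology _
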